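/- **Setting.** Let $N\ge 0$, let $\Omega\subset\mathbb{C}$ be open, and let $A(x;\lambda)\in\mathbb{C}^{N\times N}$, $x\in\mathbb{R}$, $\lambda\in\Omega$, be bounded and continuous in $x$ for every $\lambda$, analytic in $\lambda$ for every $x$, and bounded on $\mathbb{R}\times U$ for some neighbourhood $U$ of each point of $\Omega$. Suppose that the limits $A_\pm(\lambda)=\lim_{x\to\pm\infty}A(x;\lambda)$ exist for all $\lambda\in\Omega$, and that for every $\lambda\in\Omega$ the operator $$\mathcal{T}(\lambda)=\frac{d}{dx}-A(x;\lambda)$$ on $L^2(\mathbb{R},\mathbb{C}^N)$ with domain $H^1(\mathbb{R},\mathbb{C}^N)$ is Fredholm of index $0$. Let $E^{\mathrm u}_-(\lambda)$ be the sum of the generalized eigenspaces of $A_-(\lambda)$ to eigenvalues with positive real part, and $E^{\mathrm s}_+(\lambda)$ the sum of the generalized eigenspaces of $A_+(\lambda)$ to eigenvalues with negative real part. For $\lambda\in\Omega$ let $E^{\mathrm u}_-(x;\lambda)$ and $E^{\mathrm s}_+(x;\lambda)$, $x\in\mathbb{R}$, be families of subspaces of $\mathbb{C}^N$ that are invariant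 under the flow of $u_x=A(x;\lambda)u$ and converge in the Grassmannian, $E^{\mathrm u}_-(x;\lambda)\to E^{\mathrm u}_-(\lambda)$ as $x\to-\infty$ and $E^{\mathrm s}_+(x;\lambda)\to E^{\mathrm s}_+(\lambda)$ as $x\to+\infty$. Let $w_1,\dots,w_N:\Omega\to\mathbb{C}^N$ be analytic such that, for every $\lambda\in\Omega$, $w_1(\lambda),\dots,w_k(\lambda)$ is a basis of $E^{\mathrm u}_-(0;\lambda)$ and $w_{k+1}(\lambda),\dots,w_N(\lambda)$ is a basis of $E^{\mathrm s}_+(0;\lambda)$. Define $$\iota(\lambda):\mathbb{C}^N\to\mathbb{C}^N,\qquad \iota(\lambda)c=\sum_{j\le k}c_jw_j(\lambda)-\sum_{j>k}c_jw_j(\lambda),\qquad \mathcal{E}(\lambda)=\det\iota(\lambda).$$ **Multiplicities.** Let $T(\lambda):X\to Y$ be a family of linear operators (here $\mathcal{T}$, with $X=H^1$, $Y=L^2$, or $\iota$, with $X=Y=\mathbb{C}^N$). The geometric multiplicity of $\lambda_*$ is $\dim\ker T(\lambda_*)$. A root function of order $p$ at $\lambda_*$ is a polynomial $u(\lambda)=\sum_{j=0}^p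 u_j(\lambda-\lambda_*)^j$ with $u_j\in X$ and $T(\lambda)u(\lambda)=\mathcal{O}((\lambda-\lambda_*)^{p+1})$ in $Y$ as $\lambda\to\lambda_*$. The root functions of order $p$ form a linear space, which multiplication by $\lambda-\lambda_*$ embeds into the space of those of order $p+1$. The algebraic multiplicity of $\lambda_*$ is the supremum over $p$ of the dimensions of these spaces. Multiplicities take values in $\{0,1,2,\dots,\infty\}$, and the value is $0$ if $\ker T(\lambda_*)=\{0\}$. **Proposition.** For every $\lambda_*\in\Omega$, the geometric multiplicity of $\lambda_*$ for $\mathcal{T}$ equals that for $\iota$, and the algebraic multiplicity of $\lambda_*$ for $\mathcal{T}$ equals that for $\iota$. Moreover, the algebraic multiplicity of $\lambda_*$ for $\mathcal{T}$ equals the order of vanishing of the Evans function $\mathcal{E}$ at $\lambda_*$ (which is $\infty$ if $\mathcal{E}$ vanishes identically near $\lambda_*$). -/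

import Mathlib

open MeasureTheory Filter Topology Asymptotics
open scoped ContDiff BoundedContinuousFunction

noncomputable section

namespace PointwiseEvans

/-! ### Multiplicities for nonlinear eigenvalue problems (linear operator pencils) -/

section Pencils

variable {X Y : Type*} [AddCommGroup X] [Module ℂ X] [NormedAddCommGroup Y] [NormedSpace ℂ Y]

/-- The linear space of root functions of order `p` of the pencil `T` at `z₀`: polynomials
`u(z) = ∑_{j ≤ p} (z - z₀)^j u_j` (given by their coefficients `u_j`) such that
`T(z) u(z) = O((z - z₀)^(p+1))` in the norm of `Y` as `z → z₀`. -/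
def rootFunctions (T : ℂ → X →ₗ[ℂ] Y) (z₀ : ℂ) (p : ℕ) : Submodule ℂ (Fin (p + 1) → X) where
  carrier := {u | (fun z : ℂ => T z (∑ j : Fin (p + 1), (z - z₀) ^ (j : ℕ) • u j)) =O[𝓝 z₀]
    fun z : ℂ => (z - z₀) ^ (p + 1)}
  zero_mem' := by
    simpa using isBigO_zero (fun z : ℂ => (z - z₀) ^ (p + 1)) (𝓝 z₀)
  add_mem' := by
    intro u v hu hv
    simpa [smul_add, Finset.sum_add_distrib] using IsBigO.add hu hv
  smul_mem' := by
    intro c u hu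
    have h := IsBigO.const_smul_left (c := c) hu
    have e : (fun z : ℂ => T z (∑ j : Fin (p + 1), (z - z₀) ^ (j : ℕ) • (c • u) j)) =
        c • (fun z : ℂ => T z (∑ j : Fin (p + 1), (z - z₀) ^ (j : ℕ) • u j)) := by
      funext z
      simp only [Pi.smul_apply, ← map_smul, Finset.smul_sum]
      congr 1
      exact Finset.sum_congr rfl fun j _ => smul_comm _ _ _
    change _ =O[𝓝 z₀] _
    rw [e]
    exact h

/-- Geometric multiplicity: the dimension of the kernel of `T(z₀)`
(zero if `z₀` is not an eigenvalue). -/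
def geometricMultiplicity (T : ℂ → X →ₗ[ℂ] Y) (z₀ : ℂ) : ℕ∞ :=
  Cardinal.toENat (Module.rank ℂ (LinearMap.ker (T z₀)))

/-- Algebraic multiplicity: the dimension of the space of root functions of arbitrary order.
Multiplication by `z - z₀` embeds the root functions of order `p` into those of order `p + 1`, so
the dimensions increase with `p`, and the dimension for arbitrary order is their supremum
(possibly `⊤`). -/
def algebraicMultiplicity (T : ℂ → X →ₗ[ℂ] Y) (z₀ : ℂ) : ℕ∞ :=
  ⨆ p : ℕ, Cardinal.toENat (Module.rank ℂ (rootFunctions T z₀ p))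

/-- A linear operator is Fredholm of index `0`: its kernel is finite-dimensional, its range is
closed and of finite codimension, and these two dimensions agree. (Here `X` is the domain of the
operator; no topology on it is needed.) -/
def IsFredholmIndexZero (T : X →ₗ[ℂ] Y) : Prop :=
  FiniteDimensional ℂ (LinearMap.ker T) ∧
  IsClosed (LinearMap.range T : Set Y) ∧
  FiniteDimensional ℂ (Y ⧸ LinearMap.range T) ∧
  Module.finrank ℂ (LinearMap.ker T) = Module.finrank ℂ (Y ⧸ LinearMap.range T)

end Pencils

/-! ### The operators `d/dx - A(x)` on `L²(ℝ, ℂᴺ)` with domain `H¹(ℝ, ℂᴺ)` -/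

/-- The space `ℂᴺ`. -/
abbrev CN (N : ℕ) : Type := EuclideanSpace ℂ (Fin N)

/-- Complex `N × N` matrices, as operators on `ℂᴺ`. -/
abbrev Mat (N : ℕ) : Type := CN N →L[ℂ] CN N

/-- The Hilbert space `L²(ℝ, ℂᴺ)`. -/
abbrev L2 (N : ℕ) : Type := Lp (CN N) 2 (volume : Measure ℝ)

variable {N : ℕ}

/-- `g` is the weak derivative of `u`: `∫ φ' u = - ∫ φ g` for all test functions `φ`. -/
def IsWeakDeriv (u g : L2 N) : Prop :=
  ∀ φ : ℝ → ℝ, ContDiff ℝ ∞ φ → HasCompactSupport φ →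
    ∫ x, deriv φ x • u x = - ∫ x, φ x • g x

theorem integrable_test_smul {φ : ℝ → ℝ} (hφ : Continuous φ) (hs : HasCompactSupport φ)
    (u : L2 N) : Integrable (fun x => φ x • u x) :=
  ((Lp.memLp u).locallyIntegrable (by norm_num)).integrable_smul_left_of_hasCompactSupport hφ hs

theorem IsWeakDeriv.add {u g v h : L2 N} (hu : IsWeakDeriv u g) (hv : IsWeakDeriv v h) :
    IsWeakDeriv (u + v) (g + h) := by
  intro φ hφ hs
  have hd : Continuous (deriv φ) := hφ.continuous_deriv (by simp)
  have e1 : ∫ x, deriv φ x • (u + v : L2 N) x =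
      ∫ x, (deriv φ x • u x + deriv φ x • v x) :=
    integral_congr_ae (by filter_upwards [Lp.coeFn_add u v] with x hx; rw [hx, Pi.add_apply, smul_add])
  have e2 : ∫ x, φ x • (g + h : L2 N) x = ∫ x, (φ x • g x + φ x • h x) :=
    integral_congr_ae (by filter_upwards [Lp.coeFn_add g h] with x hx; rw [hx, Pi.add_apply, smul_add])
  rw [e1, e2, integral_add (integrable_test_smul hd hs.deriv u)
      (integrable_test_smul hd hs.deriv v),
    integral_add (integrable_test_smul hφ.continuous hs g)
      (integrable_test_smul hφ.continuous hs h), hu φ hφ hs, hv φ hφ hs, neg_add]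

theorem IsWeakDeriv.smul (c : ℂ) {u g : L2 N} (hu : IsWeakDeriv u g) :
    IsWeakDeriv (c • u) (c • g) := by
  intro φ hφ hs
  have e1 : ∫ x, deriv φ x • (c • u : L2 N) x = ∫ x, c • (deriv φ x • u x) :=
    integral_congr_ae (by
      filter_upwards [Lp.coeFn_smul c u] with x hx
      rw [hx, Pi.smul_apply, smul_comm])
  have e2 : ∫ x, φ x • (c • g : L2 N) x = ∫ x, c • (φ x • g x) :=
    integral_congr_ae (by
      filter_upwards [Lp.coeFn_smul c g] with x hx
      rw [hx, Pi.smul_apply, smul_comm])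
  rw [e1, e2, integral_smul, integral_smul, hu φ hφ hs, smul_neg]

theorem IsWeakDeriv.zero : IsWeakDeriv (0 : L2 N) 0 := by
  intro φ _ _
  have h : ∀ ψ : ℝ → ℝ, ∫ x, ψ x • (0 : L2 N) x = 0 := fun ψ => by
    rw [← integral_zero ℝ (CN N) (μ := volume)]
    exact integral_congr_ae (by
      filter_upwards [Lp.coeFn_zero (CN N) 2 (volume : Measure ℝ)] with x hx
      rw [hx, Pi.zero_apply, smul_zero])
  rw [h, h, neg_zero]

theorem IsWeakDeriv.unique {u g h : L2 N} (hg : IsWeakDeriv u g) (hh : IsWeakDeriv u h) :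
    g = h := by
  apply Lp.ext
  refine ae_eq_of_integral_contDiff_smul_eq ((Lp.memLp g).locallyIntegrable (by norm_num))
    ((Lp.memLp h).locallyIntegrable (by norm_num)) fun φ hφ hs => ?_
  exact neg_injective ((hg φ hφ hs).symm.trans (hh φ hφ hs))

/-- The Sobolev space `H¹(ℝ, ℂᴺ)`, as a subspace of `L²(ℝ, ℂᴺ)`. -/
def H1 (N : ℕ) : Submodule ℂ (L2 N) where
  carrier := {u | ∃ g, IsWeakDeriv u g}
  zero_mem' := ⟨0, IsWeakDeriv.zero⟩
  add_mem' := fun ⟨g, hg⟩ ⟨h, hh⟩ => ⟨g + h, hg.add hh⟩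
  smul_mem' := fun c _ ⟨g, hg⟩ => ⟨c • g, hg.smul c⟩

/-- The weak derivative `d/dx : H¹(ℝ, ℂᴺ) → L²(ℝ, ℂᴺ)`. -/
def weakDeriv (N : ℕ) : H1 N →ₗ[ℂ] L2 N where
  toFun u := u.2.choose
  map_add' u v := (u + v).2.choose_spec.unique (u.2.choose_spec.add v.2.choose_spec)
  map_smul' c u := (c • u).2.choose_spec.unique (u.2.choose_spec.smul c)

theorem isWeakDeriv_weakDeriv (u : H1 N) : IsWeakDeriv (u : L2 N) (weakDeriv N u) :=
  u.2.choose_spec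

theorem memLp_mul (a : ℝ →ᵇ Mat N) (u : L2 N) :
    MemLp (fun x => a x (u x)) 2 (volume : Measure ℝ) := by
  refine (Lp.memLp u).of_le_mul (c := ‖a‖) ?_ (ae_of_all _ fun x => ?_)
  · exact (ContinuousLinearMap.apply ℂ (CN N)).flip.aestronglyMeasurable_comp₂
      a.continuous.aestronglyMeasurable (Lp.aestronglyMeasurable u)
  · exact ((a x).le_opNorm _).trans
      (mul_le_mul_of_nonneg_right (a.norm_coe_le_norm x) (norm_nonneg _))

/-- Pointwise multiplication `u ↦ A(·) u` by a bounded continuous matrix function on `L²`. -/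
def mulOp (a : ℝ →ᵇ Mat N) : L2 N →ₗ[ℂ] L2 N where
  toFun u := (memLp_mul a u).toLp _
  map_add' u v := by
    apply Lp.ext
    filter_upwards [(memLp_mul a (u + v)).coeFn_toLp, (memLp_mul a u).coeFn_toLp,
      (memLp_mul a v).coeFn_toLp, Lp.coeFn_add u v,
      Lp.coeFn_add ((memLp_mul a u).toLp _) ((memLp_mul a v).toLp _)] with x h1 h2 h3 h4 h5
    rw [h1, h5, Pi.add_apply, h2, h3, h4, Pi.add_apply, map_add]
  map_smul' c u := by
    apply Lp.ext
    filter_upwards [(memLp_mul a (c • u)).coeFn_toLp, (memLp_mul a u).coeFn_toLp,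
      Lp.coeFn_smul c u, Lp.coeFn_smul c ((memLp_mul a u).toLp _)] with x h1 h2 h3 h4
    rw [h1, RingHom.id_apply, h4, Pi.smul_apply, h2, h3, Pi.smul_apply, map_smul]

/-- The operator pencil `𝒯(z) = d/dx - A(·; z) : H¹(ℝ, ℂᴺ) → L²(ℝ, ℂᴺ)`. -/
def opPencil (A : ℂ → ℝ →ᵇ Mat N) (z : ℂ) : H1 N →ₗ[ℂ] L2 N :=
  weakDeriv N - mulOp (A z) ∘ₗ (H1 N).subtype

/-! ### Stable and unstable subspaces, and the matching pencil -/

/-- The sum of the generalized eigenspaces of `B` to eigenvalues with positive real part. -/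
def unstableSpace (B : Mat N) : Submodule ℂ (CN N) :=
  ⨆ (ν : ℂ) (_ : 0 < ν.re), Module.End.maxGenEigenspace (B : Module.End ℂ (CN N)) ν

/-- The sum of the generalized eigenspaces of `B` to eigenvalues with negative real part. -/
def stableSpace (B : Mat N) : Submodule ℂ (CN N) :=
  ⨆ (ν : ℂ) (_ : ν.re < 0), Module.End.maxGenEigenspace (B : Module.End ℂ (CN N)) ν

/-- The family of subspaces `E x` is invariant under the flow of `u_x = a(x) u`. -/
def IsInvariantFamily (a : ℝ → Mat N) (E : ℝ → Submodule ℂ (CN N)) : Prop :=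
  ∀ u : ℝ → CN N, (∀ x, HasDerivAt u (a x (u x)) x) → ∀ x y, u x ∈ E x → u y ∈ E y

/-- Convergence of subspaces in the Grassmannian, that is, of their orthogonal projections. -/
def TendstoSubspace (E : ℝ → Submodule ℂ (CN N)) (l : Filter ℝ) (F : Submodule ℂ (CN N)) : Prop :=
  Tendsto (fun x => (E x).starProjection) l (𝓝 F.starProjection)

/-- `x ↦ E x` is the family `E^u_-(x)`: invariant under the flow, and converging as `x → -∞` to
the unstable subspace of the limiting matrix `a_-`. -/
def IsUnstableFamily (a : ℝ → Mat N) (am : Mat N) (E : ℝ → Submodule ℂ (CN N)) : Prop :=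
  IsInvariantFamily a E ∧ TendstoSubspace E atBot (unstableSpace am)

/-- `x ↦ E x` is the family `E^s_+(x)`: invariant under the flow, and converging as `x → +∞` to
the stable subspace of the limiting matrix `a_+`. -/
def IsStableFamily (a : ℝ → Mat N) (ap : Mat N) (E : ℝ → Submodule ℂ (CN N)) : Prop :=
  IsInvariantFamily a E ∧ TendstoSubspace E atTop (stableSpace ap)

/-- The vectors `w i`, `i ∈ s`, form a basis of the subspace `E`. -/
def IsBasisOf (w : Fin N → CN N) (s : Set (Fin N)) (E : Submodule ℂ (CN N)) : Prop :=
  LinearIndepOn ℂ w s ∧ Submodule.span ℂ (w '' s) = E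

/-- The matching pencil `ι(z) : ℂᴺ → ℂᴺ`,
`ι(z) c = ∑_{j < k} c_j w_j(z) - ∑_{j ≥ k} c_j w_j(z)`: the composition of the trivialization
`c ↦ (∑_{j < k} c_j w_j(z), ∑_{j ≥ k} c_j w_j(z))` with `(w^u, w^s) ↦ w^u - w^s`. -/
def matchPencil (k : ℕ) (w : Fin N → ℂ → CN N) (z : ℂ) : CN N →ₗ[ℂ] CN N where
  toFun c := (∑ j ∈ Finset.univ.filter (fun j : Fin N => (j : ℕ) < k), c j • w j z) -
    ∑ j ∈ Finset.univ.filter (fun j : Fin N => k ≤ (j : ℕ)), c j • w j z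
  map_add' c d := by
    simp only [PiLp.add_apply, add_smul, Finset.sum_add_distrib]
    abel
  map_smul' r c := by
    simp only [PiLp.smul_apply, smul_eq_mul, mul_smul, ← Finset.smul_sum, ← smul_sub,
      RingHom.id_apply]

/-- The Evans function `det ι(z)`. -/
def evans (k : ℕ) (w : Fin N → ℂ → CN N) (z : ℂ) : ℂ :=
  LinearMap.det (matchPencil k w z)

end PointwiseEvans

end

/-!
Both pencils have the same spaces of root functions, up to a linear isomorphism which evaluates at
`x = 0`, and for the finite-dimensional pencil `ι` multiplicities are read off from the determinant.

*Root functions of `𝒯` are jets of solutions.* Let `a i` be the Taylor coefficients of `A(·; z)` at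
`z₀`; they are bounded functions of `x`, because a locally bounded, pointwise analytic family is
analytic in the supremum norm (`analyticAt_of_pointwise`). Then `∑ (z - z₀)^m u_m` is a root function
if and only if the coefficients solve the jet system `u_m' = ∑_{j ≤ m} a_{m-j} u_j` and lie in `H¹`.
By regularity of weak solutions they are classical solutions, determined by their values at `x = 0`
(`rank_rootFunctions_opPencil`).

*Square integrable jets.* Fredholmness of `𝒯(z)` forces the limits `A_±(z)` to have no eigenvalues on
the imaginary axis: otherwise cut-offs of `e^{νx} v` far out on the line give arbitrarily many
orthogonal approximate null vectors (`isHyperbolic_of_isFredholm`). A hyperbolic limit has a Lyapunov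
form (`IsHyperbolic.exists_isLyapunov`), which is used twice. It identifies `E^s_+(0; z)` with the set
of initial values of the solutions that are square integrable at `+∞`
(`IsStableFamily.eq_decaySpace`), and it shows that these solutions decay exponentially, uniformly in
`z`. By Cauchy's estimate the jets in `z` of such solutions decay as well, so that a jet solution is
square integrable at `+∞` if and only if its initial value is the jet of a section of the bundle
`E^s_+(0; ·)` (`IsDecayBundle.l2AtTop_jet_iff`). The end `-∞` follows by reflection.

*Matching.* Hence the root functions of `𝒯` of order `p` correspond to the `p`-jets which are sections
of both `E^u_-(0; ·)` and `E^s_+(0; ·)`. In terms of the bases `w_j` these are exactly the root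
functions of `ι` (`rank_rootFunctions_matchPencil`). So the ranks agree for every `p`, which gives the
equality of the algebraic multiplicities, and for `p = 0` that of the geometric ones.

*Determinants.* If `M(z₀)` is a singular matrix, a kernel vector can be split off: `M = M' D` with
`det D = z - z₀`, and the dimensions of the spaces of root functions of `M` and `M'` differ by at most
one, and exactly by one for large orders if they are bounded. By induction the algebraic multiplicity
is the order of vanishing of `det M` (`algebraicMultiplicity_clmPencil`).
-/

noncomputable section

namespace PointwiseEvans

/-! ### Taylor jets -/

section Jets

variable {E F G : Type*} [NormedAddCommGroup E] [NormedSpace ℂ E] [NormedAddCommGroup F]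
  [NormedSpace ℂ F] [NormedAddCommGroup G] [NormedSpace ℂ G]

/-- The polynomial `∑_{j < n} (z - z₀)^j u_j` with coefficient vector `u`. -/
def jetPoly {V : Type*} [AddCommMonoid V] [Module ℂ V] {n : ℕ} (z₀ : ℂ) (u : Fin n → V) (z : ℂ) :
    V :=
  ∑ j : Fin n, (z - z₀) ^ (j : ℕ) • u j

/-- The coefficients `a i` are Taylor coefficients of `f` at `z₀`, to every order. -/
def IsTaylor (f : ℂ → E) (z₀ : ℂ) (a : ℕ → E) : Prop :=
  ∀ n : ℕ, (fun z => f z - ∑ i ∈ Finset.range n, (z - z₀) ^ i • a i) =O[𝓝 z₀]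
    fun z => (z - z₀) ^ n

theorem isTaylor_of_hasFPowerSeriesAt {f : ℂ → E} {z₀ : ℂ} {p : FormalMultilinearSeries ℂ ℂ E}
    (hp : HasFPowerSeriesAt f p z₀) : IsTaylor f z₀ p.coeff := by
  intro n
  have h := hp.isBigO_sub_partialSum_pow n
  have ht : Tendsto (fun z : ℂ => z - z₀) (𝓝 z₀) (𝓝 0) := by
    have : Continuous (fun z : ℂ => z - z₀) := by fun_prop
    simpa using this.tendsto z₀
  have h2 := h.comp_tendsto ht
  refine IsBigO.congr' (h2.trans (isBigO_of_le _ fun z => ?_)) ?_ (EventuallyEq.refl _ _)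
    (g₁ := fun z => (z - z₀) ^ n)
  · simp
  · refine Eventually.of_forall fun z => ?_
    simp [FormalMultilinearSeries.partialSum]

theorem exists_isTaylor {f : ℂ → E} {z₀ : ℂ} (hf : AnalyticAt ℂ f z₀) :
    ∃ a, IsTaylor f z₀ a := by
  obtain ⟨p, hp⟩ := hf
  exact ⟨p.coeff, isTaylor_of_hasFPowerSeriesAt hp⟩

theorem tendsto_sub_pow (z₀ : ℂ) {n : ℕ} (hn : n ≠ 0) :
    Tendsto (fun z : ℂ => (z - z₀) ^ n) (𝓝 z₀) (𝓝 0) := by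
  have : Continuous (fun z : ℂ => (z - z₀) ^ n) := by fun_prop
  simpa [hn] using this.tendsto z₀

theorem IsTaylor.coeff_zero {f : ℂ → E} {z₀ : ℂ} {a : ℕ → E} (h : IsTaylor f z₀ a) :
    a 0 = f z₀ := by
  have h1 := (h 1).bound
  obtain ⟨C, hC⟩ := h1
  have := hC.self_of_nhds
  simp only [Finset.range_one, Finset.sum_singleton, sub_self, pow_zero, one_smul, pow_one,
    norm_zero, mul_zero, norm_le_zero_iff] at this
  exact (sub_eq_zero.1 this).symm

theorem IsTaylor.exists_bound {f : ℂ → E} {z₀ : ℂ} {a : ℕ → E} (h : IsTaylor f z₀ a) :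
    ∃ C : ℝ, ∀ᶠ z in 𝓝 z₀, ‖f z‖ ≤ C := by
  obtain ⟨C, hC⟩ := (h 0).bound
  exact ⟨C, by simpa using hC⟩

theorem eventually_norm_le_add_one {f : ℂ → E} {z₀ : ℂ} (hf : AnalyticAt ℂ f z₀) :
    ∀ᶠ z in 𝓝 z₀, ‖f z‖ ≤ ‖f z₀‖ + 1 := by
  filter_upwards [hf.continuousAt.norm.eventually_lt_const (lt_add_one _)] with z hz using hz.le

theorem analyticAt_clm_apply {f : ℂ → E →L[ℂ] F} {g : ℂ → E} {z₀ : ℂ}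
    (hf : AnalyticAt ℂ f z₀) (hg : AnalyticAt ℂ g z₀) : AnalyticAt ℂ (fun z => f z (g z)) z₀ :=
  AnalyticAt.comp (𝕜 := ℂ) (f := fun z => (f z, g z)) (x := z₀)
    ((ContinuousLinearMap.id ℂ (E →L[ℂ] F)).analyticAt_bilinear (f z₀, g z₀)) (hf.prod hg)

theorem analyticAt_clm_comp {f : ℂ → E} {z₀ : ℂ} (hf : AnalyticAt ℂ f z₀) (L : E →L[ℂ] F) :
    AnalyticAt ℂ (fun z => L (f z)) z₀ :=
  (L.analyticAt (f z₀)).comp hf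

theorem IsTaylor.clm_comp {f : ℂ → E} {z₀ : ℂ} {a : ℕ → E} (h : IsTaylor f z₀ a)
    (L : E →L[ℂ] F) : IsTaylor (fun z => L (f z)) z₀ (fun i => L (a i)) := by
  intro n
  refine ((L.isBigO_comp _ _).trans (h n)).congr_left fun z => ?_
  simp [map_sub, map_sum]

theorem IsTaylor.sub {f g : ℂ → E} {z₀ : ℂ} {a b : ℕ → E} (hf : IsTaylor f z₀ a)
    (hg : IsTaylor g z₀ b) : IsTaylor (fun z => f z - g z) z₀ (fun i => a i - b i) := by
  intro n
  refine ((hf n).sub (hg n)).congr_left fun z => ?_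
  simp only [smul_sub, Finset.sum_sub_distrib]
  abel

/-- The Taylor convolution of operator coefficients `a` with a coefficient vector `u`: the first
`n` Taylor coefficients of `f(z) u(z)` if `a` are those of `f` and `u` are those of `u(z)`. -/
def conv {n : ℕ} (a : ℕ → E →L[ℂ] F) (u : Fin n → E) : Fin n → F :=
  fun m => ∑ j ∈ Finset.Iic m, a ((m : ℕ) - j) (u j)

theorem conv_add {n : ℕ} (a : ℕ → E →L[ℂ] F) (u v : Fin n → E) :
    conv a (u + v) = conv a u + conv a v := by
  funext m
  simp [conv, Finset.sum_add_distrib]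

theorem conv_smul {n : ℕ} (a : ℕ → E →L[ℂ] F) (c : ℂ) (u : Fin n → E) :
    conv a (c • u) = c • conv a u := by
  funext m
  simp [conv, Finset.smul_sum]

theorem conv_sub_left {n : ℕ} (a b : ℕ → E →L[ℂ] F) (u : Fin n → E) :
    conv (fun i => a i - b i) u = conv a u - conv b u := by
  funext m
  simp [conv, Finset.sum_sub_distrib]

/-- The Taylor convolution with fixed coefficients, as a linear map. -/
@[simps] def convₗ (n : ℕ) (a : ℕ → E →L[ℂ] F) : (Fin n → E) →ₗ[ℂ] (Fin n → F) where
  toFun := conv a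
  map_add' := conv_add a
  map_smul' := conv_smul a

theorem sum_Ici_eq_sum_range {V : Type*} [AddCommMonoid V] {n : ℕ} (j : Fin n) (g : ℕ → V) :
    ∑ m ∈ Finset.Ici j, g m = ∑ i ∈ Finset.range (n - j), g (j + i) := by
  have h := Finset.sum_map (Finset.Ici j) Fin.valEmbedding g
  rw [Fin.map_valEmbedding_Ici, Finset.sum_Ico_eq_sum_range] at h
  exact h.symm

/-- The exact remainder in the multiplication of a jet by an operator family: it is a combination of
the Taylor remainders of the family. -/
theorem apply_jetPoly_sub {n : ℕ} (f : ℂ → E →L[ℂ] F) (a : ℕ → E →L[ℂ] F) (z₀ z : ℂ)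
    (u : Fin n → E) :
    f z (jetPoly z₀ u z) - jetPoly z₀ (conv a u) z =
      ∑ j : Fin n, (z - z₀) ^ (j : ℕ) •
        (f z - ∑ i ∈ Finset.range (n - j), (z - z₀) ^ i • a i) (u j) := by
  have h : jetPoly z₀ (conv a u) z = ∑ j : Fin n, (z - z₀) ^ (j : ℕ) •
      (∑ i ∈ Finset.range (n - j), (z - z₀) ^ i • a i) (u j) := by
    simp only [jetPoly, conv, Finset.smul_sum]
    rw [Finset.sum_comm' (t' := Finset.univ) (s' := fun j : Fin n => Finset.Ici j)
      (by simp)]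
    refine Finset.sum_congr rfl fun j _ => ?_
    rw [sum_Ici_eq_sum_range j fun m => (z - z₀) ^ m • (a (m - j)) (u j)]
    simp [Finset.smul_sum, pow_add, mul_smul]
  rw [h, jetPoly, map_sum, ← Finset.sum_sub_distrib]
  refine Finset.sum_congr rfl fun j _ => ?_
  rw [map_smul, sub_apply, smul_sub]

/-- Modulo `O((z - z₀)^n)`, an operator family acts on jets by convolution with its Taylor
coefficients. -/
theorem IsTaylor.apply_jetPoly {f : ℂ → E →L[ℂ] F} {z₀ : ℂ} {a : ℕ → E →L[ℂ] F}
    (h : IsTaylor f z₀ a) {n : ℕ} (u : Fin n → E) :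
    (fun z => f z (jetPoly z₀ u z) - jetPoly z₀ (conv a u) z) =O[𝓝 z₀]
      fun z => (z - z₀) ^ n := by
  simp only [apply_jetPoly_sub]
  refine IsBigO.fun_sum fun j _ => ?_
  have h1 := (h (n - j)).bound
  obtain ⟨C, hC⟩ := h1
  refine IsBigO.of_bound (C * ‖u j‖) ?_
  filter_upwards [hC] with z hz
  have e : n = j + (n - j) := by omega
  rw [norm_smul, norm_pow, norm_pow]
  conv_rhs => rw [e, pow_add]
  calc ‖z - z₀‖ ^ (j : ℕ) * _ ≤ ‖z - z₀‖ ^ (j : ℕ) * (C * ‖(z - z₀) ^ (n - j)‖ * ‖u j‖) := by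
        gcongr
        exact (ContinuousLinearMap.le_opNorm _ _).trans (by gcongr)
    _ = _ := by rw [norm_pow]; ring

theorem jetPoly_succ {V : Type*} [AddCommMonoid V] [Module ℂ V] {n : ℕ} (z₀ : ℂ)
    (u : Fin (n + 1) → V) (z : ℂ) :
    jetPoly z₀ u z = u 0 + (z - z₀) • jetPoly z₀ (fun j : Fin n => u j.succ) z := by
  simp [jetPoly, Fin.sum_univ_succ, Finset.smul_sum, smul_smul, pow_succ']

theorem jetPoly_castSucc {V : Type*} [AddCommMonoid V] [Module ℂ V] {n : ℕ} (z₀ : ℂ)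
    (u : Fin (n + 1) → V) (z : ℂ) :
    jetPoly z₀ u z = jetPoly z₀ (fun j : Fin n => u j.castSucc) z
      + (z - z₀) ^ n • u (Fin.last n) := by
  simp [jetPoly, Fin.sum_univ_castSucc]

theorem jetPoly_add {V : Type*} [AddCommMonoid V] [Module ℂ V] {n : ℕ} (z₀ : ℂ)
    (u v : Fin n → V) (z : ℂ) :
    jetPoly z₀ (u + v) z = jetPoly z₀ u z + jetPoly z₀ v z := by
  simp [jetPoly, Finset.sum_add_distrib]

theorem jetPoly_sub {V : Type*} [AddCommGroup V] [Module ℂ V] {n : ℕ} (z₀ : ℂ)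
    (u v : Fin n → V) (z : ℂ) :
    jetPoly z₀ (u - v) z = jetPoly z₀ u z - jetPoly z₀ v z := by
  simp [jetPoly, smul_sub]

theorem map_jetPoly {V W : Type*} [AddCommMonoid V] [Module ℂ V] [AddCommMonoid W] [Module ℂ W]
    {n : ℕ} (z₀ : ℂ) (L : V →ₗ[ℂ] W) (u : Fin n → V) (z : ℂ) :
    L (jetPoly z₀ u z) = jetPoly z₀ (fun j => L (u j)) z := by
  simp [jetPoly]

@[fun_prop] theorem continuous_jetPoly {n : ℕ} (z₀ : ℂ) (u : Fin n → E) :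
    Continuous (jetPoly z₀ u) := by
  unfold jetPoly
  fun_prop

/-- A polynomial of degree less than `n` that vanishes to order `n` is zero. -/
theorem eq_zero_of_jetPoly_isBigO {n : ℕ} {z₀ : ℂ} (u : Fin n → E)
    (h : jetPoly z₀ u =O[𝓝[≠] z₀] fun z => (z - z₀) ^ n) : u = 0 := by
  induction n with
  | zero => exact Subsingleton.elim _ _
  | succ n ih =>
    have h0 : u 0 = 0 := by
      have h1 : Tendsto (jetPoly z₀ u) (𝓝[≠] z₀) (𝓝 (jetPoly z₀ u z₀)) :=
        (continuous_jetPoly z₀ u).continuousAt.tendsto.mono_left nhdsWithin_le_nhds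
      have h2 := h.trans_tendsto
        ((tendsto_sub_pow z₀ n.succ_ne_zero).mono_left nhdsWithin_le_nhds)
      have h3 := tendsto_nhds_unique h1 h2
      rwa [jetPoly_succ, sub_self, zero_smul, add_zero] at h3
    have h1 := ih (fun j => u j.succ) (by
      obtain ⟨C, hC⟩ := h.bound
      refine IsBigO.of_bound C ?_
      filter_upwards [hC, self_mem_nhdsWithin] with z hz hne
      have hne' : 0 < ‖z - z₀‖ := norm_pos_iff.2 (sub_ne_zero.2 hne)
      rw [jetPoly_succ, h0, zero_add, norm_smul, norm_pow, pow_succ'] at hz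
      rw [norm_pow]
      refine le_of_mul_le_mul_left (hz.trans_eq ?_) hne'
      ring)
    funext j
    refine Fin.cases h0 (fun j => congrFun h1 j) j

/-- Conditions modulo `O((z - z₀)^n)` on jets are equations between their coefficients. -/
theorem jetPoly_isBigO_iff {n : ℕ} {z₀ : ℂ} {u : Fin n → E} :
    (jetPoly z₀ u =O[𝓝 z₀] fun z => (z - z₀) ^ n) ↔ u = 0 := by
  refine ⟨fun h => eq_zero_of_jetPoly_isBigO u (h.mono nhdsWithin_le_nhds), ?_⟩
  rintro rfl
  have : jetPoly z₀ (0 : Fin n → E) = fun _ => 0 := by funext z; simp [jetPoly]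
  rw [this]
  exact isBigO_zero _ _

theorem IsTaylor.apply_jetPoly_isBigO_iff {f : ℂ → E →L[ℂ] F} {z₀ : ℂ} {a : ℕ → E →L[ℂ] F}
    (h : IsTaylor f z₀ a) {n : ℕ} (u : Fin n → E) :
    ((fun z => f z (jetPoly z₀ u z)) =O[𝓝 z₀] fun z => (z - z₀) ^ n) ↔ conv a u = 0 := by
  rw [← jetPoly_isBigO_iff (z₀ := z₀)]
  constructor
  · intro h1
    exact (h1.sub (h.apply_jetPoly u)).congr_left fun z => by abel
  · intro h1
    exact (h1.add (h.apply_jetPoly u)).congr_left fun z => by abel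

end Jets

/-! ### Algebraic multiplicity of analytic matrix families -/

section Matrices

variable {E : Type*} [NormedAddCommGroup E] [NormedSpace ℂ E]

/-- A family of continuous linear maps, seen as a pencil of linear maps. -/
def clmPencil {F : Type*} [NormedAddCommGroup F] [NormedSpace ℂ F] (M : ℂ → E →L[ℂ] F) (z : ℂ) :
    E →ₗ[ℂ] F := M z

theorem mem_rootFunctions_iff {X Y : Type*} [AddCommGroup X] [Module ℂ X] [NormedAddCommGroup Y]
    [NormedSpace ℂ Y] {T : ℂ → X →ₗ[ℂ] Y} {z₀ : ℂ} {p : ℕ} {u : Fin (p + 1) → X} :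
    u ∈ rootFunctions T z₀ p ↔
      (fun z => T z (jetPoly z₀ u z)) =O[𝓝 z₀] fun z => (z - z₀) ^ (p + 1) := Iff.rfl

theorem analyticAt_det [FiniteDimensional ℂ E] {M : ℂ → E →L[ℂ] E} {z₀ : ℂ}
    (hM : AnalyticAt ℂ M z₀) :
    AnalyticAt ℂ (fun z => LinearMap.det (clmPencil M z)) z₀ := by
  classical
  let b := Module.finBasis ℂ E
  have h : (fun z => LinearMap.det (clmPencil M z)) =
      fun z => ∑ σ : Equiv.Perm (Fin (Module.finrank ℂ E)), (Equiv.Perm.sign σ : ℂ) *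
        ∏ i, b.repr (M z (b i)) (σ i) := by
    funext z
    rw [← LinearMap.det_toMatrix b, Matrix.det_apply']
    simp [LinearMap.toMatrix_apply, clmPencil]
  rw [h]
  refine Finset.analyticAt_fun_sum _ fun σ _ => analyticAt_const.mul ?_
  refine Finset.analyticAt_fun_prod _ fun i _ => ?_
  have hL : AnalyticAt ℂ (fun T : E →L[ℂ] E =>
      LinearMap.toContinuousLinearMap (b.coord (σ i)) (T (b i))) (M z₀) :=
    ((LinearMap.toContinuousLinearMap (b.coord (σ i))).comp
      (ContinuousLinearMap.apply ℂ E (b i))).analyticAt _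
  exact hL.comp hM

/-- If `M(z₀)` is singular with kernel vector `c` and `φ c = 1`, this is the factor `M'` in
`M(z) = M'(z) (1 + (z - z₀ - 1) φ(·) c)`. -/
def deflate (M : ℂ → E →L[ℂ] E) (z₀ : ℂ) (φ : E →L[ℂ] ℂ) (c : E) (z : ℂ) : E →L[ℂ] E :=
  M z ∘L (ContinuousLinearMap.id ℂ E - φ.smulRight c) + dslope M z₀ z ∘L φ.smulRight c

theorem analyticAt_deflate {M : ℂ → E →L[ℂ] E} {z₀ : ℂ} (hM : AnalyticAt ℂ M z₀)
    (φ : E →L[ℂ] ℂ) (c : E) : AnalyticAt ℂ (deflate M z₀ φ c) z₀ := by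
  obtain ⟨q, hq⟩ := hM
  have h1 : AnalyticAt ℂ (dslope M z₀) z₀ := ⟨_, hq.has_fpower_series_dslope_fslope⟩
  have h0 : AnalyticAt ℂ M z₀ := hq.analyticAt
  exact ((((ContinuousLinearMap.compL ℂ E E E).flip
    (ContinuousLinearMap.id ℂ E - φ.smulRight c)).analyticAt _).comp h0).add
    ((((ContinuousLinearMap.compL ℂ E E E).flip (φ.smulRight c)).analyticAt _).comp h1)

variable {M : ℂ → E →L[ℂ] E} {z₀ : ℂ} {φ : E →L[ℂ] ℂ} {c : E}

theorem smul_dslope_apply (hc : M z₀ c = 0) (z : ℂ) :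
    (z - z₀) • dslope M z₀ z c = M z c := by
  have := congrArg (fun T : E →L[ℂ] E => T c) (sub_smul_dslope M z₀ z)
  change (z - z₀) • dslope M z₀ z c = M z c - M z₀ c at this
  rw [this, hc, sub_zero]

theorem deflate_apply (z : ℂ) (x : E) :
    deflate M z₀ φ c z x = M z (x - φ x • c) + φ x • dslope M z₀ z c := by
  simp [deflate]

/-- The factorization `M(z) = M'(z) (1 + (z - z₀ - 1) φ(·) c)`. -/
theorem deflate_factor (hc : M z₀ c = 0) (hφ : φ c = 1) (z : ℂ) (x : E) :
    deflate M z₀ φ c z (x + ((z - z₀ - 1) * φ x) • c) = M z x := by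
  rw [deflate_apply]
  have h := smul_dslope_apply hc z
  have e : φ (x + ((z - z₀ - 1) * φ x) • c) = (z - z₀) * φ x := by
    simp [hφ]; ring
  rw [e, mul_comm (z - z₀) (φ x), mul_smul _ _ (dslope M z₀ z c), h, ← map_smul, ← map_add]
  congr 1
  module

theorem det_eq_deflate [FiniteDimensional ℂ E] (hc : M z₀ c = 0) (hφ : φ c = 1) (z : ℂ) :
    LinearMap.det (clmPencil M z) =
      LinearMap.det (clmPencil (deflate M z₀ φ c) z) * (z - z₀) := by
  have h : clmPencil M z = clmPencil (deflate M z₀ φ c) z ∘ₗ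
      LinearMap.transvection ((z - z₀ - 1) • (φ : E →ₗ[ℂ] ℂ)) c := by
    ext x
    simp only [clmPencil, LinearMap.comp_apply, LinearMap.transvection.apply,
      LinearMap.smul_apply, smul_eq_mul, ContinuousLinearMap.coe_coe]
    exact (deflate_factor hc hφ z x).symm
  rw [h, LinearMap.det_comp, LinearMap.transvection.det]
  simp [hφ]

/-- Splitting off a kernel vector lowers the order of vanishing of the determinant by one: the
factor that is split off is a transvection with determinant `z - z₀`. -/
theorem order_det_eq_deflate [FiniteDimensional ℂ E] (hM : AnalyticAt ℂ M z₀)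
    (hc : M z₀ c = 0) (hφ : φ c = 1) :
    analyticOrderAt (fun z => LinearMap.det (clmPencil M z)) z₀ =
      analyticOrderAt (fun z => LinearMap.det (clmPencil (deflate M z₀ φ c) z)) z₀ + 1 := by
  have h : (fun z => LinearMap.det (clmPencil M z)) =
      (fun z => LinearMap.det (clmPencil (deflate M z₀ φ c) z)) * fun z => z - z₀ := by
    funext z
    exact det_eq_deflate hc hφ z
  have h1 : analyticOrderAt (fun z : ℂ => z - z₀) z₀ = 1 := by
    simp
  rw [h, analyticOrderAt_mul (analyticAt_det (analyticAt_deflate hM φ c)) (by fun_prop), h1]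

theorem exists_kernel_functional (h : LinearMap.det (clmPencil M z₀) = 0) :
    ∃ (c : E) (φ : E →L[ℂ] ℂ), M z₀ c = 0 ∧ φ c = 1 := by
  have h1 := LinearMap.bot_lt_ker_of_det_eq_zero h
  obtain ⟨c, hc, hne⟩ := Submodule.exists_mem_ne_zero_of_ne_bot h1.ne'
  obtain ⟨φ, hφ⟩ := SeparatingDual.exists_eq_one (R := ℂ) hne
  exact ⟨c, φ, hc, hφ⟩

/-- Multiplication of jets by `1 + (z - z₀ - 1) φ(·) c`, truncated to degree `p`. -/
def deflateJet (φ : E →L[ℂ] ℂ) (c : E) (p : ℕ) : (Fin (p + 1) → E) →ₗ[ℂ] (Fin (p + 1) → E) where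
  toFun u := (fun j => u j - φ (u j) • c) + Fin.cons 0 (fun j : Fin p => φ (u j.castSucc) • c)
  map_add' u v := by
    funext j
    refine Fin.cases ?_ (fun j => ?_) j
    · simp only [Pi.add_apply, Fin.cons_zero, map_add]; module
    · simp only [Pi.add_apply, Fin.cons_succ, map_add]; module
  map_smul' r u := by
    funext j
    refine Fin.cases ?_ (fun j => ?_) j
    · simp only [Pi.add_apply, Pi.smul_apply, RingHom.id_apply, Fin.cons_zero, map_smul,
        smul_eq_mul]; module
    · simp only [Pi.add_apply, Pi.smul_apply, RingHom.id_apply, Fin.cons_succ, map_smul,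
        smul_eq_mul]; module

theorem jetPoly_deflateJet (p : ℕ) (u : Fin (p + 1) → E) (z : ℂ) :
    jetPoly z₀ (deflateJet φ c p u) z =
      (jetPoly z₀ u z + ((z - z₀ - 1) * φ (jetPoly z₀ u z)) • c)
        - (z - z₀) ^ (p + 1) • (φ (u (Fin.last p)) • c) := by
  have h1 : jetPoly z₀ (fun j => u j - φ (u j) • c) z =
      jetPoly z₀ u z - φ (jetPoly z₀ u z) • c :=
    (map_jetPoly z₀ ((ContinuousLinearMap.id ℂ E - φ.smulRight c : E →L[ℂ] E) : E →ₗ[ℂ] E) u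
      z).symm
  have h2 : jetPoly z₀ (fun j : Fin p => φ (u j.castSucc) • c) z =
      φ (jetPoly z₀ (fun j : Fin p => u j.castSucc) z) • c :=
    (map_jetPoly z₀ ((φ.smulRight c : E →L[ℂ] E) : E →ₗ[ℂ] E) _ z).symm
  have h3 : deflateJet φ c p u = (fun j => u j - φ (u j) • c) +
      Fin.cons 0 (fun j : Fin p => φ (u j.castSucc) • c) := rfl
  have h4 : jetPoly z₀ (Fin.cons 0 fun j : Fin p => φ (u j.castSucc) • c : Fin (p + 1) → E) z =
      (z - z₀) • jetPoly z₀ (fun j : Fin p => φ (u j.castSucc) • c) z := by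
    rw [jetPoly_succ]
    simp
  rw [h3, jetPoly_add, h1, h4]
  rw [h2, jetPoly_castSucc z₀ u z, map_add, map_smul]
  simp only [smul_eq_mul, pow_succ]
  module

theorem deflateJet_mem (hM : AnalyticAt ℂ M z₀) (hc : M z₀ c = 0) (hφ : φ c = 1) {p : ℕ}
    {u : Fin (p + 1) → E} (hu : u ∈ rootFunctions (clmPencil M) z₀ p) :
    deflateJet φ c p u ∈ rootFunctions (clmPencil (deflate M z₀ φ c)) z₀ p := by
  rw [mem_rootFunctions_iff] at hu ⊢
  have hb : (fun z => deflate M z₀ φ c z (φ (u (Fin.last p)) • c)) =O[𝓝 z₀] fun _ => (1 : ℂ) :=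
    (((analyticAt_deflate hM φ c).continuousAt).clm_apply continuousAt_const).isBigO_one ℂ
  have h2 := (isBigO_refl (fun z : ℂ => (z - z₀) ^ (p + 1)) (𝓝 z₀)).smul hb
  simp only [smul_eq_mul, mul_one] at h2
  refine (hu.sub h2).congr_left fun z => ?_
  simp only [clmPencil, ContinuousLinearMap.coe_coe]
  rw [jetPoly_deflateJet, map_sub, deflate_factor hc hφ, map_smul _ ((z - z₀) ^ (p + 1))]

variable [FiniteDimensional ℂ E]

/-- Upper bound: `deflateJet` maps root functions of `M` to root functions of the deflated family, and
its kernel consists of the multiples of `(z - z₀)^p c`. -/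
theorem finrank_rootFunctions_le_deflate (hM : AnalyticAt ℂ M z₀) (hc : M z₀ c = 0)
    (hφ : φ c = 1) (p : ℕ) :
    Module.finrank ℂ (rootFunctions (clmPencil M) z₀ p) ≤
      Module.finrank ℂ (rootFunctions (clmPencil (deflate M z₀ φ c)) z₀ p) + 1 := by
  let L : rootFunctions (clmPencil M) z₀ p →ₗ[ℂ]
      rootFunctions (clmPencil (deflate M z₀ φ c)) z₀ p × ℂ :=
    LinearMap.prod (((deflateJet φ c p).comp (Submodule.subtype _)).codRestrict _
        fun u => deflateJet_mem hM hc hφ u.2)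
      (((φ : E →ₗ[ℂ] ℂ).comp (LinearMap.proj (Fin.last p))).comp (Submodule.subtype _))
  have hL : Function.Injective L := by
    rw [← LinearMap.ker_eq_bot, LinearMap.ker_eq_bot']
    rintro ⟨u, hu⟩ h
    have h1 : deflateJet φ c p u = 0 := congrArg Subtype.val (congrArg Prod.fst h)
    have h2 : φ (u (Fin.last p)) = 0 := congrArg Prod.snd h
    have h3 : ∀ j, φ (u j) = 0 := by
      intro j
      refine Fin.lastCases h2 (fun i => ?_) j
      have := congrArg φ (congrFun h1 i.succ)
      simpa [deflateJet, hφ] using this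
    ext j : 2
    have := congrFun h1 j
    refine Fin.cases (fun this => ?_) (fun i this => ?_) j this
    · simpa [deflateJet, h3] using this
    · simpa [deflateJet, h3] using this
  have := LinearMap.finrank_le_finrank_of_injective hL
  simpa using this

/-- Lower bound: if `v` is a root function of order `p` of the deflated family, then
`φ(v) c + (z - z₀) (v - φ(v) c)` is a root function of order `p + 1` of `M`, and so is
`(z - z₀)^(p+1) c`. -/
theorem finrank_deflate_lt (hM : AnalyticAt ℂ M z₀) (hc : M z₀ c = 0)
    (hφ : φ c = 1) (p : ℕ) :
    Module.finrank ℂ (rootFunctions (clmPencil (deflate M z₀ φ c)) z₀ p) + 1 ≤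
      Module.finrank ℂ (rootFunctions (clmPencil M) z₀ (p + 1)) := by
  let S : ((Fin (p + 1) → E) × ℂ) →ₗ[ℂ] (Fin (p + 2) → E) :=
    { toFun := fun v => Fin.snoc (α := fun _ => E) (fun j => φ (v.1 j) • c) (v.2 • c) +
        Fin.cons 0 (fun j => v.1 j - φ (v.1 j) • c)
      map_add' := fun v w => by
        funext j
        rw [Pi.add_apply, Pi.add_apply, Pi.add_apply, Pi.add_apply]
        refine Fin.cases ?_ (fun j => ?_) j
        · rw [Fin.cons_zero, Fin.cons_zero, Fin.cons_zero, ← Fin.castSucc_zero]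
          simp only [Fin.snoc_castSucc, Prod.fst_add, Pi.add_apply, map_add]; module
        · rw [Fin.cons_succ, Fin.cons_succ, Fin.cons_succ]
          refine Fin.lastCases ?_ (fun j => ?_) j
          · simp only [Fin.succ_last, Fin.snoc_last, Prod.fst_add, Prod.snd_add,
              Pi.add_apply, map_add]; module
          · simp only [Fin.succ_castSucc, Fin.snoc_castSucc, Prod.fst_add,
              Pi.add_apply, map_add]; module
      map_smul' := fun r v => by
        funext j
        rw [Pi.add_apply, Pi.smul_apply, Pi.add_apply]
        refine Fin.cases ?_ (fun j => ?_) j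
        · rw [Fin.cons_zero, Fin.cons_zero, ← Fin.castSucc_zero]
          simp only [Fin.snoc_castSucc, Prod.smul_fst,
            Pi.smul_apply, map_smul, RingHom.id_apply, smul_eq_mul]; module
        · rw [Fin.cons_succ, Fin.cons_succ]
          refine Fin.lastCases ?_ (fun j => ?_) j
          · simp only [Fin.succ_last, Fin.snoc_last, Prod.smul_fst, Prod.smul_snd,
              Pi.smul_apply, map_smul, RingHom.id_apply, smul_eq_mul]; module
          · simp only [Fin.succ_castSucc, Fin.snoc_castSucc, Prod.smul_fst,
              Pi.smul_apply, map_smul, RingHom.id_apply, smul_eq_mul]; module }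
  have hSdef : ∀ v, S v = Fin.snoc (α := fun _ => E) (fun j => φ (v.1 j) • c) (v.2 • c) +
        Fin.cons 0 (fun j => v.1 j - φ (v.1 j) • c) := fun v => rfl
  have hSj : ∀ v z, jetPoly z₀ (S v) z = φ (jetPoly z₀ v.1 z) • c +
      (z - z₀) ^ (p + 1) • v.2 • c +
      (z - z₀) • (jetPoly z₀ v.1 z - φ (jetPoly z₀ v.1 z) • c) := by
    intro v z
    have h1 : jetPoly z₀ (fun j => v.1 j - φ (v.1 j) • c) z =
        jetPoly z₀ v.1 z - φ (jetPoly z₀ v.1 z) • c :=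
      (map_jetPoly z₀ ((ContinuousLinearMap.id ℂ E - φ.smulRight c : E →L[ℂ] E) : E →ₗ[ℂ] E)
        v.1 z).symm
    have h2 : jetPoly z₀ (fun j => φ (v.1 j) • c) z = φ (jetPoly z₀ v.1 z) • c :=
      (map_jetPoly z₀ ((φ.smulRight c : E →L[ℂ] E) : E →ₗ[ℂ] E) _ z).symm
    rw [hSdef, jetPoly_add, jetPoly_castSucc, jetPoly_succ z₀ (Fin.cons _ _)]
    simp only [Fin.snoc_castSucc, Fin.snoc_last, Fin.cons_zero, Fin.cons_succ, h1, h2, zero_add]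
  have hSmem : ∀ v : rootFunctions (clmPencil (deflate M z₀ φ c)) z₀ p × ℂ,
      S (v.1, v.2) ∈ rootFunctions (clmPencil M) z₀ (p + 1) := by
    rintro ⟨⟨v, hv⟩, t⟩
    rw [mem_rootFunctions_iff] at hv ⊢
    have hz : (fun z => z - z₀) =O[𝓝 z₀] fun z : ℂ => z - z₀ := isBigO_refl _ _
    have hMc : (fun z => M z c) =O[𝓝 z₀] fun z : ℂ => z - z₀ := by
      have h := hM.differentiableAt.isBigO_sub
      have h2 := ((ContinuousLinearMap.apply ℂ E c).isBigO_comp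
        (fun z => M z - M z₀) (𝓝 z₀)).trans h
      simpa [hc] using h2
    have h1 := hz.smul hv
    have h2 := (isBigO_refl (fun z : ℂ => (z - z₀) ^ (p + 1)) (𝓝 z₀)).smul
      (hMc.const_smul_left t)
    have h3 := (h1.add (h2.congr_right (fun z => by
      rw [smul_eq_mul, smul_eq_mul, mul_comm])))
    refine (h3.congr_left fun z => ?_).congr_right fun z => ?_
    · rw [hSj]
      simp only [clmPencil, ContinuousLinearMap.coe_coe, Pi.smul_apply]
      rw [deflate_apply, map_add, map_add, map_smul, map_smul, map_smul, map_smul, smul_add,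
        smul_comm (z - z₀) (φ _), smul_dslope_apply hc]
      module
    · rw [smul_eq_mul, pow_succ' _ (p + 1)]
  let L : rootFunctions (clmPencil (deflate M z₀ φ c)) z₀ p × ℂ →ₗ[ℂ]
      rootFunctions (clmPencil M) z₀ (p + 1) :=
    (S.comp (LinearMap.prodMap (Submodule.subtype _) LinearMap.id)).codRestrict _ hSmem
  have hL : Function.Injective L := by
    rw [← LinearMap.ker_eq_bot, LinearMap.ker_eq_bot']
    rintro ⟨⟨v, hv⟩, t⟩ h
    have h1 : S (v, t) = 0 := congrArg Subtype.val h
    rw [hSdef] at h1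
    have hφv : ∀ j, φ (v j) = 0 := by
      intro j
      have h2 := congrArg φ (congrFun h1 j.castSucc)
      rw [Pi.add_apply, Fin.snoc_castSucc] at h2
      refine Fin.cases (fun h2 => ?_) (fun i h2 => ?_) j h2
      · rw [Fin.castSucc_zero, Fin.cons_zero] at h2
        simpa [hφ] using h2
      · rw [← Fin.succ_castSucc, Fin.cons_succ] at h2
        simpa [hφ] using h2
    have ht : t = 0 := by
      have h2 := congrArg φ (congrFun h1 (Fin.last p).succ)
      rw [Pi.add_apply, Fin.cons_succ, Fin.succ_last, Fin.snoc_last] at h2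
      simpa [hφ, hφv] using h2
    have hv0 : v = 0 := by
      funext j
      have h2 := congrFun h1 j.succ
      rw [Pi.add_apply, Fin.cons_succ] at h2
      refine Fin.lastCases (fun h2 => ?_) (fun i h2 => ?_) j h2
      · rw [Fin.succ_last, Fin.snoc_last] at h2
        simpa [ht, hφv] using h2
      · rw [Fin.succ_castSucc, Fin.snoc_castSucc] at h2
        simpa [hφv] using h2
    subst ht hv0
    rfl
  have := LinearMap.finrank_le_finrank_of_injective hL
  simpa using this

theorem rootFunctions_eq_bot_of_det_ne_zero (hM : ContinuousAt M z₀)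
    (h : LinearMap.det (clmPencil M z₀) ≠ 0) (p : ℕ) :
    rootFunctions (clmPencil M) z₀ p = ⊥ := by
  have hinj : LinearMap.ker (clmPencil M z₀) = ⊥ := by
    rw [← LinearMap.isUnit_iff_ker_eq_bot]
    exact LinearMap.isUnit_iff_isUnit_det _ |>.2 (isUnit_iff_ne_zero.2 h)
  obtain ⟨K, hK, hanti⟩ := (clmPencil M z₀).exists_antilipschitzWith hinj
  have hb : ∀ x : E, ‖x‖ ≤ K * ‖M z₀ x‖ := fun x => by
    simpa [clmPencil] using hanti.le_mul_norm_sub x 0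
  have hK' : (0 : ℝ) < K := hK
  have hnear : ∀ᶠ z in 𝓝 z₀, ‖M z - M z₀‖ ≤ 1 / (2 * K) := by
    have := Metric.continuousAt_iff'.1 hM (1 / (2 * K)) (by positivity)
    filter_upwards [this] with z hz
    rw [← dist_eq_norm]
    exact hz.le
  rw [Submodule.eq_bot_iff]
  intro u hu
  rw [mem_rootFunctions_iff] at hu
  refine jetPoly_isBigO_iff.1 (IsBigO.trans (IsBigO.of_bound (2 * K) ?_) hu)
  filter_upwards [hnear] with z hz
  set x := jetPoly z₀ u z
  have h1 := hb x
  have h2 : ‖M z₀ x‖ ≤ ‖M z x‖ + 1 / (2 * K) * ‖x‖ := by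
    calc ‖M z₀ x‖ = ‖M z x - (M z - M z₀) x‖ := by simp
      _ ≤ ‖M z x‖ + ‖(M z - M z₀) x‖ := norm_sub_le _ _
      _ ≤ _ := by gcongr; exact (ContinuousLinearMap.le_opNorm _ _).trans (by gcongr)
  change ‖x‖ ≤ 2 * K * ‖M z x‖
  have h3 : (K : ℝ) * (1 / (2 * K) * ‖x‖) = ‖x‖ / 2 := by field_simp
  nlinarith [mul_le_mul_of_nonneg_left h2 hK'.le]

theorem finrank_rootFunctions_le_order (hM : AnalyticAt ℂ M z₀) (d : ℕ)
    (hd : analyticOrderAt (fun z => LinearMap.det (clmPencil M z)) z₀ = d) (p : ℕ) :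
    Module.finrank ℂ (rootFunctions (clmPencil M) z₀ p) ≤ d := by
  induction d generalizing M with
  | zero =>
    rw [Nat.cast_zero, (analyticAt_det hM).analyticOrderAt_eq_zero] at hd
    rw [rootFunctions_eq_bot_of_det_ne_zero hM.continuousAt hd]
    simp
  | succ d ih =>
    have h0 : LinearMap.det (clmPencil M z₀) = 0 :=
      apply_eq_zero_of_analyticOrderAt_ne_zero
        (f := fun z => LinearMap.det (clmPencil M z)) (by rw [hd]; simp)
    obtain ⟨c, φ, hc, hφ⟩ := exists_kernel_functional h0
    rw [order_det_eq_deflate hM hc hφ, Nat.cast_succ] at hd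
    have := ih (analyticAt_deflate hM φ c) (by simpa using hd)
    exact (finrank_rootFunctions_le_deflate hM hc hφ p).trans (by omega)

theorem le_finrank_rootFunctions (hM : AnalyticAt ℂ M z₀) (p : ℕ)
    (hp : (p + 1 : ℕ) ≤ analyticOrderAt (fun z => LinearMap.det (clmPencil M z)) z₀) :
    p + 1 ≤ Module.finrank ℂ (rootFunctions (clmPencil M) z₀ p) := by
  have h0 : LinearMap.det (clmPencil M z₀) = 0 :=
    apply_eq_zero_of_analyticOrderAt_ne_zero (f := fun z => LinearMap.det (clmPencil M z)) (by
      intro h; rw [h] at hp; simp at hp)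
  obtain ⟨c, φ, hc, hφ⟩ := exists_kernel_functional h0
  induction p generalizing M c φ with
  | zero =>
    refine Nat.succ_le_of_lt (Module.finrank_pos_iff_exists_ne_zero.2 ?_)
    have hmem : (fun _ => c : Fin 1 → E) ∈ rootFunctions (clmPencil M) z₀ 0 := by
      rw [mem_rootFunctions_iff]
      have h := hM.differentiableAt.isBigO_sub
      have h2 := ((ContinuousLinearMap.apply ℂ E c).isBigO_comp
        (fun z => M z - M z₀) (𝓝 z₀)).trans h
      simpa [hc, jetPoly, clmPencil] using h2
    refine ⟨⟨_, hmem⟩, fun h => ?_⟩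
    have : c = 0 := congrFun (congrArg Subtype.val h) 0
    simp [this] at hφ
  | succ p ih =>
    rw [order_det_eq_deflate hM hc hφ] at hp
    have hp' : ((p + 1 : ℕ) : ℕ∞) ≤ analyticOrderAt
        (fun z => LinearMap.det (clmPencil (deflate M z₀ φ c) z)) z₀ := by
      rw [Nat.cast_succ] at hp
      exact (ENat.add_le_add_iff_right (by simp)).1 hp
    have h0' : LinearMap.det (clmPencil (deflate M z₀ φ c) z₀) = 0 :=
      apply_eq_zero_of_analyticOrderAt_ne_zero
        (f := fun z => LinearMap.det (clmPencil (deflate M z₀ φ c) z)) (by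
        intro h; rw [h] at hp'; simp at hp')
    obtain ⟨c', φ', hc', hφ'⟩ := exists_kernel_functional h0'
    have := ih (analyticAt_deflate hM φ c) hp' h0' c' φ' hc' hφ'
    exact le_trans (by omega) (finrank_deflate_lt hM hc hφ p)

/-- The algebraic multiplicity of an analytic matrix family is the order of vanishing of its
determinant. -/
theorem algebraicMultiplicity_clmPencil (hM : AnalyticAt ℂ M z₀) :
    algebraicMultiplicity (clmPencil M) z₀ =
      analyticOrderAt (fun z => LinearMap.det (clmPencil M z)) z₀ := by
  have hr : ∀ p, Cardinal.toENat (Module.rank ℂ (rootFunctions (clmPencil M) z₀ p)) =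
      (Module.finrank ℂ (rootFunctions (clmPencil M) z₀ p) : ℕ∞) := fun p => by
    rw [← Module.finrank_eq_rank, Cardinal.toENat_nat]
  simp only [algebraicMultiplicity, hr]
  refine le_antisymm ?_ ?_
  · refine iSup_le fun p => ?_
    by_cases h : analyticOrderAt (fun z => LinearMap.det (clmPencil M z)) z₀ = ⊤
    · rw [h]; exact le_top
    · obtain ⟨d, hd⟩ := ENat.ne_top_iff_exists.1 h
      rw [← hd]
      exact_mod_cast finrank_rootFunctions_le_order hM d hd.symm p
  · refine ENat.forall_natCast_le_iff_le.1 fun m hm => ?_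
    rcases m with _ | p
    · simp
    · refine le_iSup_of_le p ?_
      exact_mod_cast le_finrank_rootFunctions hM p hm

end Matrices

/-! ### Families of bounded functions depending analytically on a parameter -/

section BoundedFamilies

variable {α F : Type*} [TopologicalSpace α] [NormedAddCommGroup F] [NormedSpace ℂ F]

/-- Cauchy's estimate for the derivative makes a bounded, pointwise holomorphic family Lipschitz in
the supremum norm. -/
theorem norm_sub_le_of_pointwise_differentiable {f : ℂ → α →ᵇ F} {z₀ : ℂ} {r M : ℝ} (hr : 0 < r)
    (hd : ∀ x, DifferentiableOn ℂ (fun z => f z x) (Metric.ball z₀ (3 * r)))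
    (hM : ∀ z ∈ Metric.ball z₀ (3 * r), ‖f z‖ ≤ M) {z w : ℂ}
    (hz : z ∈ Metric.closedBall z₀ r) (hw : w ∈ Metric.closedBall z₀ r) :
    ‖f z - f w‖ ≤ M / r * ‖z - w‖ := by
  have hM0 : 0 ≤ M := (norm_nonneg _).trans (hM z₀ (Metric.mem_ball_self (by positivity)))
  refine (BoundedContinuousFunction.norm_le (by positivity)).2 fun x => ?_
  rw [BoundedContinuousFunction.sub_apply]
  refine (convex_closedBall z₀ r).norm_image_sub_le_of_norm_deriv_le (𝕜 := ℂ)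
    (f := fun z => f z x) (fun y hy => ?_) (fun y hy => ?_) hw hz
  · refine (hd x).differentiableAt (Metric.isOpen_ball.mem_nhds ?_)
    exact Metric.closedBall_subset_ball (by linarith) hy
  · have hsub : Metric.closedBall y r ⊆ Metric.ball z₀ (3 * r) := fun t ht => by
      rw [Metric.mem_closedBall] at ht hy
      rw [Metric.mem_ball]
      linarith [dist_triangle t y z₀]
    refine Complex.norm_deriv_le_of_forall_mem_sphere_norm_le hr ?_ fun t ht =>
      ((f t).norm_coe_le_norm x).trans (hM t (hsub (Metric.sphere_subset_closedBall ht)))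
    refine ((hd x).mono ?_).diffContOnCl
    rw [closure_ball y hr.ne']
    exact hsub

/-- A locally bounded family of bounded functions that is pointwise analytic in the parameter is
analytic for the supremum norm: the Cauchy integral formula holds in that norm. -/
theorem analyticAt_of_pointwise [CompleteSpace F] {f : ℂ → α →ᵇ F} {Ω : Set ℂ} (hΩ : IsOpen Ω)
    (hf : ∀ x, AnalyticOnNhd ℂ (fun z => f z x) Ω) {z₀ : ℂ} (hz₀ : z₀ ∈ Ω)
    (hb : ∃ M : ℝ, ∀ᶠ z in 𝓝 z₀, ‖f z‖ ≤ M) : AnalyticAt ℂ f z₀ := by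
  obtain ⟨M, hM⟩ := hb
  obtain ⟨R, hR, hball⟩ := Metric.eventually_nhds_iff_ball.1 (hM.and (hΩ.mem_nhds hz₀))
  obtain ⟨r, hr, rfl⟩ : ∃ r : ℝ, 0 < r ∧ R = 3 * r := ⟨R / 3, by positivity, by ring⟩
  have hd : ∀ x, DifferentiableOn ℂ (fun z => f z x) (Metric.ball z₀ (3 * r)) := fun x z hz =>
    (hf x z (hball z hz).2).differentiableAt.differentiableWithinAt
  have hcont : ContinuousOn f (Metric.closedBall z₀ r) := by
    have hM0 : 0 ≤ M := (norm_nonneg _).trans (hball z₀ (Metric.mem_ball_self hR)).1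
    have : LipschitzOnWith (Real.toNNReal (M / r)) f (Metric.closedBall z₀ r) :=
      LipschitzOnWith.of_dist_le_mul fun z hz w hw => by
        rw [dist_eq_norm, dist_eq_norm, Real.coe_toNNReal _ (by positivity)]
        exact norm_sub_le_of_pointwise_differentiable hr hd (fun z hz => (hball z hz).1) hz hw
    exact this.continuousOn
  lift r to NNReal using hr.le
  have hci : CircleIntegrable f z₀ r :=
    (hcont.mono Metric.sphere_subset_closedBall).circleIntegrable r.2
  have h := (hasFPowerSeriesOn_cauchy_integral hci (by exact_mod_cast hr)).analyticAt
  refine h.congr ?_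
  filter_upwards [Metric.ball_mem_nhds z₀ hr] with w hw
  ext x
  have hw2 := (DifferentiableOn.circleIntegral_sub_inv_smul ((hd x).mono
    (Metric.closedBall_subset_ball (by linarith))) hw)
  have hint : CircleIntegrable (fun z => (z - w)⁻¹ • f z) z₀ r := by
    refine ContinuousOn.circleIntegrable r.2 (ContinuousOn.fun_smul ?_
      (hcont.mono Metric.sphere_subset_closedBall))
    refine ContinuousOn.inv₀ (by fun_prop) fun z hz h0 => ?_
    rw [sub_eq_zero.1 h0, mem_sphere_iff_norm] at hz
    rw [mem_ball_iff_norm] at hw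
    linarith
  have hev : (∮ z in C(z₀, r), (z - w)⁻¹ • f z) x = ∮ z in C(z₀, r), (z - w)⁻¹ • f z x := by
    have := (BoundedContinuousFunction.evalCLM ℂ x : (α →ᵇ F) →L[ℂ] F).intervalIntegral_comp_comm
      hint.out
    exact this.symm
  rw [BoundedContinuousFunction.smul_apply, hev, hw2, smul_smul, inv_mul_cancel₀, one_smul]
  simp [Real.pi_ne_zero]

end BoundedFamilies

/-! ### Linear differential equations -/

section LinearODE

variable {E : Type*} [NormedAddCommGroup E] [NormedSpace ℝ E]

/-- The Picard iterates of `u' = a(x) u`, `u(0) = v`, as the terms of a series. -/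
def picardTerm (a : ℝ → E →L[ℝ] E) (v : E) : ℕ → ℝ → E
  | 0, _ => v
  | n + 1, x => ∫ t in (0 : ℝ)..x, a t (picardTerm a v n t)

variable {a : ℝ → E →L[ℝ] E}

variable [CompleteSpace E]

theorem hasDerivAt_picardTerm_succ_of_continuous (ha : Continuous a) (v : E) (n : ℕ)
    (hc : Continuous (picardTerm a v n)) (x : ℝ) :
    HasDerivAt (picardTerm a v (n + 1)) (a x (picardTerm a v n x)) x := by
  have h : Continuous fun t => a t (picardTerm a v n t) := ha.clm_apply hc
  exact intervalIntegral.integral_hasDerivAt_right (h.intervalIntegrable _ _)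
    (h.stronglyMeasurableAtFilter _ _) h.continuousAt

theorem continuous_picardTerm (ha : Continuous a) (v : E) (n : ℕ) :
    Continuous (picardTerm a v n) := by
  induction n with
  | zero => exact continuous_const
  | succ n ih =>
    exact continuous_iff_continuousAt.2 fun x =>
      (hasDerivAt_picardTerm_succ_of_continuous ha v n ih x).continuousAt

theorem norm_picardTerm_le (ha : Continuous a) {M : ℝ} (hM : ∀ x, ‖a x‖ ≤ M) (v : E) (n : ℕ)
    (x : ℝ) : ‖picardTerm a v n x‖ ≤ ‖v‖ * ((M * |x|) ^ n / n.factorial) := by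
  have hM0 : 0 ≤ M := (norm_nonneg _).trans (hM 0)
  induction n generalizing x with
  | zero => simp [picardTerm]
  | succ n ih =>
    have h1 : ‖picardTerm a v (n + 1) x‖ ≤ ∫ t in Set.uIoc 0 x, ‖a t (picardTerm a v n t)‖ :=
      intervalIntegral.norm_integral_le_integral_norm_uIoc
    have hc : Continuous fun t => ‖a t (picardTerm a v n t)‖ :=
      (ha.clm_apply (continuous_picardTerm ha v n)).norm
    have h2 : ∫ t in Set.uIoc 0 x, ‖a t (picardTerm a v n t)‖ ≤
        ∫ t in Set.uIoc 0 x, (‖v‖ * (M ^ (n + 1) / n.factorial)) * |t - 0| ^ n := by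
      refine setIntegral_mono_on ?_ ?_ measurableSet_uIoc fun t _ => ?_
      · exact (hc.intervalIntegrable 0 x).def'
      · exact (Continuous.intervalIntegrable (by fun_prop) 0 x).def'
      · calc ‖a t (picardTerm a v n t)‖ ≤ M * (‖v‖ * ((M * |t|) ^ n / n.factorial)) :=
            (ContinuousLinearMap.le_opNorm _ _).trans
              (mul_le_mul (hM t) (ih t) (norm_nonneg _) hM0)
          _ = _ := by rw [sub_zero, mul_pow]; ring
    refine h1.trans (h2.trans_eq ?_)
    rw [integral_const_mul, integral_pow_abs_sub_uIoc, sub_zero, Nat.factorial_succ, mul_pow]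
    push_cast
    field_simp

/-- Global existence for linear differential equations with bounded continuous coefficients. -/
theorem exists_linear_solution (ha : Continuous a) {M : ℝ} (hM : ∀ x, ‖a x‖ ≤ M) (v : E) :
    ∃ u : ℝ → E, u 0 = v ∧ ∀ x, HasDerivAt u (a x (u x)) x := by
  have hM0 : 0 ≤ M := (norm_nonneg _).trans (hM 0)
  have hsum : ∀ x, Summable fun n => picardTerm a v n x := fun x =>
    Summable.of_norm_bounded ((Real.summable_pow_div_factorial (M * |x|)).mul_left ‖v‖)
      fun n => norm_picardTerm_le ha hM v n x
  refine ⟨fun x => ∑' n, picardTerm a v n x, ?_, fun x => ?_⟩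
  · change ∑' n, picardTerm a v n 0 = v
    rw [tsum_eq_single 0]
    · rfl
    · rintro (_ | n) hn
      · exact absurd rfl hn
      · simp [picardTerm]
  · let g' : ℕ → ℝ → E := fun n => Nat.casesOn n (fun _ => 0) fun n y => a y (picardTerm a v n y)
    let B : ℕ → ℝ := fun n => Nat.casesOn n 0
      fun n => M * (‖v‖ * ((M * (|x| + 1)) ^ n / n.factorial))
    have hB : Summable B := by
      rw [← summable_nat_add_iff 1]
      exact ((Real.summable_pow_div_factorial (M * (|x| + 1))).mul_left ‖v‖).mul_left M
    have hx : x ∈ Metric.ball (0 : ℝ) (|x| + 1) := by simp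
    have h := hasDerivAt_tsum_of_isPreconnected (g := picardTerm a v) (g' := g') hB
      Metric.isOpen_ball (convex_ball (0 : ℝ) (|x| + 1)).isPreconnected
      (fun n y _ => ?_) (fun n y hy => ?_) hx (hsum x) hx
    · have e : ∑' n, g' n x = a x (∑' n, picardTerm a v n x) := by
        have hs : Summable fun n => g' n x := by
          rw [← summable_nat_add_iff 1]
          exact (hsum x).mapL (a x)
        rw [hs.tsum_eq_zero_add, (a x).map_tsum (hsum x)]
        exact zero_add _
      rw [e] at h
      exact h
    · rcases n with _ | n
      · exact hasDerivAt_const y v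
      · exact hasDerivAt_picardTerm_succ_of_continuous ha v n (continuous_picardTerm ha v n) y
    · rcases n with _ | n
      · simp [g', B]
      · have hy' : |y| ≤ |x| + 1 := by
          rw [mem_ball_zero_iff, Real.norm_eq_abs] at hy
          exact hy.le
        refine (ContinuousLinearMap.le_opNorm _ _).trans
          (mul_le_mul (hM y) ((norm_picardTerm_le ha hM v n y).trans ?_) (norm_nonneg _) hM0)
        gcongr

end LinearODE

section Gronwall

variable {E : Type*} [NormedAddCommGroup E] [NormedSpace ℝ E] {a : ℝ → E →L[ℝ] E} {M : ℝ}

/-- Gronwall's inequality for an inhomogeneous linear equation. -/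
theorem norm_le_of_linear_ode (hM : ∀ x, ‖a x‖ ≤ M) {u f : ℝ → E} {α β δ ε : ℝ}
    (hu : ∀ x ∈ Set.Icc α β, HasDerivAt u (a x (u x) + f x) x) (hδ : ‖u α‖ ≤ δ)
    (hε : ∀ x ∈ Set.Icc α β, ‖f x‖ ≤ ε) (hαβ : α ≤ β) :
    ‖u β‖ ≤ gronwallBound δ M ε (β - α) := by
  refine norm_le_gronwallBound_of_norm_deriv_right_le (f := u) (f' := fun x => a x (u x) + f x)
    (fun x hx => (hu x hx).continuousAt.continuousWithinAt)
    (fun x hx => (hu x (Set.Ico_subset_Icc_self hx)).hasDerivWithinAt) hδ (fun x hx => ?_) β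
    (Set.right_mem_Icc.2 hαβ)
  refine (norm_add_le _ _).trans (add_le_add ?_ (hε x (Set.Ico_subset_Icc_self hx)))
  exact (ContinuousLinearMap.le_opNorm _ _).trans
    (mul_le_mul_of_nonneg_right (hM x) (norm_nonneg _))

theorem norm_le_exp_of_linear_ode (hM : ∀ x, ‖a x‖ ≤ M) {u : ℝ → E}
    (hu : ∀ x, HasDerivAt u (a x (u x)) x) {x y : ℝ} (hxy : x ≤ y) :
    ‖u y‖ ≤ ‖u x‖ * Real.exp (M * (y - x)) := by
  rw [← gronwallBound_ε0]
  exact norm_le_of_linear_ode (f := 0) hM (fun t _ => by simpa using hu t) le_rfl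
    (fun t _ => by simp) hxy

theorem hasDerivAt_comp_neg {u : ℝ → E} {u' : E} {x : ℝ} (h : HasDerivAt u u' (-x)) :
    HasDerivAt (fun t => u (-t)) (-u') x := by
  have h1 := h.scomp x (hasDerivAt_neg x)
  rw [neg_one_smul] at h1
  exact h1

theorem norm_le_exp_of_linear_ode_backward (hM : ∀ x, ‖a x‖ ≤ M) {u : ℝ → E}
    (hu : ∀ x, HasDerivAt u (a x (u x)) x) {x y : ℝ} (hxy : x ≤ y) :
    ‖u x‖ ≤ ‖u y‖ * Real.exp (M * (y - x)) := by
  have h := norm_le_exp_of_linear_ode (a := fun t => -a (-t)) (u := fun t => u (-t))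
    (fun t => by simpa using hM (-t)) (fun t => by
      simpa using hasDerivAt_comp_neg (hu (-t))) (neg_le_neg hxy)
  simpa [sub_eq_add_neg, add_comm] using h

theorem eq_zero_of_linear_ode (hM : ∀ x, ‖a x‖ ≤ M) {u : ℝ → E}
    (hu : ∀ x, HasDerivAt u (a x (u x)) x) {x : ℝ} (hx : u x = 0) (y : ℝ) : u y = 0 := by
  rcases le_total x y with h | h
  · simpa [hx] using norm_le_exp_of_linear_ode hM hu h
  · simpa [hx] using norm_le_exp_of_linear_ode_backward hM hu h

end Gronwall

/-! ### Lyapunov forms of hyperbolic matrices -/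

section Lyapunov

/-- The projections `π ν` onto the generalized eigenspaces, indexed by all `ν : ℂ` (they vanish unless
`ν` is an eigenvalue). -/
theorem exists_spectral_projections {V : Type*} [AddCommGroup V] [Module ℂ V]
    [FiniteDimensional ℂ V] (f : Module.End ℂ V) :
    ∃ (S : Finset ℂ) (π : ℂ → Module.End ℂ V), (∀ ν ∈ S, f.HasEigenvalue ν) ∧
      (∀ ν v, π ν v ∈ f.maxGenEigenspace ν) ∧
      (∀ ν μ, ν ≠ μ → ∀ v ∈ f.maxGenEigenspace μ, π ν v = 0) ∧
      (∀ v, ∑ ν ∈ S, π ν v = v) ∧ ∀ ν v, π ν (f v) = f (π ν v) := by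
  have htop := Module.End.iSup_maxGenEigenspace_eq_top f
  have hcompl : ∀ ν, IsCompl (f.maxGenEigenspace ν) (⨆ μ, ⨆ (_ : μ ≠ ν), f.maxGenEigenspace μ) :=
    fun ν => ⟨f.independent_maxGenEigenspace ν, by
      rw [codisjoint_iff, eq_top_iff, ← htop]
      refine iSup_le fun μ => ?_
      by_cases h : μ = ν
      · rw [h]; exact le_sup_left
      · exact le_sup_of_le_right (le_iSup₂_of_le μ h le_rfl)⟩
  let π : ℂ → Module.End ℂ V := fun ν => (f.maxGenEigenspace ν).projection _ (hcompl ν)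
  have hmem : ∀ ν v, π ν v ∈ f.maxGenEigenspace ν := fun ν v => by
    exact Submodule.projection_apply_mem (hcompl ν) v
  have hself : ∀ ν, ∀ v ∈ f.maxGenEigenspace ν, π ν v = v := fun ν v hv =>
    Submodule.projection_apply_of_mem_left (hcompl ν) hv
  have hzero : ∀ ν μ, ν ≠ μ → ∀ v ∈ f.maxGenEigenspace μ, π ν v = 0 := fun ν μ h v hv => by
    refine (Submodule.projection_apply_eq_zero_iff (hcompl ν)).2 ?_
    exact Submodule.mem_iSup_of_mem μ (Submodule.mem_iSup_of_mem h.symm hv)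
  -- linear maps agreeing on every generalized eigenspace are equal
  have hext : ∀ g h : Module.End ℂ V, (∀ μ, ∀ v ∈ f.maxGenEigenspace μ, g v = h v) → g = h := by
    intro g h hgh
    have : (⊤ : Submodule ℂ V) ≤ LinearMap.eqLocus g h := by
      rw [← htop]
      exact iSup_le fun μ v hv => hgh μ v hv
    exact LinearMap.ext fun v => this (Submodule.mem_top (x := v))
  have hmaps : ∀ μ, ∀ v ∈ f.maxGenEigenspace μ, f v ∈ f.maxGenEigenspace μ := fun μ v hv =>
    Module.End.mapsTo_maxGenEigenspace_of_comm (Commute.refl f) μ hv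
  classical
  refine ⟨f.finite_hasEigenvalue.toFinset, π, fun ν hν => by simpa using hν, hmem, hzero, ?_, ?_⟩
  · intro v
    have := hext (∑ ν ∈ f.finite_hasEigenvalue.toFinset, π ν) LinearMap.id fun μ w hw => ?_
    · simpa using congrArg (fun g : Module.End ℂ V => g v) this
    · rw [LinearMap.sum_apply, LinearMap.id_apply]
      by_cases hμ : f.HasEigenvalue μ
      · rw [Finset.sum_eq_single μ (fun ν _ hne => hzero ν μ hne w hw)
          (fun h => absurd (by simpa using hμ) h), hself μ w hw]
      · have hbot : f.maxGenEigenspace μ = ⊥ := by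
          by_contra hne
          exact hμ (Module.End.HasUnifEigenvalue.lt one_pos hne)
        rw [hbot, Submodule.mem_bot] at hw
        simp [hw]
  · intro ν v
    have := hext (π ν ∘ₗ f) (f ∘ₗ π ν) fun μ w hw => ?_
    · exact congrArg (fun g : Module.End ℂ V => g v) this
    · simp only [LinearMap.comp_apply]
      by_cases h : ν = μ
      · subst h
        rw [hself ν w hw, hself ν _ (hmaps ν w hw)]
      · rw [hzero ν μ h w hw, hzero ν μ h _ (hmaps μ w hw), map_zero]

/-- For a nilpotent part `n`, the weighted norm `∑ ε^(-2k) ‖n^k y‖²` makes `n` as small as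
desired. -/
theorem abs_sum_inner_le {V : Type*} [NormedAddCommGroup V] [InnerProductSpace ℂ V] (m : ℕ)
    {ε : ℝ} (hε : 0 < ε) (y : ℕ → V) (hy : y m = 0) :
    |∑ k ∈ Finset.range m, (ε ^ 2)⁻¹ ^ k * (inner ℂ (y k) (y (k + 1))).re| ≤
      ε * ∑ k ∈ Finset.range m, (ε ^ 2)⁻¹ ^ k * ‖y k‖ ^ 2 := by
  have hshift : ∑ k ∈ Finset.range m, (ε ^ 2)⁻¹ ^ (k + 1) * ‖y (k + 1)‖ ^ 2 ≤
      ∑ k ∈ Finset.range m, (ε ^ 2)⁻¹ ^ k * ‖y k‖ ^ 2 := by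
    have h1 := Finset.sum_range_succ' (fun k => (ε ^ 2)⁻¹ ^ k * ‖y k‖ ^ 2) m
    rw [Finset.sum_range_succ, hy] at h1
    simp only [norm_zero, pow_zero, one_mul, ne_eq, OfNat.ofNat_ne_zero, not_false_eq_true,
      zero_pow, mul_zero, add_zero] at h1
    nlinarith [sq_nonneg ‖y 0‖]
  have hterm : ∀ k, |(ε ^ 2)⁻¹ ^ k * (inner ℂ (y k) (y (k + 1))).re| ≤
      ε / 2 * ((ε ^ 2)⁻¹ ^ k * ‖y k‖ ^ 2) +
        ε / 2 * ((ε ^ 2)⁻¹ ^ (k + 1) * ‖y (k + 1)‖ ^ 2) := by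
    intro k
    have h1 : |(inner ℂ (y k) (y (k + 1))).re| ≤ ‖y k‖ * ‖y (k + 1)‖ :=
      (Complex.abs_re_le_norm _).trans (norm_inner_le_norm _ _)
    have h2 : ‖y k‖ * ‖y (k + 1)‖ ≤ ε / 2 * ‖y k‖ ^ 2 + ε / 2 * ((ε ^ 2)⁻¹ * ‖y (k + 1)‖ ^ 2) := by
      have h3 : ε / 2 * ‖y k‖ ^ 2 + ε / 2 * ((ε ^ 2)⁻¹ * ‖y (k + 1)‖ ^ 2) -
          ‖y k‖ * ‖y (k + 1)‖ = (ε * ‖y k‖ - ‖y (k + 1)‖) ^ 2 / (2 * ε) := by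
        field_simp
        ring
      have h4 : 0 ≤ (ε * ‖y k‖ - ‖y (k + 1)‖) ^ 2 / (2 * ε) := by positivity
      linarith
    have hpos : 0 ≤ (ε ^ 2)⁻¹ ^ k := by positivity
    rw [abs_mul, abs_of_nonneg hpos]
    refine (mul_le_mul_of_nonneg_left (h1.trans h2) hpos).trans_eq ?_
    rw [pow_succ]
    ring
  calc _ ≤ ∑ k ∈ Finset.range m, |(ε ^ 2)⁻¹ ^ k * (inner ℂ (y k) (y (k + 1))).re| :=
        Finset.abs_sum_le_sum_abs _ _
    _ ≤ ∑ k ∈ Finset.range m, (ε / 2 * ((ε ^ 2)⁻¹ ^ k * ‖y k‖ ^ 2) +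
        ε / 2 * ((ε ^ 2)⁻¹ ^ (k + 1) * ‖y (k + 1)‖ ^ 2)) := Finset.sum_le_sum fun k _ => hterm k
    _ ≤ _ := by
        rw [Finset.sum_add_distrib, ← Finset.mul_sum, ← Finset.mul_sum]
        nlinarith

variable {N : ℕ}

/-- A matrix without eigenvalues on the imaginary axis. -/
def IsHyperbolic (B : Mat N) : Prop :=
  ∀ ν : ℂ, Module.End.HasEigenvalue (B : Module.End ℂ (CN N)) ν → ν.re ≠ 0

/-- The Hermitian matrix `H` is a Lyapunov form of `B`: the quadratic form `⟨H v, v⟩` decreases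
along `u' = B u`, is positive definite on the stable space and nonpositive on the unstable
space. -/
structure IsLyapunov (B H : Mat N) : Prop where
  symm : ∀ v w, inner ℂ (H v) w = inner ℂ v (H w)
  decay : ∀ v, (inner ℂ (H v) (B v)).re ≤ -‖v‖ ^ 2
  pos : ∃ c : ℝ, 0 < c ∧ ∀ v ∈ stableSpace B, c * ‖v‖ ^ 2 ≤ (inner ℂ (H v) v).re
  nonpos : ∀ v ∈ unstableSpace B, (inner ℂ (H v) v).re ≤ 0

theorem IsHyperbolic.stable_sup_unstable {B : Mat N} (hB : IsHyperbolic B) :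
    stableSpace B ⊔ unstableSpace B = ⊤ := by
  rw [eq_top_iff, ← Module.End.iSup_maxGenEigenspace_eq_top (B : Module.End ℂ (CN N))]
  refine iSup_le fun ν => ?_
  by_cases hν : Module.End.HasEigenvalue (B : Module.End ℂ (CN N)) ν
  · rcases lt_or_gt_of_ne (hB ν hν) with h | h
    · exact le_sup_of_le_left (le_iSup₂_of_le ν h le_rfl)
    · exact le_sup_of_le_right (le_iSup₂_of_le ν h le_rfl)
  · have : Module.End.maxGenEigenspace (B : Module.End ℂ (CN N)) ν = ⊥ := by
      by_contra hne
      exact hν (Module.End.HasUnifEigenvalue.lt one_pos hne)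
    rw [this]
    exact bot_le

/-- Every hyperbolic matrix has a Lyapunov form: up to a constant, the sum over the eigenvalues `ν` of
`sign(-re ν) ∑ₖ ε^(-2k) ‖(B - ν)^k π_ν v‖²`, where `2 ε ≤ |re ν|`. On each generalized eigenspace its
derivative along `u' = B u` is `2 re ν` times the form, up to an error from the nilpotent part, which
the weights make small compared with `re ν`. -/
theorem IsHyperbolic.exists_isLyapunov {B : Mat N} (hB : IsHyperbolic B) :
    ∃ H, IsLyapunov B H := by
  set f : Module.End ℂ (CN N) := (B : Module.End ℂ (CN N)) with hf
  obtain ⟨S, π, hS, hmem, hzero, hsum, hcomm⟩ := exists_spectral_projections f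
  obtain ⟨ε, hε, hεS⟩ : ∃ ε : ℝ, 0 < ε ∧ ∀ ν ∈ S, 2 * ε ≤ |ν.re| := by
    have : ∀ T : Finset ℂ, (∀ ν ∈ T, ν.re ≠ 0) → ∃ ε : ℝ, 0 < ε ∧ ∀ ν ∈ T, 2 * ε ≤ |ν.re| := by
      intro T
      induction T using Finset.induction_on with
      | empty => exact fun _ => ⟨1, one_pos, by simp⟩
      | insert μ T _ ih =>
        intro h
        obtain ⟨ε, hε, h1⟩ := ih fun ν hν => h ν (Finset.mem_insert_of_mem hν)
        have hμ : 0 < |μ.re| := abs_pos.2 (h μ (Finset.mem_insert_self _ _))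
        refine ⟨min ε (|μ.re| / 2), lt_min hε (by positivity), fun ν hν => ?_⟩
        rcases Finset.mem_insert.1 hν with rfl | hν
        · linarith [min_le_right ε (|ν.re| / 2)]
        · linarith [min_le_left ε (|μ.re| / 2), h1 ν hν]
    exact this S fun ν hν => hB ν (hS ν hν)
  let t : ℝ := (ε ^ 2)⁻¹
  have ht : 0 < t := by positivity
  let m : ℕ := N + 1
  let y : ℂ → CN N → ℕ → CN N := fun ν v k => ((f - algebraMap ℂ _ ν) ^ k) (π ν v)
  have hym : ∀ ν v, y ν v m = 0 := by
    intro ν v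
    have h1 := hmem ν v
    rw [Module.End.maxGenEigenspace_eq_genEigenspace_finrank, Module.End.mem_genEigenspace_nat] at h1
    have h2 : Module.finrank ℂ (CN N) = N := by simp
    rw [h2, LinearMap.mem_ker] at h1
    have h3 : ((f - algebraMap ℂ (Module.End ℂ (CN N)) ν) ^ N) (π ν v) = 0 := h1
    simp only [y, m, pow_succ']
    rw [Module.End.mul_apply, h3, map_zero]
  have hyB : ∀ ν v k, y ν (B v) k = ν • y ν v k + y ν v (k + 1) := by
    intro ν v k
    have h1 : π ν (B v) = ν • π ν v + (f - algebraMap ℂ _ ν) (π ν v) := by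
      rw [show (B v) = f v from rfl, hcomm]
      simp [Module.algebraMap_end_apply]
    simp only [y, h1, map_add, map_smul, pow_succ]
    rfl
  let s : ℂ → ℝ := fun ν => if ν.re < 0 then 1 else -1
  let Q : ℂ → CN N → ℝ := fun ν v => ∑ k ∈ Finset.range m, t ^ k * ‖y ν v k‖ ^ 2
  have hQ0 : ∀ ν v, ‖π ν v‖ ^ 2 ≤ Q ν v := by
    intro ν v
    have := Finset.single_le_sum (f := fun k => t ^ k * ‖y ν v k‖ ^ 2)
      (fun k _ => by positivity) (Finset.mem_range.2 (Nat.succ_pos N))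
    simpa [y] using this
  have hQnn : ∀ ν v, 0 ≤ Q ν v := fun ν v => (by positivity : (0 : ℝ) ≤ _).trans (hQ0 ν v)
  let K : ℝ := (S.card : ℝ) + 1
  have hK : 0 < K := by positivity
  have hKQ : ∀ v, ‖v‖ ^ 2 ≤ K * ∑ ν ∈ S, Q ν v := by
    intro v
    have h1 : ‖v‖ ≤ ∑ ν ∈ S, ‖π ν v‖ := by
      conv_lhs => rw [← hsum v]
      exact norm_sum_le _ _
    have h2 : ‖v‖ ^ 2 ≤ (∑ ν ∈ S, ‖π ν v‖) ^ 2 := by gcongr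
    have h3 : (∑ ν ∈ S, ‖π ν v‖) ^ 2 ≤ S.card * ∑ ν ∈ S, ‖π ν v‖ ^ 2 := sq_sum_le_card_mul_sum_sq
    have h4 : ∑ ν ∈ S, ‖π ν v‖ ^ 2 ≤ ∑ ν ∈ S, Q ν v := Finset.sum_le_sum fun ν _ => hQ0 ν v
    have h5 : 0 ≤ ∑ ν ∈ S, Q ν v := Finset.sum_nonneg fun ν _ => hQnn ν v
    have h6 : (S.card : ℝ) * ∑ ν ∈ S, ‖π ν v‖ ^ 2 ≤ S.card * ∑ ν ∈ S, Q ν v := by gcongr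
    simp only [K]
    linarith
  let L : ℂ → ℕ → Mat N := fun ν k =>
    LinearMap.toContinuousLinearMap (((f - algebraMap ℂ _ ν) ^ k) ∘ₗ π ν)
  have hL : ∀ ν k v, L ν k v = y ν v k := fun ν k v => rfl
  let H : Mat N := ∑ ν ∈ S, ∑ k ∈ Finset.range m, ((K / ε * (s ν * t ^ k) : ℝ) : ℂ) •
    (ContinuousLinearMap.adjoint (L ν k) ∘L L ν k)
  have hH : ∀ v w, inner ℂ (H v) w = ∑ ν ∈ S, ∑ k ∈ Finset.range m,
      ((K / ε * (s ν * t ^ k) : ℝ) : ℂ) * inner ℂ (y ν v k) (y ν w k) := by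
    intro v w
    simp only [H, sum_apply, sum_inner, smul_apply,
      inner_smul_left, ContinuousLinearMap.comp_apply, ContinuousLinearMap.adjoint_inner_left,
      hL, Complex.conj_ofReal]
  have hHre : ∀ v w, (inner ℂ (H v) w).re = K / ε * ∑ ν ∈ S, s ν * ∑ k ∈ Finset.range m,
      t ^ k * (inner ℂ (y ν v k) (y ν w k)).re := by
    intro v w
    rw [hH, Complex.re_sum, Finset.mul_sum]
    refine Finset.sum_congr rfl fun ν _ => ?_
    rw [Complex.re_sum, Finset.mul_sum, Finset.mul_sum]
    refine Finset.sum_congr rfl fun k _ => ?_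
    rw [Complex.re_ofReal_mul]
    ring
  have hHq : ∀ v, (inner ℂ (H v) v).re = K / ε * ∑ ν ∈ S, s ν * Q ν v := by
    intro v
    rw [hHre]
    simp only [Q]
    congr 1
    refine Finset.sum_congr rfl fun ν _ => ?_
    congr 1
    refine Finset.sum_congr rfl fun k _ => ?_
    rw [inner_self_eq_norm_sq_to_K]
    norm_cast
  have hQzero : ∀ P : ℂ → Prop, ∀ v ∈ ⨆ (ν : ℂ) (_ : P ν), f.maxGenEigenspace ν,
      ∀ ν, ¬ P ν → Q ν v = 0 := by
    intro P v hv ν hν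
    have hle : (⨆ (ν : ℂ) (_ : P ν), f.maxGenEigenspace ν) ≤ LinearMap.ker (π ν) := by
      refine iSup₂_le fun μ hμ w hw => ?_
      exact hzero ν μ (fun h => hν (h ▸ hμ)) w hw
    have h1 : π ν v = 0 := hle hv
    simp [Q, y, h1]
  have hKε : 0 < K / ε := by positivity
  refine ⟨H, fun v w => ?_, fun v => ?_, ⟨ε⁻¹, by positivity, fun v hv => ?_⟩, fun v hv => ?_⟩
  · rw [hH, ← inner_conj_symm, hH, map_sum]
    refine Finset.sum_congr rfl fun ν _ => ?_
    rw [map_sum]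
    refine Finset.sum_congr rfl fun k _ => ?_
    rw [map_mul, Complex.conj_ofReal, inner_conj_symm]
  · have hν : ∀ ν ∈ S, s ν * ∑ k ∈ Finset.range m,
        t ^ k * (inner ℂ (y ν v k) (y ν (B v) k)).re ≤ -(ε * Q ν v) := by
      intro ν hν
      have h1 : ∑ k ∈ Finset.range m, t ^ k * (inner ℂ (y ν v k) (y ν (B v) k)).re =
          ν.re * Q ν v +
            ∑ k ∈ Finset.range m, t ^ k * (inner ℂ (y ν v k) (y ν v (k + 1))).re := by
        simp only [Q, Finset.mul_sum]
        rw [← Finset.sum_add_distrib]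
        refine Finset.sum_congr rfl fun k _ => ?_
        rw [hyB, inner_add_right, inner_smul_right, inner_self_eq_norm_sq_to_K, Complex.add_re]
        have : ((ν * ((‖y ν v k‖ : ℂ)) ^ 2)).re = ν.re * ‖y ν v k‖ ^ 2 := by
          rw [← Complex.ofReal_pow, Complex.re_mul_ofReal]
        erw [this]
        ring
      have h2 := abs_le.1 (abs_sum_inner_le m hε (y ν v) (hym ν v))
      have h3 := hεS ν hν
      have h4 := hQnn ν v
      rw [h1]
      simp only [s]
      change -(ε * Q ν v) ≤ _ ∧ _ ≤ ε * Q ν v at h2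
      split_ifs with hneg
      · rw [abs_of_neg hneg] at h3
        nlinarith [h2.1, h2.2]
      · rw [abs_of_nonneg (not_lt.1 hneg)] at h3
        nlinarith [h2.1, h2.2]
    rw [hHre]
    have h1 := Finset.sum_le_sum hν
    rw [Finset.sum_neg_distrib, ← Finset.mul_sum] at h1
    have h2 := mul_le_mul_of_nonneg_left h1 hKε.le
    have h3 : K / ε * -(ε * ∑ ν ∈ S, Q ν v) = -(K * ∑ ν ∈ S, Q ν v) := by
      field_simp
    linarith [hKQ v]
  · have h1 : ∑ ν ∈ S, s ν * Q ν v = ∑ ν ∈ S, Q ν v := by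
      refine Finset.sum_congr rfl fun ν _ => ?_
      by_cases h : ν.re < 0
      · simp [s, h]
      · rw [hQzero (fun ν => ν.re < 0) v hv ν h, mul_zero]
    rw [hHq, h1]
    have h2 := hKQ v
    calc ε⁻¹ * ‖v‖ ^ 2 ≤ ε⁻¹ * (K * ∑ ν ∈ S, Q ν v) := by gcongr
      _ = _ := by ring
  · rw [hHq]
    refine mul_nonpos_of_nonneg_of_nonpos hKε.le (Finset.sum_nonpos fun ν _ => ?_)
    by_cases h : 0 < ν.re
    · simp only [s, not_lt.2 h.le, if_false]
      linarith [hQnn ν v]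
    · rw [hQzero (fun ν => 0 < ν.re) v hv ν h, mul_zero]

end Lyapunov

/-! ### Square integrable solutions on a half line -/

section HalfLine

variable {N : ℕ}

/-- `u` solves `u' = a(x) u` on the line. -/
def IsSolution (a : ℝ → Mat N) (u : ℝ → CN N) : Prop := ∀ x, HasDerivAt u (a x (u x)) x

/-- `u` is square integrable on `(0, ∞)`. -/
def L2AtTop (u : ℝ → CN N) : Prop := MemLp u 2 (volume.restrict (Set.Ioi (0 : ℝ)))

theorem IsSolution.continuous {a : ℝ → Mat N} {u : ℝ → CN N} (h : IsSolution a u) :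
    Continuous u :=
  continuous_iff_continuousAt.2 fun x => (h x).continuousAt

theorem norm_restrictScalars_apply_le (a : ℝ →ᵇ Mat N) (x : ℝ) :
    ‖(a x).restrictScalars ℝ‖ ≤ ‖a‖ := by
  rw [ContinuousLinearMap.norm_restrictScalars]
  exact a.norm_coe_le_norm x

theorem exists_solution (a : ℝ →ᵇ Mat N) (v : CN N) : ∃ u, u 0 = v ∧ IsSolution a u := by
  obtain ⟨u, h0, hu⟩ := exists_linear_solution
    (a := fun x => (a x).restrictScalars ℝ)
    ((ContinuousLinearMap.restrictScalarsL ℂ (CN N) (CN N) ℝ ℝ).continuous.comp a.continuous)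
    (norm_restrictScalars_apply_le a) v
  exact ⟨u, h0, hu⟩

theorem IsSolution.norm_le (a : ℝ →ᵇ Mat N) {u : ℝ → CN N} (hu : IsSolution a u) {x y : ℝ}
    (hxy : x ≤ y) : ‖u y‖ ≤ ‖u x‖ * Real.exp (‖a‖ * (y - x)) :=
  norm_le_exp_of_linear_ode (a := fun x => (a x).restrictScalars ℝ)
    (norm_restrictScalars_apply_le a) hu hxy

theorem IsSolution.norm_le_backward (a : ℝ →ᵇ Mat N) {u : ℝ → CN N} (hu : IsSolution a u)
    {x y : ℝ} (hxy : x ≤ y) : ‖u x‖ ≤ ‖u y‖ * Real.exp (‖a‖ * (y - x)) :=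
  norm_le_exp_of_linear_ode_backward (a := fun x => (a x).restrictScalars ℝ)
    (norm_restrictScalars_apply_le a) hu hxy

theorem IsSolution.eq_zero (a : ℝ →ᵇ Mat N) {u : ℝ → CN N} (hu : IsSolution a u) {x : ℝ}
    (hx : u x = 0) (y : ℝ) : u y = 0 :=
  eq_zero_of_linear_ode (a := fun x => (a x).restrictScalars ℝ)
    (norm_restrictScalars_apply_le a) hu hx y

theorem IsSolution.add {a : ℝ → Mat N} {u v : ℝ → CN N} (hu : IsSolution a u)
    (hv : IsSolution a v) : IsSolution a (u + v) := fun x => by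
  simpa using (hu x).add (hv x)

theorem IsSolution.sub {a : ℝ → Mat N} {u v : ℝ → CN N} (hu : IsSolution a u)
    (hv : IsSolution a v) : IsSolution a (u - v) := fun x => by
  simpa using (hu x).sub (hv x)

theorem IsSolution.smul {a : ℝ → Mat N} {u : ℝ → CN N} (hu : IsSolution a u) (c : ℂ) :
    IsSolution a (c • u) := fun x => by
  simpa using (hu x).const_smul c

theorem IsSolution.ext (a : ℝ →ᵇ Mat N) {u v : ℝ → CN N} (hu : IsSolution a u)
    (hv : IsSolution a v) {x : ℝ} (h : u x = v x) : u = v := by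
  funext y
  exact sub_eq_zero.1 ((hu.sub hv).eq_zero a (x := x) (by simp [h]) y)

/-- The solution of `u' = a(x) u` with initial value `v` at `0`. -/
def solution (a : ℝ →ᵇ Mat N) (v : CN N) : ℝ → CN N := (exists_solution a v).choose

theorem solution_zero (a : ℝ →ᵇ Mat N) (v : CN N) : solution a v 0 = v :=
  (exists_solution a v).choose_spec.1

theorem isSolution_solution (a : ℝ →ᵇ Mat N) (v : CN N) : IsSolution a (solution a v) :=
  (exists_solution a v).choose_spec.2

theorem IsSolution.eq_solution (a : ℝ →ᵇ Mat N) {u : ℝ → CN N} (hu : IsSolution a u) :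
    u = solution a (u 0) :=
  hu.ext a (isSolution_solution a _) (x := 0) (solution_zero a _).symm

/-- The flow of `u' = a(x) u` from `0` to `x`. -/
def flow (a : ℝ →ᵇ Mat N) (x : ℝ) : CN N →ₗ[ℂ] CN N where
  toFun v := solution a v x
  map_add' v w := congrFun (((isSolution_solution a _).add (isSolution_solution a _)).ext a
    (isSolution_solution a _) (x := 0) (by simp [solution_zero])).symm x
  map_smul' c v := congrFun (((isSolution_solution a _).smul c).ext a
    (isSolution_solution a _) (x := 0) (by simp [solution_zero])).symm x

theorem flow_apply (a : ℝ →ᵇ Mat N) (x : ℝ) (v : CN N) : flow a x v = solution a v x := rfl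

theorem flow_injective (a : ℝ →ᵇ Mat N) (x : ℝ) : Function.Injective (flow a x) := by
  rw [← LinearMap.ker_eq_bot, LinearMap.ker_eq_bot']
  intro v hv
  have := (isSolution_solution a v).eq_zero a hv 0
  rwa [solution_zero] at this

/-- The initial values at `0` of the solutions of `u' = a(x) u` that are square integrable on
`(0, ∞)`. -/
def decaySpace (a : ℝ →ᵇ Mat N) : Submodule ℂ (CN N) where
  carrier := {v | L2AtTop (solution a v)}
  zero_mem' := by
    have : solution a (0 : CN N) = fun _ => 0 := funext fun x => (flow a x).map_zero
    simp [this, L2AtTop]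
  add_mem' {v w} hv hw := by
    have : solution a (v + w) = solution a v + solution a w := funext fun x => (flow a x).map_add v w
    simpa [this, L2AtTop] using MemLp.add hv hw
  smul_mem' c v hv := by
    have : solution a (c • v) = c • solution a v := funext fun x => (flow a x).map_smul c v
    simpa [this, L2AtTop] using MemLp.const_smul hv c

theorem mem_decaySpace {a : ℝ →ᵇ Mat N} {v : CN N} :
    v ∈ decaySpace a ↔ L2AtTop (solution a v) := Iff.rfl

/-- The form `H` decreases along the flow of `u' = a(x) u` on `[x₀, ∞)`. -/
structure IsLyapunovFrom (a : ℝ → Mat N) (H : Mat N) (x₀ : ℝ) : Prop where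
  symm : ∀ v w, inner ℂ (H v) w = inner ℂ v (H w)
  decay : ∀ x, x₀ ≤ x → ∀ v, (inner ℂ (H v) (a x v)).re ≤ -(1 / 2) * ‖v‖ ^ 2

theorem abs_form_le (H : Mat N) (v w : CN N) : |(inner ℂ (H v) w).re| ≤ ‖H‖ * ‖v‖ * ‖w‖ :=
  (Complex.abs_re_le_norm _).trans ((norm_inner_le_norm _ _).trans
    (mul_le_mul_of_nonneg_right (H.le_opNorm v) (norm_nonneg _)))

theorem IsLyapunov.isLyapunovFrom {B H : Mat N} (h : IsLyapunov B H) {a : ℝ → Mat N} {x₀ : ℝ}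
    (ha : ∀ x, x₀ ≤ x → ‖a x - B‖ ≤ 1 / (2 * (‖H‖ + 1))) : IsLyapunovFrom a H x₀ := by
  refine ⟨h.symm, fun x hx v => ?_⟩
  have e : inner ℂ (H v) (a x v) = inner ℂ (H v) (B v) + inner ℂ (H v) ((a x - B) v) := by
    rw [← inner_add_right]
    simp
  have h1 := h.decay v
  have h2 := (le_abs_self _).trans (abs_form_le H v ((a x - B) v))
  have h3 : ‖(a x - B) v‖ ≤ 1 / (2 * (‖H‖ + 1)) * ‖v‖ :=
    (ContinuousLinearMap.le_opNorm _ _).trans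
      (mul_le_mul_of_nonneg_right (ha x hx) (norm_nonneg _))
  have h4 : ‖H‖ * ‖v‖ * ‖(a x - B) v‖ ≤ 1 / 2 * ‖v‖ ^ 2 := by
    have hH := norm_nonneg H
    calc ‖H‖ * ‖v‖ * ‖(a x - B) v‖ ≤ (‖H‖ + 1) * ‖v‖ * (1 / (2 * (‖H‖ + 1)) * ‖v‖) := by
          gcongr
          linarith
      _ = _ := by field_simp
  rw [e, Complex.add_re]
  linarith

namespace IsLyapunovFrom

variable {a : ℝ →ᵇ Mat N} {H : Mat N} {x₀ : ℝ} {u : ℝ → CN N}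

theorem hasDerivAt_form (h : IsLyapunovFrom a H x₀) (hu : IsSolution a u) (x : ℝ) :
    HasDerivAt (fun x => (inner ℂ (H (u x)) (u x)).re)
      (2 * (inner ℂ (H (u x)) (a x (u x))).re) x := by
  have h1 : HasDerivAt (fun x => H (u x)) (H (a x (u x))) x :=
    (H.restrictScalars ℝ).hasFDerivAt.comp_hasDerivAt x (hu x)
  have h2 := h1.inner ℂ (hu x)
  have h3 := Complex.reCLM.hasFDerivAt.comp_hasDerivAt x h2
  refine h3.congr_deriv ?_
  rw [h.symm (a x (u x)), ← inner_conj_symm (a x (u x))]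
  simp only [Complex.reCLM_apply, Complex.add_re, Complex.conj_re]
  ring

theorem integral_le (h : IsLyapunovFrom a H x₀) (hu : IsSolution a u) {x y : ℝ} (hx : x₀ ≤ x)
    (hxy : x ≤ y) : ∫ t in x..y, ‖u t‖ ^ 2 ≤
      (inner ℂ (H (u x)) (u x)).re - (inner ℂ (H (u y)) (u y)).re := by
  have hc : Continuous fun t => ‖u t‖ ^ 2 := hu.continuous.norm.pow 2
  have hd : ∀ t, HasDerivAt (fun t => (inner ℂ (H (u t)) (u t)).re + ∫ s in x..t, ‖u s‖ ^ 2)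
      (2 * (inner ℂ (H (u t)) (a t (u t))).re + ‖u t‖ ^ 2) t := fun t =>
    (h.hasDerivAt_form hu t).add (intervalIntegral.integral_hasDerivAt_right
      (hc.intervalIntegrable _ _) (hc.stronglyMeasurableAtFilter _ _) hc.continuousAt)
  have hanti : AntitoneOn (fun t => (inner ℂ (H (u t)) (u t)).re + ∫ s in x..t, ‖u s‖ ^ 2)
      (Set.Ici x) := by
    refine antitoneOn_of_deriv_nonpos (convex_Ici x)
      (fun t _ => (hd t).continuousAt.continuousWithinAt)
      (fun t _ => (hd t).differentiableAt.differentiableWithinAt) fun t ht => ?_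
    rw [interior_Ici] at ht
    rw [(hd t).deriv]
    have := h.decay t (hx.trans (le_of_lt ht)) (u t)
    linarith
  have := hanti (Set.mem_Ici.2 le_rfl) (Set.mem_Ici.2 hxy) hxy
  simp only [intervalIntegral.integral_same, add_zero] at this
  linarith

theorem antitoneOn_form (h : IsLyapunovFrom a H x₀) (hu : IsSolution a u) {x y : ℝ}
    (hx : x₀ ≤ x) (hxy : x ≤ y) :
    (inner ℂ (H (u y)) (u y)).re ≤ (inner ℂ (H (u x)) (u x)).re := by
  have h1 := h.integral_le hu hx hxy
  have h2 : 0 ≤ ∫ t in x..y, ‖u t‖ ^ 2 :=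
    intervalIntegral.integral_nonneg hxy fun t _ => by positivity
  linarith

/-- The integral of `‖u‖²` is bounded by the decrease of the form, hence finite as long as the form
stays nonnegative. -/
theorem l2AtTop_of_form_nonneg (h : IsLyapunovFrom a H x₀) (hu : IsSolution a u)
    (hq : ∀ x, x₀ ≤ x → 0 ≤ (inner ℂ (H (u x)) (u x)).re) : L2AtTop u := by
  have hc : Continuous fun t => ‖u t‖ ^ 2 := hu.continuous.norm.pow 2
  rw [L2AtTop, memLp_two_iff_integrable_sq_norm hu.continuous.aestronglyMeasurable]
  have h1 : IntegrableOn (fun t => ‖u t‖ ^ 2) (Set.Ioi x₀) := by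
    refine integrableOn_Ioi_of_intervalIntegral_norm_bounded (l := atTop) (b := fun y => y)
      ((inner ℂ (H (u x₀)) (u x₀)).re) x₀ (fun y => hc.integrableOn_Ioc) tendsto_id ?_
    filter_upwards [eventually_ge_atTop x₀] with y hy
    have h2 := h.integral_le hu le_rfl hy
    have h3 := hq y hy
    have e : ∀ t, ‖‖u t‖ ^ 2‖ = ‖u t‖ ^ 2 := fun t => Real.norm_of_nonneg (by positivity)
    simp only [e]
    linarith
  have h2 : IntegrableOn (fun t => ‖u t‖ ^ 2) (Set.Icc 0 x₀) := hc.integrableOn_Icc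
  refine (h2.union h1).mono_set fun t ht => ?_
  rcases le_or_gt t x₀ with h | h
  · exact Or.inl ⟨le_of_lt ht, h⟩
  · exact Or.inr h

theorem form_nonneg_of_l2AtTop (h : IsLyapunovFrom a H x₀) (hx₀ : 0 ≤ x₀) (hu : IsSolution a u)
    (hL : L2AtTop u) {x : ℝ} (hx : x₀ ≤ x) : 0 ≤ (inner ℂ (H (u x)) (u x)).re := by
  by_contra! hneg
  set q := (inner ℂ (H (u x)) (u x)).re with hq
  have hc : Continuous fun t => ‖u t‖ ^ 2 := hu.continuous.norm.pow 2
  rw [L2AtTop, memLp_two_iff_integrable_sq_norm hu.continuous.aestronglyMeasurable] at hL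
  -- `q` stays below its negative value, which keeps `‖u‖` away from zero
  have hlow : ∀ t, x ≤ t → -q / (‖H‖ + 1) ≤ ‖u t‖ ^ 2 := by
    intro t ht
    have h1 := h.antitoneOn_form hu hx ht
    have h2 := (abs_le.1 (abs_form_le H (u t) (u t))).1
    rw [div_le_iff₀ (by positivity)]
    nlinarith [norm_nonneg H, sq_nonneg ‖u t‖]
  set I := ∫ t in Set.Ioi (0 : ℝ), ‖u t‖ ^ 2 with hI
  have hpos : 0 < -q / (‖H‖ + 1) := div_pos (by linarith) (by positivity)
  set κ := -q / (‖H‖ + 1)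
  have hI0 : 0 ≤ I := integral_nonneg fun t => by positivity
  set y := x + (I + 1) / κ with hy
  have hxy : x ≤ y := by
    have : 0 ≤ (I + 1) / κ := by positivity
    linarith
  have h1 : ∫ t in x..y, κ ≤ ∫ t in x..y, ‖u t‖ ^ 2 :=
    intervalIntegral.integral_mono_on hxy (by simp) (hc.intervalIntegrable _ _)
      fun t ht => hlow t ht.1
  have h2 : ∫ t in x..y, ‖u t‖ ^ 2 ≤ I := by
    rw [intervalIntegral.integral_of_le hxy]
    refine setIntegral_mono_set hL (ae_of_all _ fun t => by positivity) ?_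
    exact LE.le.eventuallyLE fun t ht => (hx₀.trans hx).trans_lt ht.1
  rw [intervalIntegral.integral_const, smul_eq_mul, hy] at h1
  have h3 : (x + (I + 1) / κ - x) * κ = I + 1 := by field_simp; ring
  rw [h3] at h1
  rw [hy] at h2
  linarith

/-- On square integrable solutions the form controls the norm pointwise. -/
theorem norm_sq_le_form (h : IsLyapunovFrom a H x₀) (hx₀ : 0 ≤ x₀) (hu : IsSolution a u)
    (hL : L2AtTop u) {x : ℝ} (hx : x₀ ≤ x) :
    ‖u x‖ ^ 2 ≤ Real.exp (2 * ‖a‖) * (inner ℂ (H (u x)) (u x)).re := by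
  have hc : Continuous fun t => ‖u t‖ ^ 2 := hu.continuous.norm.pow 2
  have h1 := h.integral_le hu hx (by linarith : x ≤ x + 1)
  have h2 := h.form_nonneg_of_l2AtTop hx₀ hu hL (by linarith : x₀ ≤ x + 1)
  have h3 : ∫ t in x..(x + 1), Real.exp (-(2 * ‖a‖)) * ‖u x‖ ^ 2 ≤
      ∫ t in x..(x + 1), ‖u t‖ ^ 2 := by
    refine intervalIntegral.integral_mono_on (by linarith) (by simp) (hc.intervalIntegrable _ _)
      fun t ht => ?_
    have h4 := hu.norm_le_backward a ht.1
    have h5 : ‖u x‖ ≤ ‖u t‖ * Real.exp ‖a‖ := by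
      refine h4.trans (mul_le_mul_of_nonneg_left (Real.exp_le_exp.2 ?_) (norm_nonneg _))
      have := ht.2
      nlinarith [norm_nonneg a]
    have h6 : ‖u x‖ ^ 2 ≤ ‖u t‖ ^ 2 * Real.exp (2 * ‖a‖) := by
      calc ‖u x‖ ^ 2 ≤ (‖u t‖ * Real.exp ‖a‖) ^ 2 := by gcongr
        _ = _ := by rw [mul_pow, ← Real.exp_nat_mul]; norm_num
    rw [Real.exp_neg, ← div_eq_inv_mul, div_le_iff₀ (Real.exp_pos _)]
    exact h6
  rw [intervalIntegral.integral_const, smul_eq_mul, add_sub_cancel_left, one_mul] at h3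
  have h7 : Real.exp (-(2 * ‖a‖)) * ‖u x‖ ^ 2 ≤ (inner ℂ (H (u x)) (u x)).re := by linarith
  rw [Real.exp_neg, ← div_eq_inv_mul, div_le_iff₀ (Real.exp_pos _)] at h7
  linarith

end IsLyapunovFrom

/-- Square integrable solutions decay exponentially, with constants that depend only on the
Lyapunov form and a bound of the coefficients. -/
theorem exists_uniform_decay (H : Mat N) {x₀ : ℝ} (hx₀ : 0 ≤ x₀) (M : ℝ) :
    ∃ C δ : ℝ, 0 ≤ C ∧ 0 < δ ∧ ∀ a : ℝ →ᵇ Mat N, ‖a‖ ≤ M → IsLyapunovFrom a H x₀ →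
      ∀ u, IsSolution a u → L2AtTop u → ∀ x, 0 ≤ x →
        ‖u x‖ ≤ C * Real.exp (-δ * x) * ‖u 0‖ := by
  set h := ‖H‖ + 1 with hh
  have hpos : 0 < h := by positivity
  refine ⟨Real.exp M * h * Real.exp (|M| * x₀) * Real.exp ((2 * h)⁻¹ * x₀), (2 * h)⁻¹, by positivity,
    by positivity, fun a haM hLy u hu hL x hx => ?_⟩
  have hM0 : 0 ≤ M := (norm_nonneg a).trans haM
  rw [abs_of_nonneg hM0]
  have hstart : ∀ y, 0 ≤ y → y ≤ x₀ → ‖u y‖ ≤ Real.exp (M * x₀) * ‖u 0‖ := by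
    intro y hy hyx
    refine (hu.norm_le a hy).trans ?_
    rw [mul_comm]
    refine mul_le_mul_of_nonneg_right (Real.exp_le_exp.2 ?_) (norm_nonneg _)
    have := norm_nonneg a
    rw [sub_zero]
    exact mul_le_mul haM hyx hy hM0
  have h1exp : 1 ≤ Real.exp M := Real.one_le_exp hM0
  have hh1 : 1 ≤ h := by rw [hh]; linarith [norm_nonneg H]
  rcases le_total x x₀ with hxx | hxx
  · have h2 : 1 ≤ Real.exp ((2 * h)⁻¹ * x₀) * Real.exp (-(2 * h)⁻¹ * x) := by
      rw [← Real.exp_add]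
      refine Real.one_le_exp ?_
      have : 0 ≤ (2 * h)⁻¹ * (x₀ - x) := mul_nonneg (by positivity) (by linarith)
      linarith
    calc ‖u x‖ ≤ 1 * (Real.exp (M * x₀) * ‖u 0‖) * 1 := by simpa using hstart x hx hxx
      _ ≤ (Real.exp M * h) * (Real.exp (M * x₀) * ‖u 0‖) *
          (Real.exp ((2 * h)⁻¹ * x₀) * Real.exp (-(2 * h)⁻¹ * x)) := by
        gcongr
        nlinarith
      _ = _ := by ring
  · let q : ℝ → ℝ := fun t => (inner ℂ (H (u t)) (u t)).re
    have hqle : ∀ t, q t ≤ h * ‖u t‖ ^ 2 := fun t => by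
      have := (le_abs_self _).trans (abs_form_le H (u t) (u t))
      nlinarith [sq_nonneg ‖u t‖]
    have hd : ∀ t, HasDerivAt (fun t => q t * Real.exp (h⁻¹ * t))
        (2 * (inner ℂ (H (u t)) (a t (u t))).re * Real.exp (h⁻¹ * t) +
          q t * (Real.exp (h⁻¹ * t) * h⁻¹)) t := fun t => by
      refine (hLy.hasDerivAt_form hu t).mul ?_
      have := ((hasDerivAt_id t).const_mul h⁻¹).exp
      simpa using this
    -- `q' ≤ -‖u‖² ≤ -q / h`
    have hanti : AntitoneOn (fun t => q t * Real.exp (h⁻¹ * t)) (Set.Ici x₀) := by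
      refine antitoneOn_of_deriv_nonpos (convex_Ici x₀)
        (fun t _ => (hd t).continuousAt.continuousWithinAt)
        (fun t _ => (hd t).differentiableAt.differentiableWithinAt) fun t ht => ?_
      rw [interior_Ici] at ht
      rw [(hd t).deriv]
      have h1 := hLy.decay t (le_of_lt ht) (u t)
      have h2 : q t * h⁻¹ ≤ ‖u t‖ ^ 2 := by
        rw [← div_eq_mul_inv, div_le_iff₀ hpos]
        linarith [hqle t]
      have h3 := Real.exp_pos (h⁻¹ * t)
      nlinarith
    have h1 := hanti (Set.mem_Ici.2 le_rfl) (Set.mem_Ici.2 hxx) hxx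
    have h2 := hLy.norm_sq_le_form hx₀ hu hL hxx
    have h3 := hstart x₀ hx₀ le_rfl
    have h4 : q x ≤ h * (Real.exp (M * x₀) * ‖u 0‖) ^ 2 * Real.exp (h⁻¹ * x₀) *
        Real.exp (-(h⁻¹ * x)) := by
      rw [Real.exp_neg, ← div_eq_mul_inv, le_div_iff₀ (Real.exp_pos _)]
      refine h1.trans (mul_le_mul_of_nonneg_right ?_ (Real.exp_pos _).le)
      exact (hqle x₀).trans (by gcongr)
    have h5 : ‖u x‖ ^ 2 ≤ (Real.exp M * h * Real.exp (M * x₀) * Real.exp ((2 * h)⁻¹ * x₀) *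
        Real.exp (-(2 * h)⁻¹ * x) * ‖u 0‖) ^ 2 := by
      have e1 : Real.exp (2 * ‖a‖) ≤ Real.exp M ^ 2 := by
        rw [← Real.exp_nat_mul]
        refine Real.exp_le_exp.2 ?_
        push_cast
        linarith
      have e2 : Real.exp ((2 * h)⁻¹ * x₀) ^ 2 = Real.exp (h⁻¹ * x₀) := by
        rw [← Real.exp_nat_mul]
        congr 1
        field_simp
        simp
      have e3 : Real.exp (-(2 * h)⁻¹ * x) ^ 2 = Real.exp (-(h⁻¹ * x)) := by
        rw [← Real.exp_nat_mul]
        congr 1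
        field_simp
        simp
      have hq0 := hLy.form_nonneg_of_l2AtTop hx₀ hu hL hxx
      calc ‖u x‖ ^ 2 ≤ Real.exp (2 * ‖a‖) * q x := h2
        _ ≤ Real.exp M ^ 2 * (h * (Real.exp (M * x₀) * ‖u 0‖) ^ 2 * Real.exp (h⁻¹ * x₀) *
            Real.exp (-(h⁻¹ * x))) := by gcongr
        _ ≤ Real.exp M ^ 2 * (h ^ 2 * (Real.exp (M * x₀) * ‖u 0‖) ^ 2 * Real.exp (h⁻¹ * x₀) *
            Real.exp (-(h⁻¹ * x))) := by
            gcongr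
            nlinarith
        _ = _ := by rw [← e2, ← e3]; ring
    exact le_of_sq_le_sq h5 (by positivity)

/-- The stable family consists of the values of the square integrable solutions. The form is
positive on the stable space, hence on `E x` for large `x`, so solutions in `E` are square
integrable; on the other hand the values of square integrable solutions form a subspace
transverse to the unstable space, and equality follows by counting dimensions. -/
theorem IsStableFamily.eq_decaySpace {a : ℝ →ᵇ Mat N} {B : Mat N} (hB : IsHyperbolic B)
    (ha : Tendsto a atTop (𝓝 B)) {E : ℝ → Submodule ℂ (CN N)} (hE : IsStableFamily a B E) :
    E 0 = decaySpace a := by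
  obtain ⟨H, hH⟩ := hB.exists_isLyapunov
  obtain ⟨c, hc, hpos⟩ := hH.pos
  obtain ⟨hinv, hlim⟩ := hE
  set η : ℝ := min (1 / 2) (c / (12 * (‖H‖ + 1))) with hη
  have hη0 : 0 < η := lt_min (by norm_num) (by positivity)
  have h1 : ∀ᶠ x in atTop, ‖a x - B‖ ≤ 1 / (2 * (‖H‖ + 1)) := by
    have := Metric.tendsto_nhds.1 ha (1 / (2 * (‖H‖ + 1))) (by positivity)
    filter_upwards [this] with x hx
    rw [← dist_eq_norm]
    exact hx.le
  have h2 : ∀ᶠ x in atTop, ‖(E x).starProjection - (stableSpace B).starProjection‖ ≤ η := by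
    have := Metric.tendsto_nhds.1 hlim η hη0
    filter_upwards [this] with x hx
    rw [← dist_eq_norm]
    exact hx.le
  obtain ⟨x₁, hx₁⟩ := eventually_atTop.1 (h1.and h2)
  set x₀ := max x₁ 0 with hx₀def
  have hx₀ : 0 ≤ x₀ := le_max_right _ _
  have hLy : IsLyapunovFrom a H x₀ :=
    hH.isLyapunovFrom fun x hx => (hx₁ x ((le_max_left _ _).trans hx)).1
  have hproj : ∀ x, x₀ ≤ x → ∀ v ∈ E x, ‖v - (stableSpace B).starProjection v‖ ≤ η * ‖v‖ := by
    intro x hx v hv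
    have e : v - (stableSpace B).starProjection v =
        ((E x).starProjection - (stableSpace B).starProjection) v := by
      rw [sub_apply, Submodule.starProjection_eq_self_iff.2 hv]
    rw [e]
    exact (ContinuousLinearMap.le_opNorm _ _).trans
      (mul_le_mul_of_nonneg_right (hx₁ x ((le_max_left _ _).trans hx)).2 (norm_nonneg _))
  -- vectors of `E x` are close to the stable space, where the form is at least `c ‖v‖²`
  have hform : ∀ x, x₀ ≤ x → ∀ v ∈ E x, 0 ≤ (inner ℂ (H v) v).re := by
    intro x hx v hv
    set w := (stableSpace B).starProjection v with hw
    set d := v - w with hd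
    have hdle : ‖d‖ ≤ η * ‖v‖ := hproj x hx v hv
    have hwle : ‖w‖ ≤ ‖v‖ := (stableSpace B).norm_starProjection_apply_le v
    have hwpos := hpos w (Submodule.starProjection_apply_mem _ _)
    have hvw : v = w + d := by rw [hd]; abel
    have e : inner ℂ (H v) v = inner ℂ (H w) w + inner ℂ (H w) d + (inner ℂ (H d) v) := by
      conv_lhs => rw [hvw]
      rw [map_add, inner_add_left, inner_add_right, ← hvw]
    have h3 := (abs_le.1 (abs_form_le H w d)).1
    have h4 := (abs_le.1 (abs_form_le H d v)).1
    have hη1 : η ≤ 1 / 2 := min_le_left _ _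
    have hη2 : η * (12 * (‖H‖ + 1)) ≤ c := by
      rw [← le_div_iff₀ (by positivity)]
      exact min_le_right _ _
    have h5 : ‖v‖ / 2 ≤ ‖w‖ := by
      have : ‖v‖ ≤ ‖w‖ + ‖d‖ := by
        conv_lhs => rw [hvw]
        exact norm_add_le _ _
      nlinarith [norm_nonneg v]
    have h6 : c * (‖v‖ / 2) ^ 2 ≤ c * ‖w‖ ^ 2 := by gcongr
    have h7 : ‖H‖ * ‖w‖ * ‖d‖ ≤ ‖H‖ * ‖v‖ * (η * ‖v‖) := by gcongr
    have h8 : ‖H‖ * ‖d‖ * ‖v‖ ≤ ‖H‖ * (η * ‖v‖) * ‖v‖ := by gcongr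
    have h9 : 12 * η * ‖H‖ * ‖v‖ ^ 2 ≤ c * ‖v‖ ^ 2 := by
      have : 12 * η * ‖H‖ ≤ c := by nlinarith
      gcongr
    rw [e, Complex.add_re, Complex.add_re]
    nlinarith
  have hle : E 0 ≤ decaySpace a := by
    intro v hv
    refine hLy.l2AtTop_of_form_nonneg (isSolution_solution a v) fun x hx => ?_
    refine hform x hx _ (hinv _ (isSolution_solution a v) 0 x ?_)
    rwa [solution_zero]
  refine Submodule.eq_of_le_of_finrank_le hle ?_
  -- dimension count at `x₀`: the flow of `decaySpace a` is disjoint from the unstable space, so that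
  -- its dimension is at most `dim (stableSpace B) ≤ dim (E x₀) ≤ dim (E 0)`
  have hS : Module.finrank ℂ ((decaySpace a).map (flow a x₀)) = Module.finrank ℂ (decaySpace a) :=
    (LinearEquiv.finrank_eq (Submodule.equivMapOfInjective _ (flow_injective a x₀) _)).symm
  have hdisj : Disjoint ((decaySpace a).map (flow a x₀)) (unstableSpace B) := by
    rw [Submodule.disjoint_def]
    rintro _ ⟨v, hv, rfl⟩ hun
    have h3 := hLy.norm_sq_le_form hx₀ (isSolution_solution a v) hv le_rfl
    have h4 := hH.nonpos _ hun
    rw [flow_apply] at h4 ⊢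
    have h5 : ‖solution a v x₀‖ ^ 2 ≤ 0 := by nlinarith [Real.exp_pos (2 * ‖a‖)]
    have h6 : ‖solution a v x₀‖ = 0 := by
      rw [← sq_eq_zero_iff]
      exact le_antisymm h5 (sq_nonneg _)
    exact norm_eq_zero.1 h6
  have hd1 := Submodule.finrank_add_finrank_le_of_disjoint hdisj
  have hd2 := Submodule.finrank_add_le_finrank_add_finrank (stableSpace B) (unstableSpace B)
  rw [hB.stable_sup_unstable, finrank_top] at hd2
  have hd3 : Module.finrank ℂ (stableSpace B) ≤ Module.finrank ℂ (E x₀) := by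
    let L : stableSpace B →ₗ[ℂ] E x₀ :=
      (((E x₀).starProjection : CN N →ₗ[ℂ] CN N).comp (Submodule.subtype _)).codRestrict _
        fun v => Submodule.starProjection_apply_mem _ _
    refine LinearMap.finrank_le_finrank_of_injective (f := L) ?_
    rw [← LinearMap.ker_eq_bot, LinearMap.ker_eq_bot']
    rintro ⟨v, hv⟩ h
    have h3 : (E x₀).starProjection v = 0 := congrArg Subtype.val h
    have h4 : v = -(((E x₀).starProjection - (stableSpace B).starProjection) v) := by
      rw [sub_apply, Submodule.starProjection_eq_self_iff.2 hv, h3]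
      simp
    have h5 : ‖v‖ ≤ η * ‖v‖ := by
      conv_lhs => rw [h4, norm_neg]
      exact (ContinuousLinearMap.le_opNorm _ _).trans
        (mul_le_mul_of_nonneg_right (hx₁ x₀ (le_max_left _ _)).2 (norm_nonneg _))
    have hη1 : η ≤ 1 / 2 := min_le_left _ _
    have h6 : ‖v‖ = 0 := by nlinarith [norm_nonneg v]
    exact Subtype.ext (norm_eq_zero.1 h6)
  have hd4 : Module.finrank ℂ (E x₀) ≤ Module.finrank ℂ (E 0) := by
    have hsub : E x₀ ≤ (E 0).map (flow a x₀) := by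
      intro w hw
      obtain ⟨v, rfl⟩ := LinearMap.surjective_of_injective (flow_injective a x₀) w
      refine ⟨v, ?_, rfl⟩
      have := hinv _ (isSolution_solution a v) x₀ 0 hw
      rwa [solution_zero] at this
    exact (Submodule.finrank_mono hsub).trans (Submodule.finrank_map_le _ _)
  omega

end HalfLine

/-! ### Jets of solutions -/

section JetSolutions

variable {N n : ℕ}

/-- `U` solves the jet system `U_m' = ∑_{j ≤ m} a_{m-j}(x) U_j`: the equation satisfied by the
first `n` Taylor coefficients in `z` of solutions of `u' = A(x; z) u`, if `a` are the Taylor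
coefficients of `A`. -/
def IsJetSolution (a : ℕ → ℝ →ᵇ Mat N) (U : Fin n → ℝ → CN N) : Prop :=
  ∀ m x, HasDerivAt (U m) (conv (fun i => a i x) (fun j => U j x) m) x

theorem exists_jetSolution (a : ℕ → ℝ →ᵇ Mat N) (b : Fin n → CN N) :
    ∃ U : Fin n → ℝ → CN N, IsJetSolution a U ∧ ∀ m, U m 0 = b m := by
  let op : ℝ → (Fin n → CN N) →L[ℂ] (Fin n → CN N) := fun x =>
    LinearMap.toContinuousLinearMap (convₗ n fun i => a i x)
  have hop : Continuous op := by
    rw [continuous_clm_apply]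
    intro v
    refine continuous_pi fun m => ?_
    change Continuous fun x => conv (fun i => a i x) v m
    unfold conv
    exact continuous_finsetSum _ fun j _ => (a _).continuous.clm_apply continuous_const
  have hbd : ∀ x, ‖(op x).restrictScalars ℝ‖ ≤ ∑ _j : Fin n, ∑ i ∈ Finset.range n, ‖a i‖ := by
    intro x
    rw [ContinuousLinearMap.norm_restrictScalars]
    refine ContinuousLinearMap.opNorm_le_bound _ (by positivity) fun v => ?_
    refine (pi_norm_le_iff_of_nonneg (by positivity)).2 fun m => ?_
    change ‖conv (fun i => a i x) v m‖ ≤ _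
    unfold conv
    refine (norm_sum_le _ _).trans ?_
    rw [Finset.sum_mul]
    refine (Finset.sum_le_sum fun j _ => ?_).trans
      (Finset.sum_le_sum_of_subset_of_nonneg (Finset.subset_univ _)
        fun j _ _ => by positivity)
    refine (ContinuousLinearMap.le_opNorm _ _).trans
      (mul_le_mul ?_ (norm_le_pi_norm v j) (norm_nonneg _) (by positivity))
    refine ((a _).norm_coe_le_norm x).trans ?_
    exact Finset.single_le_sum (f := fun i => ‖a i‖) (fun i _ => norm_nonneg (a i))
      (Finset.mem_range.2 (by omega))
  obtain ⟨u, h0, hu⟩ := exists_linear_solution (a := fun x => (op x).restrictScalars ℝ)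
    ((ContinuousLinearMap.restrictScalarsL ℂ _ _ ℝ ℝ).continuous.comp hop) hbd b
  refine ⟨fun m x => u x m, fun m x => ?_, fun m => congrFun h0 m⟩
  exact hasDerivAt_pi.1 (hu x) m

theorem IsJetSolution.continuous {a : ℕ → ℝ →ᵇ Mat N} {U : Fin n → ℝ → CN N}
    (hU : IsJetSolution a U) (m : Fin n) : Continuous (U m) :=
  continuous_iff_continuousAt.2 fun x => (hU m x).continuousAt

theorem IsJetSolution.sub {a : ℕ → ℝ →ᵇ Mat N} {U V : Fin n → ℝ → CN N}
    (hU : IsJetSolution a U) (hV : IsJetSolution a V) : IsJetSolution a (U - V) := fun m x => by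
  have h := (convₗ n fun i => a i x).map_sub (fun j => U j x) (fun j => V j x)
  exact ((hU m x).sub (hV m x)).congr_deriv (congrFun h m).symm

/-- The lowest nonvanishing coefficient of a jet solution solves the equation at the base point. -/
theorem IsJetSolution.isSolution {a : ℕ → ℝ →ᵇ Mat N} {U : Fin n → ℝ → CN N}
    (hU : IsJetSolution a U) {m : Fin n} (hlow : ∀ j < m, U j = 0) : IsSolution (a 0) (U m) := by
  intro x
  refine (hU m x).congr_deriv ?_
  unfold conv
  rw [Finset.sum_eq_single m]
  · simp
  · intro j hj hne
    simp [hlow j (lt_of_le_of_ne (Finset.mem_Iic.1 hj) hne)]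
  · intro h
    exact absurd (Finset.mem_Iic.2 le_rfl) h

theorem IsJetSolution.eq_zero {a : ℕ → ℝ →ᵇ Mat N} {U : Fin n → ℝ → CN N}
    (hU : IsJetSolution a U) {m : Fin n} (h0 : ∀ j ≤ m, U j 0 = 0) : U m = 0 := by
  induction m using WellFoundedLT.induction with
  | ind m ih =>
    have hs := hU.isSolution (m := m) fun j hj => ih j hj fun i hi => h0 i (hi.trans hj.le)
    exact funext fun x => hs.eq_zero (a 0) (h0 m le_rfl) x

theorem IsJetSolution.ext {a : ℕ → ℝ →ᵇ Mat N} {U V : Fin n → ℝ → CN N}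
    (hU : IsJetSolution a U) (hV : IsJetSolution a V) (h0 : ∀ m, U m 0 = V m 0) : U = V := by
  funext m
  exact sub_eq_zero.1 ((hU.sub hV).eq_zero (m := m) fun j _ => by simp [h0 j])

/-- A solution of the jet system consists of the Taylor coefficients at `z₁` of the solutions
`u z` of `u' = A(x; z) u` if this holds at `x = 0`. This is a Gronwall estimate for the Taylor
remainder. -/
theorem IsJetSolution.isBigO {A : ℂ → ℝ →ᵇ Mat N} {z₁ : ℂ} {a : ℕ → ℝ →ᵇ Mat N}
    (hA : IsTaylor A z₁ a) {U : Fin n → ℝ → CN N} (hU : IsJetSolution a U)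
    {u : ℂ → ℝ → CN N} (hu : ∀ z, IsSolution (A z) (u z))
    (h0 : (fun z => u z 0 - jetPoly z₁ (fun m => U m 0) z) =O[𝓝 z₁] fun z => (z - z₁) ^ n)
    {x : ℝ} (hx : 0 ≤ x) :
    (fun z => u z x - jetPoly z₁ (fun m => U m x) z) =O[𝓝 z₁] fun z => (z - z₁) ^ n := by
  obtain ⟨M, hM⟩ : ∃ M : ℝ, ∀ᶠ z in 𝓝 z₁, ‖A z‖ ≤ M := IsTaylor.exists_bound hA
  obtain ⟨C₀, hC₀⟩ := h0.bound
  have hrem : ∀ j : Fin n, ∃ C : ℝ, ∀ᶠ z in 𝓝 z₁,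
      ‖A z - ∑ i ∈ Finset.range (n - j), (z - z₁) ^ i • a i‖ ≤ C * ‖(z - z₁) ^ (n - (j : ℕ))‖ :=
    fun j => (hA (n - j)).bound
  choose C hC using hrem
  have hK : ∀ j : Fin n, ∃ K : ℝ, ∀ y ∈ Set.Icc 0 x, ‖U j y‖ ≤ K := fun j =>
    isCompact_Icc.exists_bound_of_continuousOn (hU.continuous j).continuousOn
  choose K hK using hK
  set M' := |M| + 1 with hM'
  have hM'pos : 0 < M' := by positivity
  set e := ∑ j, C j * K j with he
  refine IsBigO.of_bound (C₀ * Real.exp (M' * x) + e / M' * (Real.exp (M' * x) - 1)) ?_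
  filter_upwards [hM, hC₀, eventually_all.2 hC] with z hMz hC₀z hCz
  have hder : ∀ y, HasDerivAt (fun y => u z y - jetPoly z₁ (fun m => U m y) z)
      (A z y (u z y) - jetPoly z₁ (conv (fun i => a i y) fun j => U j y) z) y := by
    intro y
    refine (hu z y).sub ?_
    unfold jetPoly
    exact HasDerivAt.fun_sum fun m _ => (hU m y).const_smul ((z - z₁) ^ (m : ℕ))
  have hforce : ∀ y ∈ Set.Icc 0 x, ‖A z y (jetPoly z₁ (fun m => U m y) z) -
      jetPoly z₁ (conv (fun i => a i y) fun j => U j y) z‖ ≤ e * ‖(z - z₁) ^ n‖ := by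
    intro y hy
    rw [apply_jetPoly_sub (fun z => A z y) (fun i => a i y), he, Finset.sum_mul]
    refine (norm_sum_le _ _).trans (Finset.sum_le_sum fun j _ => ?_)
    have e1 : (A z y - ∑ i ∈ Finset.range (n - j), (z - z₁) ^ i • a i y) =
        (A z - ∑ i ∈ Finset.range (n - j), (z - z₁) ^ i • a i) y := by
      simp
    have e2 : n = j + (n - j) := by omega
    rw [e1, norm_smul]
    calc ‖(z - z₁) ^ (j : ℕ)‖ * _ ≤
        ‖(z - z₁) ^ (j : ℕ)‖ * ((C j * ‖(z - z₁) ^ (n - (j : ℕ))‖) * K j) := by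
          gcongr
          refine (ContinuousLinearMap.le_opNorm _ _).trans (mul_le_mul ?_ (hK j y hy)
            (norm_nonneg _) ((hCz j).trans' (norm_nonneg (A z - _))))
          exact (BoundedContinuousFunction.norm_coe_le_norm _ y).trans (hCz j)
      _ = C j * K j * (‖(z - z₁) ^ (j : ℕ)‖ * ‖(z - z₁) ^ (n - (j : ℕ))‖) := by ring
      _ = _ := by
          rw [← norm_mul, ← pow_add, ← e2]
  have hg := norm_le_of_linear_ode (a := fun y => (A z y).restrictScalars ℝ) (M := M')
    (f := fun y => A z y (jetPoly z₁ (fun m => U m y) z) -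
      jetPoly z₁ (conv (fun i => a i y) fun j => U j y) z)
    (u := fun y => u z y - jetPoly z₁ (fun m => U m y) z)
    (fun y => (norm_restrictScalars_apply_le (A z) y).trans
      (by linarith [le_abs_self M]))
    (fun y _ => (hder y).congr_deriv (by
      rw [ContinuousLinearMap.coe_restrictScalars', map_sub]; abel)) hC₀z hforce hx
  rw [gronwallBound_of_K_ne_0 hM'pos.ne', sub_zero] at hg
  refine hg.trans_eq ?_
  ring

/-- Cauchy's estimate for the coefficients of a jet. -/
theorem norm_jet_le {F : Type*} [NormedAddCommGroup F] [NormedSpace ℂ F] [CompleteSpace F]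
    {g : ℂ → F} {z₀ : ℂ} {r C : ℝ} (hr : 0 < r)
    (hg : DifferentiableOn ℂ g (Metric.closedBall z₀ r))
    (hC : ∀ z ∈ Metric.closedBall z₀ r, ‖g z‖ ≤ C) {b : Fin n → F}
    (hb : (fun z => g z - jetPoly z₀ b z) =O[𝓝 z₀] fun z => (z - z₀) ^ n) (m : Fin n) :
    ‖b m‖ ≤ C * r⁻¹ ^ (m : ℕ) := by
  have hC0 : 0 ≤ C := (norm_nonneg _).trans (hC z₀ (Metric.mem_closedBall_self hr.le))
  lift r to NNReal using hr.le
  have hp := hg.hasFPowerSeriesOnBall (by exact_mod_cast hr)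
  have ht := isTaylor_of_hasFPowerSeriesAt hp.hasFPowerSeriesAt
  set p := cauchyPowerSeries g z₀ r
  have he : b = fun m : Fin n => p.coeff m := by
    rw [← sub_eq_zero]
    refine (jetPoly_isBigO_iff (z₀ := z₀)).1 (((ht n).sub hb).congr_left fun z => ?_)
    rw [jetPoly_sub, Finset.sum_range]
    simp only [jetPoly]
    abel
  have h1 : ‖b m‖ = ‖p m‖ := by
    rw [he]
    exact (FormalMultilinearSeries.norm_apply_eq_norm_coef).symm
  rw [h1]
  refine (norm_cauchyPowerSeries_le g z₀ r m).trans ?_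
  have h2 : ∫ θ in (0 : ℝ)..2 * Real.pi, ‖g (circleMap z₀ r θ)‖ ≤ 2 * Real.pi * C := by
    have := intervalIntegral.norm_integral_le_of_norm_le_const (a := 0) (b := 2 * Real.pi)
      (f := fun θ => ‖g (circleMap z₀ r θ)‖) (C := C) fun θ _ => by
        rw [norm_norm]
        exact hC _ (circleMap_mem_closedBall _ r.2 θ)
    refine (Real.le_norm_self _).trans (this.trans_eq ?_)
    rw [sub_zero, abs_of_pos Real.two_pi_pos]
    ring
  rw [abs_of_nonneg (NNReal.coe_nonneg r)]
  refine mul_le_mul_of_nonneg_right ?_ (by positivity)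
  rw [inv_mul_le_iff₀ Real.two_pi_pos]
  exact h2

/-- An expansion to order two is more than differentiability. Applied to the jets of solutions, this
gives the holomorphic dependence of solutions on the parameter. -/
theorem differentiableAt_of_jet {F : Type*} [NormedAddCommGroup F] [NormedSpace ℂ F]
    {g : ℂ → F} {z₁ : ℂ} {b : Fin 2 → F}
    (hb : (fun z => g z - jetPoly z₁ b z) =O[𝓝 z₁] fun z => (z - z₁) ^ 2) :
    DifferentiableAt ℂ g z₁ := by
  have h0 : g z₁ = b 0 := by
    obtain ⟨C, hC⟩ := hb.bound
    have := hC.self_of_nhds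
    simp only [sub_self, ne_eq, OfNat.ofNat_ne_zero, not_false_eq_true, zero_pow, norm_zero,
      mul_zero, norm_le_zero_iff, jetPoly_succ, zero_smul, add_zero] at this
    exact sub_eq_zero.1 this
  have h1 : HasDerivAt g (b 1) z₁ := by
    rw [hasDerivAt_iff_isLittleO]
    have h2 : (fun z : ℂ => (z - z₁) ^ 2) =o[𝓝 z₁] fun z => z - z₁ := by
      simpa [← norm_pow] using isLittleO_pow_sub_sub z₁ (m := 2) (by norm_num)
    refine (hb.trans_isLittleO h2).congr_left fun z => ?_
    rw [h0]
    simp [jetPoly]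
    abel
  exact h1.differentiableAt

theorem l2AtTop_of_norm_le_exp {u : ℝ → CN N} (hu : Continuous u) {C δ : ℝ} (hδ : 0 < δ)
    (h : ∀ x, 0 ≤ x → ‖u x‖ ≤ C * Real.exp (-δ * x)) : L2AtTop u := by
  rw [L2AtTop, memLp_two_iff_integrable_sq_norm hu.aestronglyMeasurable]
  have h1 : IntegrableOn (fun x => C ^ 2 * Real.exp (-(2 * δ) * x)) (Set.Ioi 0) :=
    (exp_neg_integrableOn_Ioi 0 (by positivity)).const_mul _
  refine Integrable.mono' h1 (hu.norm.pow 2).aestronglyMeasurable ?_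
  filter_upwards [ae_restrict_mem measurableSet_Ioi] with x hx
  rw [Real.norm_of_nonneg (by positivity)]
  calc ‖u x‖ ^ 2 ≤ (C * Real.exp (-δ * x)) ^ 2 := by
        gcongr
        exact h x (le_of_lt hx)
    _ = _ := by rw [mul_pow, ← Real.exp_nat_mul]; congr 2; push_cast; ring

/-- The ranges of the analytic family `M` are the spaces of initial values of square integrable
solutions of `u' = A(x; z) u` on `(0, ∞)` for `z` near `z₀`, and one Lyapunov form works for all
these `z`. -/
structure IsDecayBundle (A : ℂ → ℝ →ᵇ Mat N) (M : ℂ → Mat N) (z₀ : ℂ) : Prop where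
  analyticAt_coeff : ∀ᶠ z in 𝓝 z₀, AnalyticAt ℂ A z
  analyticAt_bundle : ∀ᶠ z in 𝓝 z₀, AnalyticAt ℂ M z
  range_eq : ∀ᶠ z in 𝓝 z₀, LinearMap.range (M z : CN N →ₗ[ℂ] CN N) = decaySpace (A z)
  lyapunov : ∃ (H : Mat N) (x₀ : ℝ), 0 ≤ x₀ ∧ ∀ᶠ z in 𝓝 z₀, IsLyapunovFrom (A z) H x₀

namespace IsDecayBundle

variable {A : ℂ → ℝ →ᵇ Mat N} {M : ℂ → Mat N} {z₀ : ℂ} {a : ℕ → ℝ →ᵇ Mat N}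

/-- Jets of decaying solutions decay: the solutions decay exponentially, uniformly in `z`, and
Cauchy's estimate passes the decay on to the Taylor coefficients. -/
theorem l2AtTop_jet (D : IsDecayBundle A M z₀) (ha : IsTaylor A z₀ a) {w : ℂ → CN N}
    (hw : ∀ᶠ z in 𝓝 z₀, AnalyticAt ℂ w z) (hwE : ∀ᶠ z in 𝓝 z₀, w z ∈ decaySpace (A z))
    {U : Fin n → ℝ → CN N} (hU : IsJetSolution a U)
    (h0 : (fun z => w z - jetPoly z₀ (fun m => U m 0) z) =O[𝓝 z₀] fun z => (z - z₀) ^ n)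
    (m : Fin n) : L2AtTop (U m) := by
  obtain ⟨H, x₀, hx₀, hLy⟩ := D.lyapunov
  have hAb : ∀ᶠ z in 𝓝 z₀, ‖A z‖ ≤ ‖A z₀‖ + 1 :=
    eventually_norm_le_add_one D.analyticAt_coeff.self_of_nhds
  have hwb : ∀ᶠ z in 𝓝 z₀, ‖w z‖ ≤ ‖w z₀‖ + 1 :=
    eventually_norm_le_add_one hw.self_of_nhds
  obtain ⟨R, hR, hball⟩ := Metric.eventually_nhds_iff_ball.1
    (D.analyticAt_coeff.and (hLy.and (hAb.and (hwb.and (hw.and hwE)))))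
  obtain ⟨C, δ, hC, hδ, hdecay⟩ := exists_uniform_decay H hx₀ (‖A z₀‖ + 1)
  have hr : 0 < R / 2 := by positivity
  have hsub : Metric.closedBall z₀ (R / 2) ⊆ Metric.ball z₀ R :=
    Metric.closedBall_subset_ball (by linarith)
  refine l2AtTop_of_norm_le_exp (hU.continuous m) hδ
    (C := C * (‖w z₀‖ + 1) * (R / 2)⁻¹ ^ (m : ℕ)) fun x hx => ?_
  have hb := hU.isBigO ha (u := fun z => solution (A z) (w z))
    (fun z => isSolution_solution _ _) (by simpa only [solution_zero] using h0) hx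
  refine (norm_jet_le hr (g := fun z => solution (A z) (w z) x) (C := C * (‖w z₀‖ + 1) * Real.exp (-δ * x))
    ?_ ?_ hb m).trans_eq (by ring)
  · intro z hz
    obtain ⟨hAz, -, -, -, hwz, -⟩ := hball z (hsub hz)
    obtain ⟨a₁, ha₁⟩ := exists_isTaylor hAz
    obtain ⟨b, hb⟩ := exists_isTaylor hwz
    obtain ⟨V, hV, hV0⟩ := exists_jetSolution (n := 2) a₁ fun m => b m
    refine (differentiableAt_of_jet (hV.isBigO ha₁ (u := fun z => solution (A z) (w z))
      (fun z => isSolution_solution _ _) ?_ hx)).differentiableWithinAt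
    simp only [solution_zero, hV0]
    refine (hb 2).congr_left fun y => ?_
    rw [Finset.sum_range]
    rfl
  · intro z hz
    obtain ⟨-, hLyz, hAz, hwz, -, hEz⟩ := hball z (hsub hz)
    refine (hdecay (A z) hAz hLyz _ (isSolution_solution _ _) hEz x hx).trans ?_
    rw [solution_zero]
    calc C * Real.exp (-δ * x) * ‖w z‖ ≤ C * Real.exp (-δ * x) * (‖w z₀‖ + 1) := by gcongr
      _ = _ := by ring

theorem l2AtTop_of_conv (D : IsDecayBundle A M z₀) (ha : IsTaylor A z₀ a) {μ : ℕ → Mat N}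
    (hμ : IsTaylor M z₀ μ) {U : Fin n → ℝ → CN N} (hU : IsJetSolution a U) {c : Fin n → CN N}
    (hc : (fun m => U m 0) = conv μ c) (m : Fin n) : L2AtTop (U m) := by
  refine D.l2AtTop_jet ha (w := fun z => M z (jetPoly z₀ c z)) ?_ ?_ hU ?_ m
  · filter_upwards [D.analyticAt_bundle] with z hz
    refine analyticAt_clm_apply hz ?_
    unfold jetPoly
    fun_prop
  · filter_upwards [D.range_eq] with z hz
    rw [← hz]
    exact ⟨_, rfl⟩
  · rw [hc]
    exact hμ.apply_jetPoly c

/-- The initial jets of square integrable jet solutions are the jets of sections of the bundle. -/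
theorem l2AtTop_jet_iff (D : IsDecayBundle A M z₀) (ha : IsTaylor A z₀ a) {μ : ℕ → Mat N}
    (hμ : IsTaylor M z₀ μ) {U : Fin n → ℝ → CN N} (hU : IsJetSolution a U) :
    (∀ m, L2AtTop (U m)) ↔ ∃ c, (fun m => U m 0) = conv μ c := by
  refine ⟨fun hL => ?_, fun ⟨c, hc⟩ m => D.l2AtTop_of_conv ha hμ hU hc m⟩
  -- the lowest nonvanishing coefficient is a solution, and is removed by subtracting the jet of a
  -- section of the bundle
  suffices h : ∀ k l : ℕ, l + k = n → ∀ U : Fin n → ℝ → CN N, IsJetSolution a U →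
      (∀ m, L2AtTop (U m)) → (∀ j : Fin n, (j : ℕ) < l → U j = 0) →
      ∃ c, (fun m => U m 0) = conv μ c from
    h n 0 (zero_add n) U hU hL fun j hj => absurd hj (Nat.not_lt_zero _)
  intro k
  induction k with
  | zero =>
    intro l hl U _ _ hlow
    refine ⟨0, funext fun m => ?_⟩
    rw [hlow m (by omega)]
    simp [conv]
  | succ k ih =>
    intro l hl U hU hL hlow
    let l' : Fin n := ⟨l, by omega⟩
    have hs : IsSolution (A z₀) (U l') := by
      rw [← ha.coeff_zero]
      exact hU.isSolution fun j hj => hlow j hj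
    have hmem : U l' 0 ∈ LinearMap.range (M z₀ : CN N →ₗ[ℂ] CN N) := by
      rw [D.range_eq.self_of_nhds, mem_decaySpace, ← hs.eq_solution]
      exact hL l'
    obtain ⟨γ, hγ⟩ := hmem
    obtain ⟨W, hW, hW0⟩ := exists_jetSolution a (conv μ (Pi.single l' γ))
    have hWL := D.l2AtTop_of_conv ha hμ hW (funext hW0)
    have hUW := hU.sub hW
    have hzero : ∀ j : Fin n, (j : ℕ) < l + 1 → (U - W) j = 0 := by
      intro j hj
      refine hUW.eq_zero fun i hi => ?_
      rw [Pi.sub_apply, Pi.sub_apply, hW0, sub_eq_zero]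
      have hil : (i : ℕ) ≤ l := (Fin.le_def.1 hi).trans (by omega)
      unfold conv
      rcases eq_or_lt_of_le hil with h | h
      · have : i = l' := Fin.ext h
        subst this
        rw [Finset.sum_eq_single l']
        · rw [Pi.single_eq_same, Nat.sub_self, hμ.coeff_zero]
          exact hγ.symm
        · intro b _ hb
          rw [Pi.single_eq_of_ne hb, map_zero]
        · intro h
          exact absurd (Finset.mem_Iic.2 le_rfl) h
      · rw [hlow i h, Finset.sum_eq_zero]
        · rfl
        · intro b hb
          have : b ≠ l' := fun hb' => by
            have h1 := Fin.le_def.1 (Finset.mem_Iic.1 hb)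
            rw [hb'] at h1
            exact absurd h1 (not_le.2 h)
          rw [Pi.single_eq_of_ne this, map_zero]
    obtain ⟨c, hc⟩ := ih (l + 1) (by omega) (U - W) hUW (fun m => (hL m).sub (hWL m)) hzero
    refine ⟨c + Pi.single l' γ, ?_⟩
    rw [conv_add, ← hc]
    funext m
    rw [Pi.add_apply, ← hW0 m]
    simp

end IsDecayBundle

end JetSolutions

/-! ### Weak derivatives on the line -/

section Weak

theorem intervalIntegrable_of_locallyIntegrable {E : Type*} [NormedAddCommGroup E] {g : ℝ → E}
    (hg : LocallyIntegrable g) {a b : ℝ} : IntervalIntegrable g volume a b :=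
  intervalIntegrable_iff.2
    ((hg.integrableOn_isCompact isCompact_uIcc).mono_set Set.uIoc_subset_uIcc)

variable {E : Type*} [NormedAddCommGroup E] [NormedSpace ℝ E]

theorem exists_support_subset_Ioc {φ : ℝ → ℝ} (hs : HasCompactSupport φ) :
    ∃ R : ℝ, 0 < R ∧ tsupport φ ⊆ Set.Ioo (-R) R := by
  obtain ⟨R, hR⟩ := hs.isBounded.subset_ball 0
  refine ⟨max R 1, by positivity, hR.trans ?_⟩
  rw [Real.ball_eq_Ioo]
  exact Set.Ioo_subset_Ioo (by simp) (by simp)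

theorem integral_deriv_mul_primitive {g : ℝ → ℝ} (hg : LocallyIntegrable g) {φ : ℝ → ℝ}
    (hφ : ContDiff ℝ ∞ φ) (hs : HasCompactSupport φ) :
    ∫ x, deriv φ x * ∫ t in (0 : ℝ)..x, g t = -∫ x, φ x * g x := by
  obtain ⟨R, hR, hsR⟩ := exists_support_subset_Ioc hs
  have hsub : tsupport φ ⊆ Set.Ioc (-R) R := hsR.trans Set.Ioo_subset_Ioc_self
  have h0 : ∀ x, x ∉ Set.Ioo (-R) R → φ x = 0 := fun x hx =>
    image_eq_zero_of_notMem_tsupport fun h => hx (hsR h)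
  rw [← intervalIntegral.integral_eq_integral_of_support_subset (a := -R) (b := R),
    ← intervalIntegral.integral_eq_integral_of_support_subset (a := -R) (b := R)]
  · have hi : IntervalIntegrable g volume (-R) R := intervalIntegrable_of_locallyIntegrable hg
    have h1 := AbsolutelyContinuousOnInterval.integral_mul_deriv_eq_deriv_mul
      (hi.absolutelyContinuousOnInterval_intervalIntegral (c := 0)
        (by rw [Set.uIcc_of_le (by linarith)]; constructor <;> linarith))
      ((hφ.of_le (by simp)).contDiffOn (s := Set.uIcc (-R) R)).absolutelyContinuousOnInterval
    rw [h0 R (by simp), h0 (-R) (by simp)] at h1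
    simp only [mul_comm (deriv φ _)]
    rw [h1, mul_zero, mul_zero, sub_zero, zero_sub]
    congr 1
    apply intervalIntegral.integral_congr_ae
    filter_upwards [LocallyIntegrable.ae_hasDerivAt_integral hg] with x hx _
    rw [(hx 0).deriv, mul_comm]
  · exact (Function.support_mul_subset_left _ _).trans ((subset_tsupport _).trans hsub)
  · exact (Function.support_mul_subset_left _ _).trans
      ((subset_tsupport _).trans ((tsupport_deriv_subset (f := φ)).trans hsub))

/-- The primitive of a locally integrable function has that function as its weak derivative. -/
theorem integral_deriv_smul_primitive [CompleteSpace E] {g : ℝ → E} (hg : LocallyIntegrable g)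
    {φ : ℝ → ℝ} (hφ : ContDiff ℝ ∞ φ) (hs : HasCompactSupport φ) :
    ∫ x, deriv φ x • ∫ t in (0 : ℝ)..x, g t = -∫ x, φ x • g x := by
  have hii : ∀ x, IntervalIntegrable g volume 0 x := fun x => intervalIntegrable_of_locallyIntegrable hg
  have hcont : Continuous fun x => ∫ t in (0 : ℝ)..x, g t :=
    intervalIntegral.continuous_primitive (fun a b => intervalIntegrable_of_locallyIntegrable hg) 0
  have hd : Continuous (deriv φ) := hφ.continuous_deriv (by simp)
  have i1 : Integrable fun x => deriv φ x • ∫ t in (0 : ℝ)..x, g t :=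
    (hd.smul hcont).integrable_of_hasCompactSupport hs.deriv.smul_right
  have i2 : Integrable fun x => φ x • g x :=
    hg.integrable_smul_left_of_hasCompactSupport hφ.continuous hs
  refine (SeparatingDual.eq_iff_forall_dual_eq (R := ℝ)).2 fun l => ?_
  have hlg : LocallyIntegrable fun x => l (g x) := fun x => by
    obtain ⟨s, hs, h⟩ := hg x
    exact ⟨s, hs, l.integrable_comp h⟩
  rw [map_neg, ← l.integral_comp_comm i1, ← l.integral_comp_comm i2]
  simp only [map_smul, smul_eq_mul]
  rw [← integral_deriv_mul_primitive hlg hφ hs]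
  congr 1
  ext x
  rw [← l.intervalIntegral_comp_comm (hii x)]

theorem exists_test_primitive {θ : ℝ → ℝ} (hθ : ContDiff ℝ ∞ θ) (hs : HasCompactSupport θ)
    (h0 : ∫ x, θ x = 0) :
    ∃ Φ : ℝ → ℝ, ContDiff ℝ ∞ Φ ∧ HasCompactSupport Φ ∧ deriv Φ = θ := by
  obtain ⟨R, hR, hsR⟩ := exists_support_subset_Ioc hs
  have hd : ∀ x, HasDerivAt (fun x => ∫ t in (-R)..x, θ t) (θ x) x := fun x =>
    intervalIntegral.integral_hasDerivAt_right (hθ.continuous.intervalIntegrable _ _)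
      hθ.continuous.stronglyMeasurable.stronglyMeasurableAtFilter hθ.continuous.continuousAt
  have hderiv : deriv (fun x => ∫ t in (-R)..x, θ t) = θ := funext fun x => (hd x).deriv
  have hz : ∀ x, x ∉ Set.Ioo (-R) R → θ x = 0 := fun x hx =>
    image_eq_zero_of_notMem_tsupport fun h => hx (hsR h)
  refine ⟨fun x => ∫ t in (-R)..x, θ t, ?_, ?_, hderiv⟩
  · rw [contDiff_infty_iff_deriv, hderiv]
    exact ⟨fun x => (hd x).differentiableAt, hθ⟩
  · refine HasCompactSupport.intro (K := Set.Icc (-R) R) isCompact_Icc fun x hx => ?_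
    rw [Set.mem_Icc, not_and_or, not_le, not_le] at hx
    rcases hx with hx | hx
    · refine intervalIntegral.integral_zero_ae (ae_of_all _ fun t ht => hz t fun h => ?_)
      rw [Set.uIoc_of_ge hx.le] at ht
      exact absurd h.1 (not_lt.2 ht.2)
    · rw [intervalIntegral.integral_eq_integral_of_support_subset, h0]
      exact (subset_tsupport _).trans
        (hsR.trans fun t ht => ⟨ht.1, ht.2.le.trans hx.le⟩)

/-- The lemma of du Bois-Reymond: a function with vanishing weak derivative is constant. -/
theorem exists_ae_eq_const [CompleteSpace E] {h : ℝ → E} (hh : LocallyIntegrable h)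
    (h0 : ∀ φ : ℝ → ℝ, ContDiff ℝ ∞ φ → HasCompactSupport φ → ∫ x, deriv φ x • h x = 0) :
    ∃ c, h =ᵐ[volume] fun _ => c := by
  let χ : ContDiffBump (0 : ℝ) := ⟨1, 2, one_pos, one_lt_two⟩
  set η : ℝ → ℝ := χ.normed volume with hη
  have hηd : ContDiff ℝ ∞ η := χ.contDiff_normed
  have hηs : HasCompactSupport η := χ.hasCompactSupport_normed
  have hηi : ∫ x, η x = 1 := χ.integral_normed
  -- a test function `ψ` differs from `(∫ ψ) η` by the derivative of a test function
  refine ⟨∫ x, η x • h x, ae_eq_of_integral_contDiff_smul_eq hh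
    (locallyIntegrable_const _) fun ψ hψ hψs => ?_⟩
  have ip : Integrable ψ := hψ.continuous.integrable_of_hasCompactSupport hψs
  have ie : Integrable η := hηd.continuous.integrable_of_hasCompactSupport hηs
  obtain ⟨Φ, hΦ, hΦs, hΦd⟩ := exists_test_primitive (θ := fun x => ψ x - (∫ t, ψ t) * η x)
    (hψ.sub (contDiff_const.mul hηd)) (hψs.sub (hηs.mul_left))
    (by rw [integral_sub ip (ie.const_mul _), integral_const_mul, hηi, mul_one, sub_self])
  have h1 := h0 Φ hΦ hΦs
  rw [hΦd] at h1
  simp only [sub_smul, mul_smul] at h1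
  have i1 : Integrable fun x => (∫ t, ψ t) • η x • h x :=
    (hh.integrable_smul_left_of_hasCompactSupport hηd.continuous hηs).smul _
  rw [integral_sub (hh.integrable_smul_left_of_hasCompactSupport hψ.continuous hψs) i1,
    integral_smul, sub_eq_zero] at h1
  rw [h1, integral_smul_const]

end Weak

variable {N : ℕ}

/-- A classical derivative in `L²` is a weak derivative. -/
theorem isWeakDeriv_of_hasDerivAt {f f' : ℝ → CN N} {u g : L2 N}
    (hf : ∀ x, HasDerivAt f (f' x) x) (hu : u =ᵐ[volume] f) (hg : g =ᵐ[volume] f') :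
    IsWeakDeriv u g := by
  intro φ hφ hs
  have hd : Continuous (deriv φ) := hφ.continuous_deriv (by simp)
  have e : ∀ {ψ : ℝ → ℝ} {v : L2 N} {k : ℝ → CN N}, v =ᵐ[volume] k →
      (fun x => ψ x • v x) =ᵐ[volume] fun x => ψ x • k x := fun h => by
    filter_upwards [h] with x hx
    rw [hx]
  have i1 := (integrable_test_smul hφ.continuous hs g).congr (e hg)
  have i2 := (integrable_test_smul hd hs.deriv u).congr (e hu)
  have i3 := (integrable_test_smul hφ.continuous hs u).congr (e hu)
  rw [integral_congr_ae (e hu), integral_congr_ae (e hg)]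
  have := integral_bilinear_hasDerivAt_right_eq_neg_left_of_integrable
    (L := ContinuousLinearMap.lsmul ℝ ℝ (E := CN N)) (u := φ) (u' := deriv φ) (v := f) (v' := f')
    (fun x _ => (hφ.differentiable (by simp) x).hasDerivAt) (fun x _ => hf x) i1 i2 i3
  simp only [ContinuousLinearMap.lsmul_apply] at this
  rw [this, neg_neg]

/-- Functions in `H¹` are primitives of their weak derivatives. -/
theorem IsWeakDeriv.exists_ae_eq_primitive {u g : L2 N} (h : IsWeakDeriv u g) :
    ∃ c, u =ᵐ[volume] fun x => c + ∫ t in (0 : ℝ)..x, g t := by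
  have hu : LocallyIntegrable u := (Lp.memLp u).locallyIntegrable (by norm_num)
  have hg : LocallyIntegrable g := (Lp.memLp g).locallyIntegrable (by norm_num)
  have hcont : Continuous fun x => ∫ t in (0 : ℝ)..x, g t :=
    intervalIntegral.continuous_primitive (fun a b => intervalIntegrable_of_locallyIntegrable hg) 0
  obtain ⟨c, hc⟩ := exists_ae_eq_const (hu.sub hcont.locallyIntegrable) fun φ hφ hs => by
    have hd : Continuous (deriv φ) := hφ.continuous_deriv (by simp)
    simp only [Pi.sub_apply, smul_sub]
    have i1 : Integrable fun x => deriv φ x • ∫ t in (0 : ℝ)..x, g t :=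
      (hd.smul hcont).integrable_of_hasCompactSupport hs.deriv.smul_right
    rw [integral_sub (integrable_test_smul hd hs.deriv u) i1, h φ hφ hs,
      integral_deriv_smul_primitive hg hφ hs, sub_self]
  refine ⟨c, ?_⟩
  filter_upwards [hc] with x hx
  rw [Pi.sub_apply] at hx
  rw [← hx, sub_add_cancel]

/-! ### Fredholm operators `d/dx - a` have hyperbolic asymptotics -/

/-- A differentiable function which lies in `L²` together with its derivative defines an element
of `H¹`, and its weak derivative is the classical one. -/
theorem exists_H1_of_hasDerivAt {f f' : ℝ → CN N} (hf : ∀ x, HasDerivAt f (f' x) x)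
    (h : MemLp f 2) (h' : MemLp f' 2) :
    ∃ u : H1 N, (u : L2 N) =ᵐ[volume] f ∧ weakDeriv N u =ᵐ[volume] f' := by
  have hw : IsWeakDeriv (h.toLp f) (h'.toLp f') :=
    isWeakDeriv_of_hasDerivAt hf h.coeFn_toLp h'.coeFn_toLp
  refine ⟨⟨h.toLp f, _, hw⟩, h.coeFn_toLp, ?_⟩
  rw [(isWeakDeriv_weakDeriv ⟨h.toLp f, _, hw⟩).unique hw]
  exact h'.coeFn_toLp

/-- The operator `d/dx - a` on `L²` with domain `H¹`. -/
def diffOp (a : ℝ →ᵇ Mat N) : H1 N →ₗ[ℂ] L2 N :=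
  weakDeriv N - mulOp a ∘ₗ (H1 N).subtype

theorem mulOp_coeFn (a : ℝ →ᵇ Mat N) (u : L2 N) : mulOp a u =ᵐ[volume] fun x => a x (u x) :=
  (memLp_mul a u).coeFn_toLp

theorem norm_mulOp_le (a : ℝ →ᵇ Mat N) (u : L2 N) : ‖mulOp a u‖ ≤ ‖a‖ * ‖u‖ := by
  refine Lp.norm_le_mul_norm_of_ae_le_mul ?_
  filter_upwards [mulOp_coeFn a u] with x hx
  rw [hx]
  exact ((a x).le_opNorm _).trans
    (mul_le_mul_of_nonneg_right (a.norm_coe_le_norm x) (norm_nonneg _))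

/-- The defining identity of the weak derivative, tested against vectors `e` and written as
orthogonality relations in `L²`. In this form it is visibly a closed condition. -/
theorem isWeakDeriv_iff_inner {u g : L2 N} : IsWeakDeriv u g ↔
    ∀ (φ : ℝ → ℝ) (_ : ContDiff ℝ ∞ φ) (_ : HasCompactSupport φ) (e : CN N)
      (p p' : L2 N) (_ : p =ᵐ[volume] fun x => φ x • e)
      (_ : p' =ᵐ[volume] fun x => deriv φ x • e),
      inner ℂ p' u + inner ℂ p g = 0 := by
  have key : ∀ {ψ : ℝ → ℝ} (_ : Continuous ψ) (_ : HasCompactSupport ψ) (e : CN N) {p : L2 N}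
      (_ : p =ᵐ[volume] fun x => ψ x • e) (v : L2 N),
      inner ℂ p v = inner ℂ e (∫ x, ψ x • v x) := by
    intro ψ hψ hs e p hp v
    rw [← integral_inner (integrable_test_smul hψ hs v), L2.inner_def]
    refine integral_congr_ae ?_
    filter_upwards [hp] with x hx
    rw [hx, ← Complex.coe_smul, ← Complex.coe_smul, inner_smul_left, inner_smul_right,
      Complex.conj_ofReal]
  constructor
  · intro h φ hφ hs e p p' hp hp'
    rw [key hφ.continuous hs e hp, key (hφ.continuous_deriv (by simp)) hs.deriv e hp',
      h φ hφ hs, inner_neg_right, neg_add_cancel]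
  · intro h φ hφ hs
    have hd : Continuous (deriv φ) := hφ.continuous_deriv (by simp)
    have mem : ∀ {ψ : ℝ → ℝ} (_ : Continuous ψ) (_ : HasCompactSupport ψ) (e : CN N),
        MemLp (fun x => ψ x • e) 2 := fun hψ hs e =>
      (hψ.smul continuous_const).memLp_of_hasCompactSupport hs.smul_right
    refine ext_inner_left ℂ fun e => ?_
    have h1 := h φ hφ hs e _ _ (mem hφ.continuous hs e).coeFn_toLp
      (mem hd hs.deriv e).coeFn_toLp
    rw [key hφ.continuous hs e (mem hφ.continuous hs e).coeFn_toLp,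
      key hd hs.deriv e (mem hd hs.deriv e).coeFn_toLp] at h1
    rw [inner_neg_right]
    exact eq_neg_of_add_eq_zero_left h1

theorem isClosed_isWeakDeriv : IsClosed {q : L2 N × L2 N | IsWeakDeriv q.1 q.2} := by
  simp only [isWeakDeriv_iff_inner, Set.ofPred_forall]
  refine isClosed_iInter fun φ => isClosed_iInter fun _ => isClosed_iInter fun _ =>
    isClosed_iInter fun e => isClosed_iInter fun p => isClosed_iInter fun p' =>
    isClosed_iInter fun _ => isClosed_iInter fun _ => ?_
  exact isClosed_eq (by fun_prop) continuous_const

theorem isWeakDeriv_diffOp (a : ℝ →ᵇ Mat N) (u : H1 N) :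
    IsWeakDeriv (u : L2 N) (diffOp a u + mulOp a u) := by
  have : diffOp a u + mulOp a u = weakDeriv N u := by simp [diffOp]
  rw [this]
  exact isWeakDeriv_weakDeriv u

theorem exists_of_isWeakDeriv (a : ℝ →ᵇ Mat N) {u f : L2 N}
    (h : IsWeakDeriv u (f + mulOp a u)) : ∃ v : H1 N, (v : L2 N) = u ∧ diffOp a v = f := by
  refine ⟨⟨u, _, h⟩, rfl, ?_⟩
  have := (isWeakDeriv_weakDeriv ⟨u, _, h⟩).unique h
  simp [diffOp, this]

theorem continuous_mulOp (a : ℝ →ᵇ Mat N) : Continuous (mulOp a) :=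
  (LinearMap.mkContinuous (mulOp a) ‖a‖ (norm_mulOp_le a)).continuous

/-- The graph of `d/dx - a`. -/
def diffGraph (a : ℝ →ᵇ Mat N) : Submodule ℂ (L2 N × L2 N) :=
  LinearMap.range ((H1 N).subtype.prod (diffOp a))

theorem isClosed_diffGraph (a : ℝ →ᵇ Mat N) : IsClosed (diffGraph a : Set (L2 N × L2 N)) := by
  have : (diffGraph a : Set (L2 N × L2 N)) =
      (fun q : L2 N × L2 N => (q.1, q.2 + mulOp a q.1)) ⁻¹' {q | IsWeakDeriv q.1 q.2} := by
    ext q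
    constructor
    · rintro ⟨u, rfl⟩
      exact isWeakDeriv_diffOp a u
    · intro h
      obtain ⟨v, h1, h2⟩ := exists_of_isWeakDeriv a h
      exact ⟨v, Prod.ext h1 h2⟩
  rw [this]
  have := continuous_mulOp a
  exact isClosed_isWeakDeriv.preimage (by fun_prop)

/-- By the open mapping theorem, `d/dx - a` is bounded below modulo its kernel if its range is
closed. -/
theorem exists_bound_modulo_ker (a : ℝ →ᵇ Mat N)
    (h : IsClosed (LinearMap.range (diffOp a) : Set (L2 N))) :
    ∃ C > 0, ∀ u : H1 N, ∃ k ∈ LinearMap.ker (diffOp a),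
      ‖(u : L2 N) - k‖ ≤ C * ‖diffOp a u‖ := by
  have c1 : CompleteSpace (diffGraph a) := (isClosed_diffGraph a).completeSpace_coe
  have c2 : CompleteSpace (LinearMap.range (diffOp a)) := h.completeSpace_coe
  let S : diffGraph a →L[ℂ] LinearMap.range (diffOp a) :=
    ((ContinuousLinearMap.snd ℂ (L2 N) (L2 N)).comp (diffGraph a).subtypeL).codRestrict _ (by
      rintro ⟨_, u, rfl⟩
      exact ⟨u, rfl⟩)
  have hS : Function.Surjective S := by
    rintro ⟨_, u, rfl⟩
    exact ⟨⟨_, u, rfl⟩, rfl⟩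
  obtain ⟨C, hC, hb⟩ := ContinuousLinearMap.exists_preimage_norm_le S hS
  refine ⟨C, hC, fun u => ?_⟩
  obtain ⟨⟨_, v, rfl⟩, h1, h2⟩ := hb ⟨diffOp a u, u, rfl⟩
  have h3 : diffOp a v = diffOp a u := congrArg Subtype.val h1
  refine ⟨u - v, by simp [h3], ?_⟩
  have h4 : ‖(v : L2 N)‖ ≤ ‖((v : L2 N), diffOp a v)‖ := norm_fst_le ((v : L2 N), diffOp a v)
  simpa using h4.trans h2

/-- An operator `d/dx - a` with finite-dimensional kernel and closed range does not admit
arbitrarily large orthogonal systems of approximate null vectors. -/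
theorem exists_weyl_bound (a : ℝ →ᵇ Mat N) (hk : FiniteDimensional ℂ (LinearMap.ker (diffOp a)))
    (h : IsClosed (LinearMap.range (diffOp a) : Set (L2 N))) :
    ∃ m : ℕ, ∃ ε > 0, ∀ u : Fin m → H1 N, (∀ i, u i ≠ 0) →
      (Pairwise fun i j => inner ℂ (u i : L2 N) (u j) = 0) →
      ∃ i, ε * ‖(u i : L2 N)‖ < ‖diffOp a (u i)‖ := by
  obtain ⟨C, hC, hb⟩ := exists_bound_modulo_ker a h
  set K : Submodule ℂ (L2 N) := (LinearMap.ker (diffOp a)).map (H1 N).subtype with hK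
  set m := Module.finrank ℂ K + 1 with hm
  refine ⟨m, 1 / (2 * C * m), by positivity, fun u hu0 ho => ?_⟩
  by_contra! hcon
  -- `m` exceeds the dimension of the kernel, so some combination of the `u i` is orthogonal to it
  let S : (Fin m → ℂ) →ₗ[ℂ] H1 N := Fintype.linearCombination ℂ u
  obtain ⟨c, hc, hc0⟩ : ∃ c : Fin m → ℂ,
      (K.orthogonalProjectionOnto.toLinearMap ∘ₗ (H1 N).subtype ∘ₗ S) c = 0 ∧ c ≠ 0 := by
    have := LinearMap.ker_ne_bot_of_finrank_lt
      (f := K.orthogonalProjectionOnto.toLinearMap ∘ₗ (H1 N).subtype ∘ₗ S) (by simp [hm])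
    obtain ⟨c, hc, hc0⟩ := Submodule.exists_mem_ne_zero_of_ne_bot this
    exact ⟨c, hc, hc0⟩
  have hS : S c = ∑ i, c i • u i := by simp [S, Fintype.linearCombination_apply]
  have hSL : ((S c : H1 N) : L2 N) = ∑ i, c i • (u i : L2 N) := by simp [hS]
  have hperp : (S c : L2 N) ∈ Kᗮ :=
    (Submodule.orthogonalProjectionOnto_eq_zero_iff).1 hc
  have hle : ‖(S c : L2 N)‖ ≤ C * ‖diffOp a (S c)‖ := by
    obtain ⟨k, hk, hkb⟩ := hb (S c)
    have h0 : inner ℂ (k : L2 N) (S c : L2 N) = 0 :=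
      hperp _ (Submodule.mem_map_of_mem hk)
    have h1 : ‖(S c : L2 N) - k‖ * ‖(S c : L2 N) - k‖ =
        ‖(S c : L2 N)‖ * ‖(S c : L2 N)‖ + ‖(k : L2 N)‖ * ‖(k : L2 N)‖ := by
      rw [sub_eq_add_neg, norm_add_sq_eq_norm_sq_add_norm_sq_of_inner_eq_zero (𝕜 := ℂ) _ _
        (by rw [inner_neg_right, inner_eq_zero_symm.1 h0, neg_zero]), norm_neg]
    refine le_trans ?_ hkb
    nlinarith [norm_nonneg ((S c : L2 N) - k), norm_nonneg (S c : L2 N), norm_nonneg (k : L2 N)]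
  have hci : ∀ i, ‖c i‖ * ‖(u i : L2 N)‖ ≤ ‖(S c : L2 N)‖ := by
    intro i
    have h1 : inner ℂ (u i : L2 N) (S c : L2 N) = c i * (‖(u i : L2 N)‖ : ℂ) ^ 2 := by
      rw [hSL, inner_sum, Finset.sum_eq_single i, inner_smul_right, inner_self_eq_norm_sq_to_K]
      · rfl
      · intro j _ hj
        rw [inner_smul_right, ho hj.symm, mul_zero]
      · simp
    have h2 := norm_inner_le_norm (𝕜 := ℂ) (u i : L2 N) (S c : L2 N)
    rw [h1] at h2
    have h3 : 0 < ‖(u i : L2 N)‖ := norm_pos_iff.2 (by simpa using hu0 i)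
    have h4 : ‖c i * (‖(u i : L2 N)‖ : ℂ) ^ 2‖ = ‖c i‖ * ‖(u i : L2 N)‖ ^ 2 := by simp
    rw [h4] at h2
    nlinarith
  have hpos : 0 < ‖(S c : L2 N)‖ := by
    obtain ⟨i, hi⟩ := Function.ne_iff.1 hc0
    exact lt_of_lt_of_le (mul_pos (norm_pos_iff.2 hi)
      (norm_pos_iff.2 (by simpa using hu0 i))) (hci i)
  have hT : ‖diffOp a (S c)‖ ≤ 1 / (2 * C) * ‖(S c : L2 N)‖ := by
    rw [hS, map_sum]
    calc ‖∑ i, diffOp a (c i • u i)‖ ≤ ∑ i, ‖diffOp a (c i • u i)‖ := norm_sum_le _ _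
      _ ≤ ∑ _i : Fin m, 1 / (2 * C * m) * ‖(S c : L2 N)‖ := by
          refine Finset.sum_le_sum fun i _ => ?_
          rw [map_smul, norm_smul]
          calc ‖c i‖ * ‖diffOp a (u i)‖ ≤ ‖c i‖ * (1 / (2 * C * m) * ‖(u i : L2 N)‖) :=
                mul_le_mul_of_nonneg_left (hcon i) (norm_nonneg _)
            _ = 1 / (2 * C * m) * (‖c i‖ * ‖(u i : L2 N)‖) := by ring
            _ ≤ _ := mul_le_mul_of_nonneg_left (hci i) (by positivity)
      _ = 1 / (2 * C) * ‖(S c : L2 N)‖ := by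
          have : (m : ℝ) ≠ 0 := by simp [hm]; positivity
          rw [Finset.sum_const, Finset.card_univ, Fintype.card_fin, nsmul_eq_mul]
          field_simp
  have h5 : C * ‖diffOp a (S c)‖ ≤ 1 / 2 * ‖(S c : L2 N)‖ := by
    calc _ ≤ C * (1 / (2 * C) * ‖(S c : L2 N)‖) := mul_le_mul_of_nonneg_left hT hC.le
      _ = _ := by field_simp
  linarith

/-- An approximate eigenfunction: the eigenfunction `e^{νx} v` of the constant coefficient operator
`d/dx - B`, cut off to the interval `[s, s + L]`, on which `a` is close to `B`. -/
theorem exists_approximate_eigenfunction : ∃ M : ℝ, 0 ≤ M ∧ ∀ (a : ℝ →ᵇ Mat N) (B : Mat N) (ν : ℂ)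
    (v : CN N) (s L δ : ℝ), ν.re = 0 → B v = ν • v → v ≠ 0 → 0 < L → 0 ≤ δ →
    (∀ x ∈ Set.Icc s (s + L), ‖a x - B‖ ≤ δ) →
    ∃ u : H1 N, u ≠ 0 ∧ (∀ᵐ x, x ∉ Set.Ioo s (s + L) → (u : L2 N) x = 0) ∧
      ‖diffOp a u‖ ≤ 2 * (M / L + δ) * ‖(u : L2 N)‖ := by
  let χ : ContDiffBump (1 / 2 : ℝ) := ⟨1 / 4, 1 / 2, by norm_num, by norm_num⟩
  have hχd : Continuous (deriv χ) := (χ.contDiff (n := 1)).continuous_deriv le_rfl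
  obtain ⟨M, hM⟩ := hχd.bounded_above_of_compact_support χ.hasCompactSupport.deriv
  refine ⟨M, (norm_nonneg _).trans (hM 0), ?_⟩
  intro a B ν v s L δ hν hv hv0 hL hδ hab
  have hM0 : 0 ≤ M := (norm_nonneg _).trans (hM 0)
  have hexp : ∀ x : ℝ, ‖Complex.exp (ν * x)‖ = 1 := fun x => by
    rw [Complex.norm_exp]; simp [hν]
  -- the affine change of variables which maps `[s, s + L]` to `[0, 1]`
  have hout : ∀ x, x ∉ Set.Ioo s (s + L) → (x - s) / L ∉ Metric.ball (1 / 2 : ℝ) (1 / 2) := by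
    intro x hx h
    rw [Real.ball_eq_Ioo] at h
    norm_num at h
    rw [div_lt_one hL] at h
    exact hx ⟨by have := (div_pos_iff_of_pos_right hL).1 h.1; linarith, by linarith [h.2]⟩
  have hχ0 : ∀ x, x ∉ Set.Ioo s (s + L) → χ ((x - s) / L) = 0 := fun x hx =>
    Function.notMem_support.1 (by rw [χ.support_eq]; exact hout x hx)
  have hχ'0 : ∀ x, x ∉ Set.Icc s (s + L) → deriv χ ((x - s) / L) = 0 := by
    intro x hx
    refine Function.notMem_support.1 fun h => hx ?_
    have h1 := support_deriv_subset h
    rw [χ.tsupport_eq, Real.closedBall_eq_Icc] at h1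
    norm_num at h1
    rw [div_le_one hL] at h1
    rw [le_div_iff₀ hL, zero_mul] at h1
    exact ⟨by linarith [h1.1], by linarith [h1.2]⟩
  set f : ℝ → CN N := fun x => (χ ((x - s) / L) : ℂ) • Complex.exp (ν * x) • v with hf
  set f' : ℝ → CN N := fun x => (χ ((x - s) / L) : ℂ) • (Complex.exp (ν * x) * ν) • v +
    ((deriv χ ((x - s) / L) / L : ℝ) : ℂ) • Complex.exp (ν * x) • v with hf'
  have hderiv : ∀ x, HasDerivAt f (f' x) x := by
    intro x
    have h1 : HasDerivAt (fun x : ℝ => (χ ((x - s) / L) : ℂ))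
        ((deriv χ ((x - s) / L) / L : ℝ) : ℂ) x := by
      have h2 : HasDerivAt (fun x : ℝ => (x - s) / L) (1 / L) x :=
        ((hasDerivAt_id x).sub_const s).div_const L
      have h3 : HasDerivAt χ (deriv χ ((x - s) / L)) ((x - s) / L) :=
        ((χ.contDiff (n := 1)).differentiable (by simp) _).hasDerivAt
      have h4 := (h3.comp x h2).ofReal_comp
      rw [mul_one_div] at h4
      exact h4
    have h2 : HasDerivAt (fun x : ℝ => Complex.exp (ν * x)) (Complex.exp (ν * x) * ν) x := by
      have h3 : HasDerivAt (fun x : ℝ => ν * (x : ℂ)) ν x := by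
        simpa using (Complex.ofRealCLM.hasDerivAt (x := x)).const_mul ν
      exact h3.cexp
    exact h1.smul (h2.smul_const v)
  have hcs : ∀ g : ℝ → CN N, Continuous g → (∀ x, x ∉ Set.Icc s (s + L) → g x = 0) →
      MemLp g 2 := fun g hg h0 =>
    hg.memLp_of_hasCompactSupport (HasCompactSupport.intro isCompact_Icc fun x hx => h0 x hx)
  have hχc : Continuous fun x : ℝ => (χ ((x - s) / L) : ℂ) :=
    Complex.continuous_ofReal.comp (χ.continuous.comp (by fun_prop))
  have hχ'c : Continuous fun x : ℝ => ((deriv χ ((x - s) / L) / L : ℝ) : ℂ) :=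
    Complex.continuous_ofReal.comp ((hχd.comp (by fun_prop)).div_const L)
  have hIcc : ∀ x, x ∉ Set.Icc s (s + L) → x ∉ Set.Ioo s (s + L) := fun x hx h =>
    hx (Set.Ioo_subset_Icc_self h)
  obtain ⟨u, hu, hu'⟩ := exists_H1_of_hasDerivAt hderiv
    (hcs f (by fun_prop) fun x hx => by simp [hf, hχ0 x (hIcc x hx)])
    (hcs f' (by fun_prop) fun x hx => by simp [hf', hχ0 x (hIcc x hx), hχ'0 x hx])
  -- upper bound for the image
  have hup : ‖diffOp a u‖ ≤ (M / L + δ) * ‖v‖ * L ^ (1 / 2 : ℝ) := by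
    have h1 : ‖diffOp a u‖ ≤ ‖indicatorConstLp (μ := (volume : Measure ℝ)) 2
        (measurableSet_Icc (a := s) (b := s + L)) (by simp) ((M / L + δ) * ‖v‖)‖ := by
      refine Lp.norm_le_norm_of_ae_le ?_
      filter_upwards [hu, hu', mulOp_coeFn a u, Lp.coeFn_sub (weakDeriv N u) (mulOp a u),
        indicatorConstLp_coeFn (p := 2) (μ := (volume : Measure ℝ))
          (hs := measurableSet_Icc (a := s) (b := s + L)) (hμs := by simp)
          (c := (M / L + δ) * ‖v‖)] with x h1 h2 h3 h4 h5
      have h6 : (diffOp a u : L2 N) x = f' x - a x (f x) := by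
        change (weakDeriv N u - mulOp a u : L2 N) x = _
        rw [h4, Pi.sub_apply, h2, h3, h1]
      rw [h5, h6]
      by_cases hx : x ∈ Set.Icc s (s + L)
      · have h7 : f' x - a x (f x) = ((deriv χ ((x - s) / L) / L : ℝ) : ℂ) •
            Complex.exp (ν * x) • v -
            (χ ((x - s) / L) : ℂ) • Complex.exp (ν * x) • (a x - B) v := by
          simp only [hf, hf', map_smul, sub_apply, hv, smul_sub, smul_smul]
          abel
        rw [h7, Set.indicator_of_mem hx, Real.norm_of_nonneg (by positivity), add_mul]
        refine (norm_sub_le _ _).trans (add_le_add ?_ ?_)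
        · rw [norm_smul, norm_smul, hexp, one_mul, Complex.norm_real, norm_div,
            Real.norm_of_nonneg hL.le]
          gcongr
          exact hM _
        · rw [norm_smul, norm_smul, hexp, one_mul, Complex.norm_real,
            Real.norm_of_nonneg χ.nonneg]
          calc _ ≤ 1 * ‖(a x - B) v‖ :=
                mul_le_mul_of_nonneg_right χ.le_one (norm_nonneg _)
            _ ≤ δ * ‖v‖ := by
                rw [one_mul]
                exact ((a x - B).le_opNorm v).trans
                  (mul_le_mul_of_nonneg_right (hab x hx) (norm_nonneg _))
      · rw [Set.indicator_of_notMem hx]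
        simp [hf, hf', hχ0 x (hIcc x hx), hχ'0 x hx]
    refine h1.trans (le_of_eq ?_)
    rw [norm_indicatorConstLp (by norm_num) (by norm_num), Real.norm_of_nonneg (by positivity)]
    simp [hL.le]
  -- lower bound for the function itself, where the cut-off equals `1`
  have hlow : ‖v‖ * (L / 2) ^ (1 / 2 : ℝ) ≤ ‖(u : L2 N)‖ := by
    have h1 : ‖indicatorConstLp (μ := (volume : Measure ℝ)) 2
        (measurableSet_Icc (a := s + L / 4) (b := s + 3 * L / 4)) (by simp) ‖v‖‖ ≤
        ‖(u : L2 N)‖ := by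
      refine Lp.norm_le_norm_of_ae_le ?_
      filter_upwards [hu, indicatorConstLp_coeFn (p := 2) (μ := (volume : Measure ℝ))
          (hs := measurableSet_Icc (a := s + L / 4) (b := s + 3 * L / 4)) (hμs := by simp)
          (c := ‖v‖)] with x h1 h2
      rw [h1, h2]
      by_cases hx : x ∈ Set.Icc (s + L / 4) (s + 3 * L / 4)
      · have h3 : χ ((x - s) / L) = 1 := by
          refine χ.one_of_mem_closedBall ?_
          rw [Real.closedBall_eq_Icc]
          constructor
          · rw [le_div_iff₀ hL]; norm_num; linarith [hx.1]
          · rw [div_le_iff₀ hL]; norm_num; linarith [hx.2]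
        rw [Set.indicator_of_mem hx]
        simp [hf, h3, norm_smul, hexp]
      · rw [Set.indicator_of_notMem hx]
        simp
    refine le_trans (le_of_eq ?_) h1
    rw [norm_indicatorConstLp (by norm_num) (by norm_num), norm_norm, Real.volume_real_Icc,
      max_eq_left (by linarith)]
    norm_num
    left
    congr 1
    ring
  have hvpos : 0 < ‖v‖ := norm_pos_iff.2 hv0
  have hpos : 0 < ‖(u : L2 N)‖ := lt_of_lt_of_le (by positivity) hlow
  refine ⟨u, fun h => by simp [h] at hpos, ?_, hup.trans ?_⟩
  · filter_upwards [hu] with x hx hxs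
    rw [hx]
    simp [hf, hχ0 x hxs]
  · have h1 : L ^ (1 / 2 : ℝ) ≤ 2 * (L / 2) ^ (1 / 2 : ℝ) := by
      rw [← Real.sqrt_eq_rpow, ← Real.sqrt_eq_rpow]
      refine Real.sqrt_le_iff.2 ⟨by positivity, ?_⟩
      rw [mul_pow, Real.sq_sqrt (by positivity)]
      linarith
    calc (M / L + δ) * ‖v‖ * L ^ (1 / 2 : ℝ)
        ≤ (M / L + δ) * ‖v‖ * (2 * (L / 2) ^ (1 / 2 : ℝ)) := by gcongr
      _ = 2 * (M / L + δ) * (‖v‖ * (L / 2) ^ (1 / 2 : ℝ)) := by ring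
      _ ≤ _ := by gcongr

/-- If `d/dx - a` is Fredholm and `a` is close to `B` on arbitrarily long intervals, then `B` has no
eigenvalues on the imaginary axis. -/
theorem isHyperbolic_of_isFredholm {a : ℝ →ᵇ Mat N} {B : Mat N}
    (h : IsFredholmIndexZero (diffOp a))
    (hB : ∀ δ > 0, ∀ L : ℝ, ∃ s, ∀ x ∈ Set.Icc s (s + L), ‖a x - B‖ ≤ δ) : IsHyperbolic B := by
  intro ν hν hre
  obtain ⟨v, hv⟩ := hν.exists_hasEigenvector
  have hBv : B v = ν • v := hv.apply_eq_smul
  obtain ⟨m, ε, hε, hm⟩ := exists_weyl_bound a h.1 h.2.1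
  obtain ⟨M, hM, hf⟩ := exists_approximate_eigenfunction (N := N)
  -- the cut-offs to `m` consecutive intervals of length `L` form an orthogonal system
  set L : ℝ := 4 * (M + 1) / ε with hL
  have hLpos : 0 < L := by positivity
  obtain ⟨s, hs⟩ := hB (ε / 4) (by positivity) (m * L)
  have hsub : ∀ i : Fin m, ∀ x ∈ Set.Icc (s + i * L) (s + i * L + L), ‖a x - B‖ ≤ ε / 4 := by
    intro i x hx
    have h1 : ((i : ℕ) : ℝ) + 1 ≤ m := by exact_mod_cast i.2
    refine hs x ⟨le_trans ?_ hx.1, hx.2.trans ?_⟩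
    · have : 0 ≤ ((i : ℕ) : ℝ) * L := by positivity
      linarith
    · nlinarith
  choose u hu0 husupp hub using fun i : Fin m =>
    hf a B ν v (s + i * L) L (ε / 4) hre hBv hv.2 hLpos (by positivity) (hsub i)
  obtain ⟨i, hi⟩ := hm u hu0 (by
    intro i j hij
    rw [L2.inner_def, ← integral_zero ℝ ℂ (μ := volume)]
    refine integral_congr_ae ?_
    filter_upwards [husupp i, husupp j] with x h1 h2
    by_cases hx : x ∈ Set.Ioo (s + i * L) (s + i * L + L)
    · rw [h2, inner_zero_right]
      intro hx'
      -- the intervals of two different indices do not overlap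
      rcases lt_or_gt_of_ne (fun h => hij (Fin.ext h) : (i : ℕ) ≠ j) with hlt | hlt
      · have h3 : ((i : ℕ) : ℝ) + 1 ≤ (j : ℕ) := by exact_mod_cast hlt
        nlinarith [hx.2, hx'.1]
      · have h3 : ((j : ℕ) : ℝ) + 1 ≤ (i : ℕ) := by exact_mod_cast hlt
        nlinarith [hx.1, hx'.2]
    · rw [h1 hx, inner_zero_left])
  refine absurd (hub i) (not_le.2 (lt_of_le_of_lt ?_ hi))
  gcongr
  have h1 : M / L ≤ ε / 4 := by
    rw [hL, div_le_iff₀ (by positivity)]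
    field_simp
    linarith
  linarith

theorem isHyperbolic_of_tendsto_atTop {a : ℝ →ᵇ Mat N} {B : Mat N}
    (h : IsFredholmIndexZero (diffOp a)) (hB : Tendsto a atTop (𝓝 B)) : IsHyperbolic B := by
  refine isHyperbolic_of_isFredholm h fun δ hδ L => ?_
  obtain ⟨s, hs⟩ := eventually_atTop.1 (Metric.tendsto_nhds.1 hB δ hδ)
  exact ⟨s, fun x hx => by rw [← dist_eq_norm]; exact (hs x hx.1).le⟩

theorem isHyperbolic_of_tendsto_atBot {a : ℝ →ᵇ Mat N} {B : Mat N}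
    (h : IsFredholmIndexZero (diffOp a)) (hB : Tendsto a atBot (𝓝 B)) : IsHyperbolic B := by
  refine isHyperbolic_of_isFredholm h fun δ hδ L => ?_
  obtain ⟨s, hs⟩ := eventually_atBot.1 (Metric.tendsto_nhds.1 hB δ hδ)
  exact ⟨s - L, fun x hx => by
    rw [← dist_eq_norm]; exact (hs x (by linarith [hx.2])).le⟩

/-! ### Root functions of the differential operator as jets of solutions -/

/-- The multiplication operator `mulOp`, as a continuous linear function of the coefficient. -/
def mulOpL (N : ℕ) : (ℝ →ᵇ Mat N) →L[ℂ] L2 N →L[ℂ] L2 N :=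
  LinearMap.mkContinuous₂ (LinearMap.mk₂ ℂ (fun a u => mulOp a u)
    (fun a b u => by
      apply Lp.ext
      filter_upwards [mulOp_coeFn (a + b) u, mulOp_coeFn a u, mulOp_coeFn b u,
        Lp.coeFn_add (mulOp a u) (mulOp b u)] with x h1 h2 h3 h4
      rw [h1, h4, Pi.add_apply, h2, h3]
      rfl)
    (fun c a u => by
      apply Lp.ext
      filter_upwards [mulOp_coeFn (c • a) u, mulOp_coeFn a u,
        Lp.coeFn_smul c (mulOp a u)] with x h1 h2 h3
      rw [h1, h3, Pi.smul_apply, h2]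
      rfl)
    (fun a u v => map_add _ u v) (fun c a u => map_smul _ c u)) 1
    (fun a u => by rw [one_mul]; exact norm_mulOp_le a u)

theorem mulOpL_apply (a : ℝ →ᵇ Mat N) (u : L2 N) : mulOpL N a u = mulOp a u := rfl

theorem opPencil_apply (A : ℂ → ℝ →ᵇ Mat N) (z : ℂ) (u : H1 N) :
    opPencil A z u = weakDeriv N u - mulOpL N (A z) u := rfl

section RootJets

variable {A : ℂ → ℝ →ᵇ Mat N} {z₀ : ℂ} {a : ℕ → ℝ →ᵇ Mat N} {p : ℕ}

/-- The coefficients of a root function solve the jet system in the weak sense. -/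
theorem mem_rootFunctions_opPencil (ha : IsTaylor A z₀ a) {u : Fin (p + 1) → H1 N} :
    u ∈ rootFunctions (opPencil A) z₀ p ↔
      ∀ m, weakDeriv N (u m) = conv (fun i => mulOpL N (a i)) (fun j => (u j : L2 N)) m := by
  have hF := ha.clm_comp (mulOpL N)
  have h1 := hF.apply_jetPoly fun j => (u j : L2 N)
  have h2 : ∀ z, opPencil A z (jetPoly z₀ u z) =
      jetPoly z₀ ((fun m => weakDeriv N (u m)) -
        conv (fun i => mulOpL N (a i)) (fun j => (u j : L2 N))) z -
      (mulOpL N (A z) (jetPoly z₀ (fun j => (u j : L2 N)) z) -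
        jetPoly z₀ (conv (fun i => mulOpL N (a i)) fun j => (u j : L2 N)) z) := by
    intro z
    rw [opPencil_apply, map_jetPoly, jetPoly_sub]
    have := map_jetPoly z₀ (H1 N).subtype u z
    simp only [Submodule.subtype_apply] at this
    rw [this]
    abel
  rw [mem_rootFunctions_iff]
  simp only [h2]
  have h3 := jetPoly_isBigO_iff (z₀ := z₀) (u := (fun m => weakDeriv N (u m)) -
        conv (fun i => mulOpL N (a i)) (fun j => (u j : L2 N)))
  rw [sub_eq_zero, funext_iff] at h3
  rw [← h3]
  exact ⟨fun h => (h.add h1).congr_left fun z => by abel, fun h => h.sub h1⟩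

theorem coeFn_conv_mulOpL {n : ℕ} (a : ℕ → ℝ →ᵇ Mat N) (u : Fin n → L2 N) {U : Fin n → ℝ → CN N}
    (hU : ∀ m, u m =ᵐ[volume] U m) (m : Fin n) :
    (conv (fun i => mulOpL N (a i)) u m : L2 N) =ᵐ[volume]
      fun x => conv (fun i => a i x) (fun j => U j x) m := by
  have h : ∀ᵐ x, ∀ j : Fin n, mulOp (a (m - j)) (u j) x = a (m - j) x (U j x) := by
    refine ae_all_iff.2 fun j => ?_
    filter_upwards [mulOp_coeFn (a (m - j)) (u j), hU j] with x h1 h2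
    rw [h1, h2]
  have hs : (conv (fun i => mulOpL N (a i)) u m : L2 N) =ᵐ[volume]
      ∑ j ∈ Finset.Iic m, ⇑(mulOp (a (m - j)) (u j)) := by
    unfold conv
    simp only [mulOpL_apply]
    exact Lp.coeFn_finsetSum _ _
  filter_upwards [h, hs] with x h1 h2
  rw [h2, Finset.sum_apply]
  exact Finset.sum_congr rfl fun j _ => h1 j

theorem continuous_conv {n : ℕ} (a : ℕ → ℝ →ᵇ Mat N) {U : Fin n → ℝ → CN N}
    (hU : ∀ m, Continuous (U m)) (m : Fin n) :
    Continuous fun x => conv (fun i => a i x) (fun j => U j x) m := by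
  unfold conv
  exact continuous_finsetSum _ fun j _ => (a _).continuous.clm_apply (hU j)

theorem continuous_primitive (u : L2 N) (c : CN N) :
    Continuous fun x => c + ∫ t in (0 : ℝ)..x, u t :=
  continuous_const.add (intervalIntegral.continuous_primitive (fun _ _ =>
    intervalIntegrable_of_locallyIntegrable ((Lp.memLp u).locallyIntegrable (by norm_num))) 0)

/-- The coefficients of a root function of `d/dx - A(·; z)` are classical solutions of the jet
system. -/
theorem exists_isJetSolution_of_mem (ha : IsTaylor A z₀ a) {u : Fin (p + 1) → H1 N}
    (hu : u ∈ rootFunctions (opPencil A) z₀ p) :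
    ∃ U, IsJetSolution a U ∧ ∀ m, (u m : L2 N) =ᵐ[volume] U m := by
  rw [mem_rootFunctions_opPencil ha] at hu
  choose c hc using fun m => (isWeakDeriv_weakDeriv (u m)).exists_ae_eq_primitive
  set U : Fin (p + 1) → ℝ → CN N := fun m x => c m + ∫ t in (0 : ℝ)..x, weakDeriv N (u m) t
  have hUc : ∀ m, Continuous (U m) := fun m => continuous_primitive _ _
  refine ⟨U, fun m x => ?_, hc⟩
  have hcont := continuous_conv a hUc m
  have hae : weakDeriv N (u m) =ᵐ[volume] fun x => conv (fun i => a i x) (fun j => U j x) m := by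
    rw [hu m]
    exact coeFn_conv_mulOpL a _ hc m
  have hU : U m = fun x => c m + ∫ t in (0 : ℝ)..x, conv (fun i => a i t) (fun j => U j t) m := by
    funext x
    change c m + _ = _
    congr 1
    exact intervalIntegral.integral_congr_ae (hae.mono fun x h _ => h)
  -- the integrand is continuous, so the fundamental theorem of calculus applies
  rw [hU]
  exact (intervalIntegral.integral_hasDerivAt_right (hcont.intervalIntegrable _ _)
    (hcont.stronglyMeasurableAtFilter _ _) hcont.continuousAt).const_add _

theorem exists_mem_of_isJetSolution (ha : IsTaylor A z₀ a) {U : Fin (p + 1) → ℝ → CN N}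
    (hU : IsJetSolution a U) (hL : ∀ m, MemLp (U m) 2) :
    ∃ u ∈ rootFunctions (opPencil A) z₀ p, ∀ m, (u m : L2 N) =ᵐ[volume] U m := by
  have hL' : ∀ m, MemLp (fun x => conv (fun i => a i x) (fun j => U j x) m) 2 := fun m =>
    (Lp.memLp _).ae_eq (coeFn_conv_mulOpL a (fun j => (hL j).toLp _)
      (fun j => (hL j).coeFn_toLp) m)
  choose u hu hu' using fun m => exists_H1_of_hasDerivAt (hU m) (hL m) (hL' m)
  refine ⟨u, (mem_rootFunctions_opPencil ha).2 fun m => Lp.ext ?_, hu⟩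
  filter_upwards [hu' m, coeFn_conv_mulOpL a (fun j => (u j : L2 N)) hu m] with x h1 h2
  rw [h1, h2]

theorem eq_of_ae_eq_primitive {u : H1 N} {c : CN N} {f : ℝ → CN N} (hf : Continuous f)
    (h1 : (u : L2 N) =ᵐ[volume] f)
    (h2 : (u : L2 N) =ᵐ[volume] fun x => c + ∫ t in (0 : ℝ)..x, weakDeriv N u t) : c = f 0 := by
  have := congrFun (((continuous_primitive _ c).ae_eq_iff_eq volume hf).1 (h2.symm.trans h1)) 0
  simpa using this

/-- The value at `0` of the continuous representative of a function in `H¹`. -/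
def trace (N : ℕ) : H1 N →ₗ[ℂ] CN N where
  toFun u := (isWeakDeriv_weakDeriv u).exists_ae_eq_primitive.choose
  map_add' u v := by
    have hu := (isWeakDeriv_weakDeriv u).exists_ae_eq_primitive.choose_spec
    have hv := (isWeakDeriv_weakDeriv v).exists_ae_eq_primitive.choose_spec
    set c := (isWeakDeriv_weakDeriv u).exists_ae_eq_primitive.choose
    set d := (isWeakDeriv_weakDeriv v).exists_ae_eq_primitive.choose
    have h := eq_of_ae_eq_primitive (u := u + v)
      ((continuous_primitive (weakDeriv N u) c).add (continuous_primitive (weakDeriv N v) d)) (by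
        filter_upwards [hu, hv, Lp.coeFn_add (u : L2 N) (v : L2 N)] with x h1 h2 h3
        rw [Submodule.coe_add, h3, Pi.add_apply, h1, h2]
        rfl) (isWeakDeriv_weakDeriv (u + v)).exists_ae_eq_primitive.choose_spec
    simpa using h
  map_smul' r u := by
    have hu := (isWeakDeriv_weakDeriv u).exists_ae_eq_primitive.choose_spec
    set c := (isWeakDeriv_weakDeriv u).exists_ae_eq_primitive.choose
    have h := eq_of_ae_eq_primitive (u := r • u)
      ((continuous_primitive (weakDeriv N u) c).const_smul r) (by
        filter_upwards [hu, Lp.coeFn_smul r (u : L2 N)] with x h1 h3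
        rw [Submodule.coe_smul, h3, Pi.smul_apply, h1]
        rfl)
      (isWeakDeriv_weakDeriv (r • u)).exists_ae_eq_primitive.choose_spec
    simpa using h

theorem trace_eq {u : H1 N} {f : ℝ → CN N} (hf : Continuous f)
    (h : (u : L2 N) =ᵐ[volume] f) : trace N u = f 0 :=
  eq_of_ae_eq_primitive hf h (isWeakDeriv_weakDeriv u).exists_ae_eq_primitive.choose_spec

/-- The space of root functions of `d/dx - A(·; z)` has the dimension of the space of initial
values at `0` of the square integrable solutions of the jet system. -/
theorem rank_rootFunctions_opPencil (ha : IsTaylor A z₀ a)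
    {R : Submodule ℂ (Fin (p + 1) → CN N)}
    (hR : ∀ U : Fin (p + 1) → ℝ → CN N, IsJetSolution a U →
      ((∀ m, MemLp (U m) 2) ↔ (fun m => U m 0) ∈ R)) :
    Module.rank ℂ (rootFunctions (opPencil A) z₀ p) = Module.rank ℂ R := by
  set T : rootFunctions (opPencil A) z₀ p →ₗ[ℂ] (Fin (p + 1) → CN N) :=
    (LinearMap.compLeft (trace N) (Fin (p + 1))).domRestrict _ with hT
  have hTapp : ∀ u m, T u m = trace N (u.1 m) := fun u m => rfl
  have hinj : Function.Injective T := by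
    intro u v huv
    obtain ⟨U, hU, hUu⟩ := exists_isJetSolution_of_mem ha u.2
    obtain ⟨V, hV, hVv⟩ := exists_isJetSolution_of_mem ha v.2
    have h : U = V := hU.ext hV fun m => by
      rw [← trace_eq (hU.continuous m) (hUu m), ← trace_eq (hV.continuous m) (hVv m)]
      exact congrFun huv m
    ext m : 3
    exact Lp.ext ((hUu m).trans (h ▸ (hVv m).symm))
  have hrange : LinearMap.range T = R := by
    ext b
    constructor
    · rintro ⟨u, rfl⟩
      obtain ⟨U, hU, hUu⟩ := exists_isJetSolution_of_mem ha u.2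
      have : T u = fun m => U m 0 := funext fun m => trace_eq (hU.continuous m) (hUu m)
      rw [this, ← hR U hU]
      exact fun m => (Lp.memLp _).ae_eq (hUu m)
    · intro hb
      obtain ⟨U, hU, hUb⟩ := exists_jetSolution a b
      have hb' : (fun m => U m 0) = b := funext hUb
      obtain ⟨u, hu, huU⟩ := exists_mem_of_isJetSolution ha hU ((hR U hU).2 (hb' ▸ hb))
      exact ⟨⟨u, hu⟩, funext fun m => (trace_eq (hU.continuous m) (huU m)).trans (hUb m)⟩
  rw [← hrange, rank_range_of_injective T hinj]

/-! ### Reflection of the line -/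

/-- The coefficient `x ↦ -a(-x)` of the equation for `u(-x)`, as a linear function of `a`. -/
def reflect (N : ℕ) : (ℝ →ᵇ Mat N) →L[ℂ] (ℝ →ᵇ Mat N) :=
  LinearMap.mkContinuous
    { toFun := fun a : ℝ →ᵇ Mat N => -a.compContinuous ⟨fun x => -x, continuous_neg⟩
      map_add' := fun a b => by ext; simp [add_comm]
      map_smul' := fun c a => by ext; simp } 1 fun a => by
    rw [one_mul]
    refine (BoundedContinuousFunction.norm_le (norm_nonneg a)).2 fun x => ?_
    simpa using a.norm_coe_le_norm (-x)

theorem reflect_apply (a : ℝ →ᵇ Mat N) (x : ℝ) : reflect N a x = -a (-x) := rfl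

theorem analyticAt_reflect (hA : AnalyticAt ℂ A z₀) :
    AnalyticAt ℂ (fun z => reflect N (A z)) z₀ :=
  analyticAt_clm_comp (F := ℝ →ᵇ Mat N) hA (reflect N)

theorem IsTaylor.reflect (ha : IsTaylor A z₀ a) :
    IsTaylor (fun z => PointwiseEvans.reflect N (A z)) z₀
      fun i => PointwiseEvans.reflect N (a i) := by
  have h := ha.clm_comp (F := ℝ →ᵇ Mat N) (PointwiseEvans.reflect N)
  exact h

theorem IsJetSolution.reflect {n : ℕ} {U : Fin n → ℝ → CN N} (hU : IsJetSolution a U) :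
    IsJetSolution (fun i => reflect N (a i)) fun m x => U m (-x) := fun m x => by
  refine (hasDerivAt_comp_neg (hU m (-x))).congr_deriv ?_
  simp [conv, reflect_apply]

theorem maxGenEigenspace_neg (f : Module.End ℂ (CN N)) (ν : ℂ) :
    Module.End.maxGenEigenspace (-f) ν = Module.End.maxGenEigenspace f (-ν) := by
  ext v
  have h : -f - ν • 1 = -(f - (-ν) • 1) := by
    rw [neg_smul]
    abel
  simp only [Module.End.mem_maxGenEigenspace, h]
  refine exists_congr fun k => ?_
  rcases Nat.even_or_odd k with hk | hk <;>
    simp only [hk.neg_pow, LinearMap.neg_apply, neg_eq_zero]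

theorem stableSpace_neg (B : Mat N) : stableSpace (-B) = unstableSpace B := by
  have h : ((-B : Mat N) : Module.End ℂ (CN N)) = -(B : Module.End ℂ (CN N)) := rfl
  unfold stableSpace unstableSpace
  simp only [h, maxGenEigenspace_neg]
  refine (Equiv.neg ℂ).iSup_congr fun ν => ?_
  simp

theorem IsHyperbolic.neg {B : Mat N} (hB : IsHyperbolic B) : IsHyperbolic (-B) := by
  intro ν hν h0
  obtain ⟨v, hv⟩ := hν.exists_hasEigenvector
  have h1 : -B v = ν • v := hv.apply_eq_smul
  refine hB (-ν) (Module.End.hasEigenvalue_of_hasEigenvector (x := v)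
    (Module.End.hasEigenvector_iff.2 ⟨Module.End.mem_eigenspace_iff.2 ?_, hv.2⟩)) (by simp [h0])
  rw [neg_smul, ← h1, neg_neg]
  rfl

/-- Reflection turns the unstable family at `-∞` into a stable family at `+∞`. -/
theorem IsUnstableFamily.reflect {a : ℝ →ᵇ Mat N} {B : Mat N} {E : ℝ → Submodule ℂ (CN N)}
    (h : IsUnstableFamily a B E) :
    IsStableFamily (PointwiseEvans.reflect N a) (-B) fun x => E (-x) := by
  refine ⟨fun u hu x y hx => ?_, ?_⟩
  · have := h.1 (fun x => u (-x)) (fun x => (hasDerivAt_comp_neg (hu (-x))).congr_deriv (by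
      simp [reflect_apply])) (-x) (-y) (by simpa using hx)
    simpa using this
  · rw [stableSpace_neg]
    exact h.2.comp tendsto_neg_atTop_atBot

theorem memLp_iff_l2AtTop {u : ℝ → CN N} (hu : Continuous u) :
    MemLp u 2 ↔ L2AtTop u ∧ L2AtTop fun x => u (-x) := by
  have hu' : Continuous fun x => u (-x) := hu.comp continuous_neg
  rw [L2AtTop, L2AtTop, memLp_two_iff_integrable_sq_norm hu.aestronglyMeasurable,
    memLp_two_iff_integrable_sq_norm hu.aestronglyMeasurable,
    memLp_two_iff_integrable_sq_norm hu'.aestronglyMeasurable]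
  change _ ↔ IntegrableOn (fun x => ‖u x‖ ^ 2) (Set.Ioi 0) volume ∧
    IntegrableOn ((fun x => ‖u x‖ ^ 2) ∘ Neg.neg) (Set.Ioi 0) volume
  have h1 : Set.Ioi (0 : ℝ) = Neg.neg ⁻¹' Set.Iio 0 := by simp
  conv_rhs => rw [and_comm, h1]
  rw [(Measure.measurePreserving_neg (volume : Measure ℝ)).integrableOn_comp_preimage
    (MeasurableEquiv.neg ℝ).measurableEmbedding, ← integrableOn_Iic_iff_integrableOn_Iio,
    ← h1, ← integrableOn_union, Set.Iic_union_Ioi, integrableOn_univ]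

end RootJets

/-! ### The matching pencil -/

/-- The matrix with columns `w j`. -/
def colMap (w : Fin N → CN N) : Mat N :=
  ∑ j, (EuclideanSpace.proj j : CN N →L[ℂ] ℂ).smulRight (w j)

theorem colMap_apply (w : Fin N → CN N) (c : CN N) : colMap w c = ∑ j, c j • w j := by
  simp [colMap]

/-- The projection of `ℂᴺ` onto the coordinates in `s`. -/
def coordProj (s : Finset (Fin N)) : Mat N :=
  LinearMap.toContinuousLinearMap
    { toFun := fun c => WithLp.toLp 2 fun j => if j ∈ s then c j else 0
      map_add' := fun c d => by ext j; by_cases h : j ∈ s <;> simp [h]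
      map_smul' := fun r c => by ext j; by_cases h : j ∈ s <;> simp [h] }

theorem coordProj_apply (s : Finset (Fin N)) (c : CN N) (j : Fin N) :
    coordProj s c j = if j ∈ s then c j else 0 := rfl

theorem colMap_coordProj (w : Fin N → CN N) (s : Finset (Fin N)) (c : CN N) :
    colMap w (coordProj s c) = ∑ j ∈ s, c j • w j := by
  simp [colMap_apply, coordProj_apply, ite_smul]

theorem coordProj_coordProj (s : Finset (Fin N)) (c : CN N) :
    coordProj s (coordProj s c) = coordProj s c := by
  ext j
  by_cases h : j ∈ s <;> simp [coordProj_apply, h]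

theorem coordProj_of_disjoint {s t : Finset (Fin N)} (h : Disjoint s t) (c : CN N) :
    coordProj s (coordProj t c) = 0 := by
  ext j
  by_cases hj : j ∈ s
  · simp [coordProj_apply, Finset.disjoint_left.1 h hj]
  · simp [coordProj_apply, hj]

theorem IsBasisOf.range_colMap {w : Fin N → CN N} {s : Finset (Fin N)}
    {E : Submodule ℂ (CN N)} (h : IsBasisOf w s E) :
    LinearMap.range (colMap w ∘L coordProj s : CN N →ₗ[ℂ] CN N) = E := by
  rw [← h.2]
  refine le_antisymm ?_ (Submodule.span_le.2 ?_)
  · rintro _ ⟨c, rfl⟩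
    change colMap w (coordProj s c) ∈ _
    rw [colMap_coordProj]
    exact Submodule.sum_mem _ fun j hj => Submodule.smul_mem _ _
      (Submodule.subset_span (Set.mem_image_of_mem _ hj))
  · rintro _ ⟨j, hj, rfl⟩
    refine ⟨EuclideanSpace.single j 1, ?_⟩
    change colMap w (coordProj s _) = _
    rw [colMap_coordProj, Finset.sum_eq_single_of_mem j hj]
    · simp
    · intro i _ hij
      simp [hij]

theorem IsBasisOf.coordProj_eq_zero {w : Fin N → CN N} {s : Finset (Fin N)}
    {E : Submodule ℂ (CN N)} (h : IsBasisOf w s E) {c : CN N}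
    (hc : colMap w (coordProj s c) = 0) : coordProj s c = 0 := by
  rw [colMap_coordProj] at hc
  have := linearIndepOn_finset_iff.1 h.1 (fun j => c j) hc
  ext j
  by_cases hj : j ∈ s
  · simp [coordProj_apply, this j hj]
  · simp [coordProj_apply, hj]

/-- The indices of the basis of the unstable subspace. -/
def lowIdx (N k : ℕ) : Finset (Fin N) := Finset.univ.filter fun j => (j : ℕ) < k

/-- The indices of the basis of the stable subspace. -/
def highIdx (N k : ℕ) : Finset (Fin N) := Finset.univ.filter fun j => k ≤ (j : ℕ)

theorem coe_lowIdx (N k : ℕ) : (lowIdx N k : Set (Fin N)) = {j : Fin N | (j : ℕ) < k} := by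
  ext; simp [lowIdx]

theorem coe_highIdx (N k : ℕ) : (highIdx N k : Set (Fin N)) = {j : Fin N | k ≤ (j : ℕ)} := by
  ext; simp [highIdx]

theorem disjoint_lowIdx (N k : ℕ) : Disjoint (lowIdx N k) (highIdx N k) :=
  Finset.disjoint_left.2 fun j h1 h2 => by
    simp only [lowIdx, highIdx, Finset.mem_filter_univ] at h1 h2
    omega

theorem coordProj_low_add_high (k : ℕ) (c : CN N) :
    coordProj (lowIdx N k) c + coordProj (highIdx N k) c = c := by
  ext j
  by_cases h : (j : ℕ) < k <;> simp [coordProj_apply, lowIdx, highIdx, h]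

/-- The part `c ↦ ∑_{j ∈ s} c_j w_j(z)` of the trivialization of the matching pencil. -/
def colPart (s : Finset (Fin N)) (w : Fin N → ℂ → CN N) (z : ℂ) : Mat N :=
  colMap (fun j => w j z) ∘L coordProj s

theorem matchPencil_eq_clmPencil (k : ℕ) (w : Fin N → ℂ → CN N) :
    matchPencil k w =
      clmPencil fun z => colPart (lowIdx N k) w z - colPart (highIdx N k) w z := by
  funext z
  ext1 c
  change _ = colMap _ (coordProj _ c) - colMap _ (coordProj _ c)
  rw [colMap_coordProj, colMap_coordProj]
  rfl

theorem analyticAt_colMap {w : Fin N → ℂ → CN N} {z : ℂ} (hw : ∀ j, AnalyticAt ℂ (w j) z) :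
    AnalyticAt ℂ (fun z => colMap fun j => w j z) z := by
  unfold colMap
  refine Finset.analyticAt_fun_sum _ fun j _ => ?_
  exact ((ContinuousLinearMap.smulRightL ℂ (CN N) (CN N)
    (EuclideanSpace.proj j : CN N →L[ℂ] ℂ)).analyticAt _).comp (hw j)

theorem analyticAt_colPart {w : Fin N → ℂ → CN N} {z : ℂ} (hw : ∀ j, AnalyticAt ℂ (w j) z)
    (s : Finset (Fin N)) : AnalyticAt ℂ (colPart s w) z :=
  (((ContinuousLinearMap.compL ℂ (CN N) (CN N) (CN N)).flip (coordProj s)).analyticAt _).comp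
    (analyticAt_colMap hw)

theorem IsTaylor.colPart {w : Fin N → ℂ → CN N} {z₀ : ℂ} {ν : ℕ → Mat N}
    (h : IsTaylor (fun z => colMap fun j => w j z) z₀ ν) (s : Finset (Fin N)) :
    IsTaylor (colPart s w) z₀ fun i => ν i ∘L coordProj s :=
  h.clm_comp ((ContinuousLinearMap.compL ℂ (CN N) (CN N) (CN N)).flip (coordProj s))

/-- A jet in the coordinates `s` is determined by its image. Only linear independence at `z₀` is used:
the lowest coefficient of the image is the image under the matrix at `z₀`. -/
theorem coordProj_eq_zero_of_conv {n : ℕ} {w : Fin N → ℂ → CN N} {z₀ : ℂ} {ν : ℕ → Mat N}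
    (h : IsTaylor (fun z => colMap fun j => w j z) z₀ ν) {s : Finset (Fin N)}
    {E : Submodule ℂ (CN N)} (hE : IsBasisOf (fun j => w j z₀) s E) {c : Fin n → CN N}
    (hc : conv ν (fun m => coordProj s (c m)) = 0) (m : Fin n) : coordProj s (c m) = 0 := by
  induction m using WellFoundedLT.induction with
  | ind m ih =>
    have h1 := congrFun hc m
    unfold conv at h1
    rw [Finset.sum_eq_single m] at h1
    · rw [Nat.sub_self, h.coeff_zero] at h1
      exact hE.coordProj_eq_zero h1
    · intro j hj hjm
      change ν _ (coordProj s (c j)) = 0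
      rw [ih j (lt_of_le_of_ne (Finset.mem_Iic.1 hj) hjm), map_zero]
    · simp

/-- The root functions of the matching pencil correspond to the jets which are sections of both
bundles. -/
theorem rank_rootFunctions_matchPencil {k : ℕ} {w : Fin N → ℂ → CN N} {z₀ : ℂ} {ν : ℕ → Mat N}
    (h : IsTaylor (fun z => colMap fun j => w j z) z₀ ν) {Eu Es : Submodule ℂ (CN N)}
    (hu : IsBasisOf (fun j => w j z₀) (lowIdx N k) Eu)
    (hs : IsBasisOf (fun j => w j z₀) (highIdx N k) Es) (p : ℕ) :
    Module.rank ℂ (rootFunctions (matchPencil k w) z₀ p) =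
      Module.rank ℂ ↥(LinearMap.range (convₗ (p + 1) fun i => ν i ∘L coordProj (lowIdx N k)) ⊓
        LinearMap.range (convₗ (p + 1) fun i => ν i ∘L coordProj (highIdx N k))) := by
  have hmem : ∀ c, c ∈ rootFunctions (matchPencil k w) z₀ p ↔
      conv ν (fun m => coordProj (lowIdx N k) (c m)) =
        conv ν (fun m => coordProj (highIdx N k) (c m)) := by
    intro c
    rw [mem_rootFunctions_iff, matchPencil_eq_clmPencil]
    have h1 := ((h.colPart (lowIdx N k)).sub (h.colPart (highIdx N k))).apply_jetPoly_isBigO_iff c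
    rw [conv_sub_left, sub_eq_zero] at h1
    exact h1
  set T : rootFunctions (matchPencil k w) z₀ p →ₗ[ℂ] (Fin (p + 1) → CN N) :=
    (convₗ (p + 1) fun i => ν i ∘L coordProj (lowIdx N k)).domRestrict _ with hT
  have hTapp : ∀ c, T c = conv ν fun m => coordProj (lowIdx N k) (c.1 m) := fun c => rfl
  have hinj : Function.Injective T := by
    rw [← LinearMap.ker_eq_bot, LinearMap.ker_eq_bot']
    intro c hc
    rw [hTapp] at hc
    have hc' := hc
    rw [(hmem c).1 c.2] at hc'
    ext1
    funext m
    change c.1 m = 0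
    rw [← coordProj_low_add_high k (c.1 m), coordProj_eq_zero_of_conv h hu hc m,
      coordProj_eq_zero_of_conv h hs hc' m, add_zero]
  have hrange : LinearMap.range T =
      LinearMap.range (convₗ (p + 1) fun i => ν i ∘L coordProj (lowIdx N k)) ⊓
        LinearMap.range (convₗ (p + 1) fun i => ν i ∘L coordProj (highIdx N k)) := by
    ext b
    constructor
    · rintro ⟨c, rfl⟩
      exact ⟨⟨c, rfl⟩, ⟨c, ((hmem c).1 c.2).symm⟩⟩
    · rintro ⟨⟨c, rfl⟩, ⟨d, hd⟩⟩
      -- take the coordinates `j < k` from `c` and the others from `d`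
      set e : Fin (p + 1) → CN N := fun m =>
        coordProj (lowIdx N k) (c m) + coordProj (highIdx N k) (d m) with he
      have e1 : ∀ m, coordProj (lowIdx N k) (e m) = coordProj (lowIdx N k) (c m) := fun m => by
        simp only [he, map_add, coordProj_coordProj,
          coordProj_of_disjoint (disjoint_lowIdx N k), add_zero]
      have e2 : ∀ m, coordProj (highIdx N k) (e m) = coordProj (highIdx N k) (d m) := fun m => by
        simp only [he, map_add, coordProj_coordProj,
          coordProj_of_disjoint (disjoint_lowIdx N k).symm, zero_add]
      refine ⟨⟨e, (hmem e).2 ?_⟩, ?_⟩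
      · simp only [e1, e2]
        exact hd.symm
      · rw [hTapp]
        simp only [e1]
        rfl
  rw [← hrange, rank_range_of_injective T hinj]

/-! ### Comparison of the multiplicities -/

/-- The stable family at `x = 0`, trivialized by `M`, consists of the initial values of decaying
solutions, for all parameters near `z₀`. -/
theorem isDecayBundle_of_isStableFamily {Ω : Set ℂ} (hΩ : IsOpen Ω) {A : ℂ → ℝ →ᵇ Mat N}
    (hA : ∀ z ∈ Ω, AnalyticAt ℂ A z) {M : ℂ → Mat N} (hM : ∀ z ∈ Ω, AnalyticAt ℂ M z)
    {B : ℂ → Mat N} (hB : ∀ z ∈ Ω, IsHyperbolic (B z))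
    (hlim : ∀ z ∈ Ω, Tendsto (A z) atTop (𝓝 (B z))) {E : ℂ → ℝ → Submodule ℂ (CN N)}
    (hE : ∀ z ∈ Ω, IsStableFamily (A z) (B z) (E z))
    (hr : ∀ z ∈ Ω, LinearMap.range (M z : CN N →ₗ[ℂ] CN N) = E z 0) {z₀ : ℂ} (hz₀ : z₀ ∈ Ω) :
    IsDecayBundle A M z₀ := by
  have hnear : ∀ᶠ z in 𝓝 z₀, z ∈ Ω := hΩ.mem_nhds hz₀
  refine ⟨hnear.mono hA, hnear.mono hM,
    hnear.mono fun z hz => (hr z hz).trans ((hE z hz).eq_decaySpace (hB z hz) (hlim z hz)), ?_⟩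
  -- a Lyapunov form at `z₀` serves all nearby `z`
  obtain ⟨H, hH⟩ := (hB z₀ hz₀).exists_isLyapunov
  set ε : ℝ := 1 / (2 * (‖H‖ + 1)) with hε
  have hε0 : 0 < ε := by positivity
  obtain ⟨x₁, hx₁⟩ := eventually_atTop.1
    (Metric.tendsto_nhds.1 (hlim z₀ hz₀) (ε / 2) (half_pos hε0))
  refine ⟨H, max x₁ 0, le_max_right _ _, ?_⟩
  filter_upwards [Metric.tendsto_nhds.1 (hA z₀ hz₀).continuousAt (ε / 2) (half_pos hε0)] with z hz
  refine hH.isLyapunovFrom fun x hx => ?_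
  have h1 := (BoundedContinuousFunction.dist_coe_le_dist x).trans_lt hz
  have h2 := hx₁ x ((le_max_left _ _).trans hx)
  rw [← dist_eq_norm]
  exact (dist_triangle _ (A z₀ x) _).trans (by linarith)

/-- The geometric multiplicity is the dimension of the space of root functions of order `0`. -/
theorem geometricMultiplicity_eq_rank {X Y : Type*} [AddCommGroup X] [Module ℂ X]
    [NormedAddCommGroup Y] [NormedSpace ℂ Y] {T : ℂ → X →ₗ[ℂ] Y} {z₀ : ℂ}
    (hT : ∀ x, DifferentiableAt ℂ (fun z => T z x) z₀) :
    geometricMultiplicity T z₀ = Cardinal.toENat (Module.rank ℂ (rootFunctions T z₀ 0)) := by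
  have h : rootFunctions T z₀ 0 = (LinearMap.ker (T z₀)).comap
      (LinearEquiv.funUnique (Fin 1) ℂ X).toLinearMap := by
    ext u
    rw [mem_rootFunctions_iff, Submodule.mem_comap, LinearMap.mem_ker]
    have e : ∀ z, jetPoly z₀ u z = u 0 := fun z => by simp [jetPoly]
    simp only [e, zero_add, pow_one]
    change _ ↔ T z₀ (u 0) = 0
    constructor
    · intro h
      obtain ⟨C, hC⟩ := h.bound
      simpa using hC.self_of_nhds
    · intro h
      have := (hT (u 0)).isBigO_sub
      simpa [h] using this
  rw [geometricMultiplicity, h]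
  congr 1
  exact (LinearEquiv.ofSubmodule' (LinearEquiv.funUnique (Fin 1) ℂ X) _).rank_eq.symm

end PointwiseEvans

end

open PointwiseEvans

theorem proposition2p3 {N : ℕ} (Ω : Set ℂ) (hΩ : IsOpen Ω)
    -- coefficients: bounded and continuous in `x`, analytic in `z`, locally uniformly bounded
    (A : ℂ → ℝ →ᵇ PointwiseEvans.Mat N)
    (hA : ∀ x : ℝ, AnalyticOnNhd ℂ (fun z => A z x) Ω)
    (hA_bdd : ∀ z₀ ∈ Ω, ∃ M : ℝ, ∀ᶠ z in 𝓝 z₀, ‖A z‖ ≤ M)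
    -- asymptotically constant coefficients
    (Am Ap : ℂ → PointwiseEvans.Mat N)
    (hAm : ∀ z ∈ Ω, Tendsto (fun x => A z x) atBot (𝓝 (Am z)))
    (hAp : ∀ z ∈ Ω, Tendsto (fun x => A z x) atTop (𝓝 (Ap z)))
    -- `d/dx - A(·; z)` is Fredholm of index zero in the region
    (hT : ∀ z ∈ Ω, PointwiseEvans.IsFredholmIndexZero (PointwiseEvans.opPencil A z))
    -- the subspaces `E^u_-(x; z)` and `E^s_+(x; z)`
    (Eu Es : ℂ → ℝ → Submodule ℂ (PointwiseEvans.CN N))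
    (hEu : ∀ z ∈ Ω, PointwiseEvans.IsUnstableFamily (A z) (Am z) (Eu z))
    (hEs : ∀ z ∈ Ω, PointwiseEvans.IsStableFamily (A z) (Ap z) (Es z))
    -- the analytic bases of these subspaces at `x = 0` from which `ι` is built
    (k : ℕ) (w : Fin N → ℂ → PointwiseEvans.CN N)
    (hw : ∀ j, AnalyticOnNhd ℂ (w j) Ω)
    (hwu : ∀ z ∈ Ω, PointwiseEvans.IsBasisOf (fun j => w j z) {j | (j : ℕ) < k} (Eu z 0))
    (hws : ∀ z ∈ Ω, PointwiseEvans.IsBasisOf (fun j => w j z) {j | k ≤ (j : ℕ)} (Es z 0)) :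
    ∀ z₀ ∈ Ω,
      PointwiseEvans.geometricMultiplicity (PointwiseEvans.opPencil A) z₀ =
          PointwiseEvans.geometricMultiplicity (PointwiseEvans.matchPencil k w) z₀ ∧
      PointwiseEvans.algebraicMultiplicity (PointwiseEvans.opPencil A) z₀ =
          PointwiseEvans.algebraicMultiplicity (PointwiseEvans.matchPencil k w) z₀ ∧
      PointwiseEvans.algebraicMultiplicity (PointwiseEvans.opPencil A) z₀ =
          analyticOrderAt (PointwiseEvans.evans k w) z₀ := by
  intro z₀ hz₀
  have hAan : ∀ z ∈ Ω, AnalyticAt ℂ A z := fun z hz =>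
    analyticAt_of_pointwise hΩ hA hz (hA_bdd z hz)
  have hwan : ∀ z ∈ Ω, ∀ j, AnalyticAt ℂ (w j) z := fun z hz j => hw j z hz
  simp only [← coe_lowIdx] at hwu
  simp only [← coe_highIdx] at hws
  -- the two ends of the line; the end `-∞` is reflected
  have Dp : IsDecayBundle A (colPart (highIdx N k) w) z₀ :=
    isDecayBundle_of_isStableFamily hΩ hAan (fun z hz => analyticAt_colPart (hwan z hz) _)
      (fun z hz => isHyperbolic_of_tendsto_atTop (hT z hz) (hAp z hz)) hAp hEs
      (fun z hz => (hws z hz).range_colMap) hz₀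
  have Dm : IsDecayBundle (fun z => reflect N (A z)) (colPart (lowIdx N k) w) z₀ :=
    isDecayBundle_of_isStableFamily hΩ (fun z hz => analyticAt_reflect (hAan z hz))
      (fun z hz => analyticAt_colPart (hwan z hz) _)
      (fun z hz => (isHyperbolic_of_tendsto_atBot (hT z hz) (hAm z hz)).neg)
      (fun z hz => ((hAm z hz).comp tendsto_neg_atTop_atBot).neg)
      (fun z hz => (hEu z hz).reflect)
      (fun z hz => by rw [neg_zero]; exact (hwu z hz).range_colMap) hz₀
  obtain ⟨a, ha⟩ := exists_isTaylor (hAan z₀ hz₀)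
  obtain ⟨ν, hν⟩ := exists_isTaylor (analyticAt_colMap (hwan z₀ hz₀))
  have hrank : ∀ p, Module.rank ℂ (rootFunctions (opPencil A) z₀ p) =
      Module.rank ℂ (rootFunctions (matchPencil k w) z₀ p) := by
    intro p
    rw [rank_rootFunctions_matchPencil hν (hwu z₀ hz₀) (hws z₀ hz₀)]
    refine rank_rootFunctions_opPencil ha fun U hU => ?_
    -- a jet solution is square integrable on `ℝ` iff its value at `0` is a jet of both bundles
    have hp := Dp.l2AtTop_jet_iff ha (hν.colPart _) hU
    have hm := Dm.l2AtTop_jet_iff (IsTaylor.reflect ha) (hν.colPart _) hU.reflect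
    simp only [neg_zero] at hm
    simp only [fun m => memLp_iff_l2AtTop (hU.continuous m), forall_and, hp, hm]
    rw [and_comm]
    exact and_congr (exists_congr fun c => eq_comm) (exists_congr fun c => eq_comm)
  have halg : algebraicMultiplicity (opPencil A) z₀ =
      algebraicMultiplicity (matchPencil k w) z₀ := by
    simp only [algebraicMultiplicity, hrank]
  have hMan : AnalyticAt ℂ (fun z => colPart (lowIdx N k) w z - colPart (highIdx N k) w z) z₀ :=
    (analyticAt_colPart (hwan z₀ hz₀) _).sub (analyticAt_colPart (hwan z₀ hz₀) _)
  refine ⟨?_, halg, ?_⟩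
  · rw [geometricMultiplicity_eq_rank, geometricMultiplicity_eq_rank, hrank]
    · intro c
      rw [matchPencil_eq_clmPencil]
      exact (analyticAt_clm_apply hMan analyticAt_const).differentiableAt
    · intro u
      simp only [opPencil_apply]
      exact (analyticAt_const.sub (analyticAt_clm_apply
        (analyticAt_clm_comp (hAan z₀ hz₀) (mulOpL N)) analyticAt_const)).differentiableAt
  · rw [halg]
    have h := algebraicMultiplicity_clmPencil hMan
    rw [← matchPencil_eq_clmPencil] at h
    exact h
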